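/- Let $M$ be a closed smooth manifold of dimension $d$, and let $T^*M$ carry its tautological $1$-form $\lambda$ and the symplectic form $\omega=-d\lambda$ (so $\omega=dq\wedge dp$ in canonical coordinates). Let $V(x)=\ker d\pi_x$ be the vertical subspace of $T_x(T^*M)$, where $\pi:T^*M\to M$ is the projection; let $\Lambda$ be the bundle of Lagrangian subspaces of the tangent spaces of $T^*M$, let $\Sigma=\{L\in\Lambda_x:\ L\cap V(x)\neq 0\}$ be the singular cycle and $\Sigma_1=\{L\in\Lambda_x:\ \dim (L\cap V(x))=1\}$. *Charts.* A vertically foliated chart is a Darboux chart $F=(F_1,F_2):\mathcal U\subset T^*M\to\mathbb R^d\times\mathbb R^d$ (i.e. $F^*(dq\wedge dp)=\omega$) whose image is a product $I^d\times J^d$ with $I,J$ intervals and such that $F(T^*_{\pi(x)}M\cap\mathcal U)=\{F_1(x)\}\times J^d$ for all $x\in\mathcal U$. *Isotopies and twist.* Let $(\phi_t)_{t\in\mathbb R}$ be a smooth isotopy of conformally symplectic diffeomorphisms of $T^*M$: $(t,x)\mapsto\phi_t(x)$ is smooth and for each $t$ one has $\phi_t^*\omega=a(t)\,\omega$ for a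 constant $a(t)$ (it is not required that $\phi_0=\mathrm{Id}$). It twists the vertical if for every $(t_0,x_0)$ there are $\varepsilon>0$, $a>0$ and a vertically foliated chart $F:\mathcal U\to(-a,a)^d\times(-a,a)^d$ onto, with $F(x_0)=0$, such that for all $t\in(t_0-\varepsilon,t_0+\varepsilon)$ the set $\mathcal G_t=\phi_t\circ\phi_{t_0}^{-1}\big(F^{-1}(\{0\}\times(-\frac a2,\frac a2)^d)\big)$ is contained in $\mathcal U$ and $F(\mathcal G_t)$ is the graph $\{(dg_t(p),p):p\in D_t\}$ of the differential of a differentiable function $g_t$ on an open set $D_t\subset\mathbb R^d$, where $g_t$ is (locally, not necessarily strictly) convex if $t\ge t_0$ and concave if $t\le t_0$. *Maslov index.* For Lagrangian subspaces $L_1,L_2$ transverse to $K$ in a symplectic vector space $(E,\Omega)$, the height is the quadratic form $\mathcal Q_K(L_1,L_2)(v)=\Omega\big((P^K|_{L_1})^{-1}v,(P^K|_{L_2})^{-1}v\big)$ on $E/K$, where $P^K:E\to E/K$ is the projection; its index is the maximal dimension of a subspace on which it is negative definite. A crossing $t_0$ of a path $\Gamma$ in $\Lambda$ (a time with $\Gamma(t_0)\in\Sigma$)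 is positive if $\Gamma(t_0)\in\Sigma_1$, $\Gamma(t)\notin\Sigma$ for $t\ne t_0$ near $t_0$, and for a vertically foliated chart $F$ around the base point of $\Gamma(t_0)$ such that $K=\ker dF_2$ is transverse to $\Gamma(t_0)$, one has, with $n$ the index of $\mathcal Q_K(V,\Gamma(t_0))$, that the index of $\mathcal Q_K(V,\Gamma(t))$ is $n+1$ for $t<t_0$ close to $t_0$ and $n$ for $t>t_0$ close to $t_0$; it is negative if it is positive after reversal of time. A smooth path $\Gamma:[\alpha,\beta]\to\Lambda$ is in general position if its endpoints are not in $\Sigma$ and each of its crossings is positive or negative; then $\mathrm{MI}(\Gamma)$ is the number of positive crossings minus the number of negative ones. If $\Gamma$ is any $C^1$ path in $\Lambda$ with endpoints not in $\Sigma$, then $\mathrm{MI}(\Gamma)$ is the common value of $\mathrm{MI}(\tilde\Gamma)$ for all smooth paths $\tilde\Gamma$ in general position that are sufficiently $C^1$-close to $\Gamma$ (such paths exist arbitrarily close to $\Gamma$). For $L\in\Lambda$ with $D\phi_\alpha(L),D\phi_\beta(L)\notin\Sigma$, set $\mathrm{DMI}(L,(\phi_t)_{t\in[\alpha,\beta]})=\mathrm{MI}\big((D\phi_t(L))_{t\in[\alpha,\beta]}\big)$.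 **Proposition.** If $(\phi_t)$ twists the vertical, then for every $L\in\Lambda$ and all $\alpha\le\beta$ with $D\phi_\alpha(L),D\phi_\beta(L)\notin\Sigma$, the dynamical Maslov index $\mathrm{DMI}(L,(\phi_t)_{t\in[\alpha,\beta]})$ is well defined and $$\mathrm{DMI}(L,(\phi_t)_{t\in[\alpha,\beta]})\le 0 .$$ -/

import Mathlib

open Set Filter Topology Bundle
open scoped Manifold ContDiff

noncomputable section

namespace CotangentMaslov

/-! ### The cotangent bundle and its symplectic form -/

/-- The model space `ℝ^d`. -/
abbrev Rn (d : ℕ) : Type := EuclideanSpace ℝ (Fin d)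

/-- The cotangent bundle `T*M` of a manifold `M` of dimension `d`. -/
abbrev Cot (d : ℕ) (M : Type*) [TopologicalSpace M] [ChartedSpace (Rn d) M] : Type _ :=
  TotalSpace (Rn d →L[ℝ] ℝ)
    (fun q : M => TangentSpace 𝓘(ℝ, Rn d) q →L[ℝ] Bundle.Trivial M ℝ q)

/-- The model with corners of `T*M`; its model vector space is `ℝ^d × (ℝ^d)^*`. -/
abbrev JCot (d : ℕ) : ModelWithCorners ℝ (Rn d × (Rn d →L[ℝ] ℝ))
    (ModelProd (Rn d) (Rn d →L[ℝ] ℝ)) :=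
  𝓘(ℝ, Rn d).prod 𝓘(ℝ, Rn d →L[ℝ] ℝ)

variable {d : ℕ} {M : Type*} [TopologicalSpace M] [ChartedSpace (Rn d) M]
  [IsManifold 𝓘(ℝ, Rn d) ∞ M]

/-- The tangent space `T_x(T*M)`. -/
abbrev TCot (x : Cot d M) : Type := TangentSpace (JCot d) x

/-- The projection `π : T*M → M`. -/
def proj (x : Cot d M) : M := x.proj

/-- The tautological form: `λ_x(v) = x(dπ_x v)`. -/
def tautForm (x : Cot d M) : TCot x →L[ℝ] ℝ :=
  ContinuousLinearMap.comp (x.2 : TangentSpace 𝓘(ℝ, Rn d) x.proj →L[ℝ] ℝ)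
    (mfderiv (JCot d) 𝓘(ℝ, Rn d) (proj : Cot d M → M) x)

/-- The tautological form read in the preferred chart of `T*M` around `x`. -/
def tautFormInChart (x : Cot d M) (y : Rn d × (Rn d →L[ℝ] ℝ)) :
    (Rn d × (Rn d →L[ℝ] ℝ)) →L[ℝ] ℝ :=
  (tautForm ((extChartAt (JCot d) x).symm y)).comp
    (mfderiv 𝓘(ℝ, Rn d × (Rn d →L[ℝ] ℝ)) (JCot d) (extChartAt (JCot d) x).symm y)

/-- The exterior derivative at a point of a 1-form on a normed space:
`dα(u, v) = (D_u α)(v) - (D_v α)(u)`. -/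
def dOneForm {A : Type*} [NormedAddCommGroup A] [NormedSpace ℝ A] (al : A → A →L[ℝ] ℝ) (y : A) :
    A →ₗ[ℝ] A →ₗ[ℝ] ℝ :=
  LinearMap.mk₂ ℝ (fun u v => fderiv ℝ al y u v - fderiv ℝ al y v u)
    (by intro u u' v; simp; ring)
    (by intro c u v; simp; ring)
    (by intro u v v'; simp; ring)
    (by intro c u v; simp; ring)

/-- The differential at `x` of the preferred chart of `T*M` around `x`. -/
def dPreferred (x : Cot d M) : TCot x →ₗ[ℝ] Rn d × (Rn d →L[ℝ] ℝ) :=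
  (mfderiv (JCot d) 𝓘(ℝ, Rn d × (Rn d →L[ℝ] ℝ)) (extChartAt (JCot d) x) x).toLinearMap

/-- The symplectic form `ω = -dλ` of `T*M`; the exterior derivative at `x` is computed in the
preferred chart around `x`. -/
def omega (x : Cot d M) : TCot x →ₗ[ℝ] TCot x →ₗ[ℝ] ℝ :=
  -((dOneForm (tautFormInChart x) (extChartAt (JCot d) x x)).compl₁₂ (dPreferred x) (dPreferred x))

/-- The vertical subspace `V(x) = T_x(T*_{π(x)}M) = ker dπ_x`. -/
def vert (x : Cot d M) : Submodule ℝ (TCot x) :=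
  LinearMap.ker (mfderiv (JCot d) 𝓘(ℝ, Rn d) (proj : Cot d M → M) x).toLinearMap

/-! ### Lagrangian subspaces and the singular cycle -/

variable (d M) in
/-- A linear subspace of a tangent space of `T*M`, with its base point. -/
structure SubspaceAt where
  pt : Cot d M
  sub : Submodule ℝ (TCot pt)

/-- `L ∈ Λ(T*M)`: the subspace `L` is Lagrangian, i.e. equal to its symplectic orthogonal. -/
def SubspaceAt.IsLagrangian (L : SubspaceAt d M) : Prop :=
  ∀ u, u ∈ L.sub ↔ ∀ v ∈ L.sub, omega L.pt u v = 0

/-- `L ∈ Σ`: the subspace `L` is not transverse to the vertical. -/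
def SubspaceAt.Singular (L : SubspaceAt d M) : Prop :=
  L.sub ⊓ vert L.pt ≠ ⊥

/-- `L ∈ Σ₁`: the regular locus of the singular cycle. -/
def SubspaceAt.RegularSingular (L : SubspaceAt d M) : Prop :=
  Module.finrank ℝ (L.sub ⊓ vert L.pt : Submodule ℝ (TCot L.pt)) = 1

/-- The image `Df(L)` of a subspace by the differential of `f`. -/
def SubspaceAt.push (f : Cot d M → Cot d M) (L : SubspaceAt d M) : SubspaceAt d M where
  pt := f L.pt
  sub := L.sub.map (mfderiv (JCot d) (JCot d) f L.pt).toLinearMap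

/-! ### Vertically foliated Darboux charts -/

/-- The standard symplectic form `dq ∧ dp` of `ℝ^d × ℝ^d`. -/
def stdForm (u v : Rn d × Rn d) : ℝ := inner ℝ u.1 v.2 - inner ℝ u.2 v.1

/-- The product set `I^d ⊆ ℝ^d`. -/
def box (d : ℕ) (I : Set ℝ) : Set (Rn d) := {p | ∀ i, p i ∈ I}

/-- `F` is a smooth chart of `T*M` with values in `ℝ^d × ℝ^d`. -/
def IsSmoothChart (F : OpenPartialHomeomorph (Cot d M) (Rn d × Rn d)) : Prop :=
  ContMDiffOn (JCot d) 𝓘(ℝ, Rn d × Rn d) ∞ F F.source ∧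
    ContMDiffOn 𝓘(ℝ, Rn d × Rn d) (JCot d) ∞ F.symm F.target

/-- The differential at `x` of a chart. -/
def dChart (F : OpenPartialHomeomorph (Cot d M) (Rn d × Rn d)) (x : Cot d M) :
    TCot x →L[ℝ] Rn d × Rn d :=
  mfderiv (JCot d) 𝓘(ℝ, Rn d × Rn d) F x

/-- `F = (F₁, F₂)` is a vertically foliated Darboux chart: it is symplectic, its image is a product
`I^d × J^d` of cubes, and it maps the trace of each cotangent fibre to `{F₁(x)} × J^d`. -/
def IsVerticallyFoliated (F : OpenPartialHomeomorph (Cot d M) (Rn d × Rn d)) : Prop :=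
  IsSmoothChart F ∧
  (∀ x ∈ F.source, ∀ u v : TCot x, stdForm (dChart F x u) (dChart F x v) = omega x u v) ∧
  ∃ I J : Set ℝ, I.OrdConnected ∧ J.OrdConnected ∧ F.target = box d I ×ˢ box d J ∧
    ∀ x ∈ F.source, F '' ({y | proj y = proj x} ∩ F.source) = {(F x).1} ×ˢ box d J

/-- The tangent space at `x` of the foliation by the leaves `F⁻¹(ℝ^d × {p})`. -/
def horiz (F : OpenPartialHomeomorph (Cot d M) (Rn d × Rn d)) (x : Cot d M) :
    Submodule ℝ (TCot x) :=
  LinearMap.ker ((ContinuousLinearMap.snd ℝ (Rn d) (Rn d)).comp (dChart F x)).toLinearMap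

/-! ### Height and index -/

/-- The height `Q_V(L₁, L₂) : v ↦ Ω((P^V|_{L₁})⁻¹ v, (P^V|_{L₂})⁻¹ v)` of `L₂` above `L₁` with
respect to `V`, a quadratic form on `E ⧸ V`. -/
def height {E : Type*} [AddCommGroup E] [Module ℝ E] (Om : E →ₗ[ℝ] E →ₗ[ℝ] ℝ)
    (V L₁ L₂ : Submodule ℝ E) (h₁ : IsCompl V L₁) (h₂ : IsCompl V L₂) :
    QuadraticForm ℝ (E ⧸ V) :=
  LinearMap.BilinMap.toQuadraticMap
    (Om.compl₁₂ (L₁.subtype ∘ₗ (Submodule.quotientEquivOfIsCompl V L₁ h₁).toLinearMap)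
      (L₂.subtype ∘ₗ (Submodule.quotientEquivOfIsCompl V L₂ h₂).toLinearMap))

/-- `L` is based in the domain of `F`, it is transverse to `K`, and the index of `Q_K(V, L)` is
`n`, where `K` is the tangent bundle of the horizontal foliation of `F` and `V` the vertical. -/
def HasHeightIndex (F : OpenPartialHomeomorph (Cot d M) (Rn d × Rn d)) (L : SubspaceAt d M)
    (n : ℕ) : Prop :=
  L.pt ∈ F.source ∧
    ∃ (hV : IsCompl (horiz F L.pt) (vert L.pt)) (hL : IsCompl (horiz F L.pt) L.sub),
      sigNeg (height (omega L.pt) (horiz F L.pt) (vert L.pt) L.sub hV hL) = n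

/-! ### Crossings -/

/-- `t₀` is a positive crossing of `Γ`: the path meets `Σ` at `t₀` in a point of `Σ₁`, it is out of
`Σ` just before and just after, and the index of `Q_K(V, Γ(t))` is `n + 1` just before and `n` just
after, where `n` is the index of `Q_K(V, Γ(t₀))`. -/
def IsPositiveCrossing (Γ : ℝ → SubspaceAt d M) (t₀ : ℝ) : Prop :=
  (Γ t₀).RegularSingular ∧
  ∃ F, IsVerticallyFoliated F ∧ ∃ n, HasHeightIndex F (Γ t₀) n ∧ ∃ ε > 0,
    (∀ t ∈ Ioo (t₀ - ε) t₀, ¬ (Γ t).Singular ∧ HasHeightIndex F (Γ t) (n + 1)) ∧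
    (∀ t ∈ Ioo t₀ (t₀ + ε), ¬ (Γ t).Singular ∧ HasHeightIndex F (Γ t) n)

/-- `t₀` is a negative crossing of `Γ`: it is a positive one after reversal of time. -/
def IsNegativeCrossing (Γ : ℝ → SubspaceAt d M) (t₀ : ℝ) : Prop :=
  IsPositiveCrossing (fun t => Γ (-t)) (-t₀)

/-- The signed number of crossings of `Γ` on `[α, β]`. -/
def signedCrossings (α β : ℝ) (Γ : ℝ → SubspaceAt d M) : ℤ :=
  (({t ∈ Icc α β | IsPositiveCrossing Γ t}).ncard : ℤ) -
    (({t ∈ Icc α β | IsNegativeCrossing Γ t}).ncard : ℤ)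

/-! ### Smooth paths of Lagrangian subspaces and their `C^1` topology

The regularity of a path in the Lagrangian Grassmannian is expressed through moving frames, i.e.
through lifts to the frame bundle, which is a submersion onto the Grassmannian. -/

/-- The total space of the tangent bundle of `T*M`. -/
abbrev TTCot (d : ℕ) (M : Type*) [TopologicalSpace M] [ChartedSpace (Rn d) M]
    [IsManifold 𝓘(ℝ, Rn d) ∞ M] : Type _ :=
  TangentBundle (JCot d) (Cot d M)

/-- The vectors `e t 0, …, e t (d-1)` are a basis of the subspace `Γ t`, for all `t ∈ [α, β]`. -/
def IsFrame (α β : ℝ) (e : ℝ → Fin d → TTCot d M) (Γ : ℝ → SubspaceAt d M) : Prop :=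
  ∀ t ∈ Icc α β, ∃ w : Fin d → TCot (Γ t).pt,
    (∀ i, e t i = ⟨(Γ t).pt, w i⟩) ∧ LinearIndependent ℝ w ∧
      Submodule.span ℝ (range w) = (Γ t).sub

/-- `e` is a frame of class `C^k` on `[α, β]` of the path `Γ` of Lagrangian subspaces. -/
def IsLagrangianFrame (k : ℕ∞ω) (α β : ℝ) (e : ℝ → Fin d → TTCot d M)
    (Γ : ℝ → SubspaceAt d M) : Prop :=
  (∀ t ∈ Icc α β, (Γ t).IsLagrangian) ∧
  ContMDiffOn 𝓘(ℝ, ℝ) (JCot d) k (fun t => (Γ t).pt) (Icc α β) ∧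
  (∀ i, ContMDiffOn 𝓘(ℝ, ℝ) (JCot d).tangent k (fun t => e t i) (Icc α β)) ∧
  IsFrame α β e Γ

/-- The 1-jet `(c(t), c'(t))` at `t` of a curve `c` defined on `[α, β]`. -/
def velocity (α β : ℝ) (c : ℝ → TTCot d M) (t : ℝ) :
    TangentBundle (JCot d).tangent (TTCot d M) :=
  tangentMapWithin 𝓘(ℝ, ℝ) (JCot d).tangent c (Icc α β) ⟨t, (1 : ℝ)⟩

/-- The filter of neighbourhoods of `e` for the `C^1` topology on families of `d` curves over
`[α, β]`, i.e. the compact-open topology of their 1-jets. -/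
def c1Nhds (α β : ℝ) (e : ℝ → Fin d → TTCot d M) : Filter (ℝ → Fin d → TTCot d M) :=
  @nhds _ (TopologicalSpace.generateFrom
    {S | ∃ (K : Set ℝ) (i : Fin d) (U : Set (TangentBundle (JCot d).tangent (TTCot d M))),
      IsCompact K ∧ K ⊆ Icc α β ∧ IsOpen U ∧
        S = {c | ∀ t ∈ K, velocity α β (fun s => c s i) t ∈ U}}) e

/-- `Γ`, with the frame `e`, is a smooth path in general position on `[α, β]`: its endpoints are
out of `Σ`, and it is topologically transverse to `Σ`, i.e. each crossing is positive or negative. -/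
def InGeneralPosition (α β : ℝ) (e : ℝ → Fin d → TTCot d M) (Γ : ℝ → SubspaceAt d M) : Prop :=
  IsLagrangianFrame ∞ α β e Γ ∧ ¬ (Γ α).Singular ∧ ¬ (Γ β).Singular ∧
    ∀ t ∈ Icc α β, (Γ t).Singular → IsPositiveCrossing Γ t ∨ IsNegativeCrossing Γ t

/-! ### The Maslov index -/

/-- `m` is the Maslov index of the `C^1` path `Γ` on `[α, β]`: arbitrarily `C^1`-close to `Γ` there
are smooth paths in general position, and all those that are close enough have signed number of
crossings `m`. -/
def HasMaslovIndex (α β : ℝ) (Γ : ℝ → SubspaceAt d M) (m : ℤ) : Prop :=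
  ¬ (Γ α).Singular ∧ ¬ (Γ β).Singular ∧
  ∃ e, IsLagrangianFrame 1 α β e Γ ∧
    (∃ᶠ e' in c1Nhds α β e, ∃ Γ', InGeneralPosition α β e' Γ') ∧
    (∀ᶠ e' in c1Nhds α β e, ∀ Γ', InGeneralPosition α β e' Γ' →
      signedCrossings α β Γ' = m)

/-- The Maslov index `MI(Γ)` of `Γ` on `[α, β]`. -/
def maslovIndex (α β : ℝ) (Γ : ℝ → SubspaceAt d M) : ℤ :=
  Classical.epsilon (HasMaslovIndex α β Γ)

/-! ### Conformally symplectic isotopies and the twist condition -/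

/-- `f` is conformally symplectic: `f^*ω = a ω` for some constant `a`. -/
def IsConformallySymplectic (f : Cot d M → Cot d M) : Prop :=
  ∃ a : ℝ, ∀ (x : Cot d M) (u v : TCot x),
    omega (f x) (mfderiv (JCot d) (JCot d) f x u) (mfderiv (JCot d) (JCot d) f x v) =
      a * omega x u v

/-- `(φ_t)` is a smooth isotopy of conformally symplectic diffeomorphisms of `T*M`. -/
def IsConformallySymplecticIsotopy
    (φ : ℝ → Diffeomorph (JCot d) (JCot d) (Cot d M) (Cot d M) ∞) : Prop :=
  ContMDiff (𝓘(ℝ, ℝ).prod (JCot d)) (JCot d) ∞ (fun z : ℝ × Cot d M => φ z.1 z.2) ∧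
    ∀ t, IsConformallySymplectic (φ t)

/-- `g` is convex near each point of the open set `D`. -/
def LocallyConvexOn (D : Set (Rn d)) (g : Rn d → ℝ) : Prop :=
  ∀ p ∈ D, ∃ r > 0, Metric.ball p r ⊆ D ∧ ConvexOn ℝ (Metric.ball p r) g

/-- The isotopy `(φ_t)` twists the vertical. Here `D` is the set over which `F(𝒢_t)` is a graph
`q = dg(p)`. It need not be a convex set, so that the convexity of `g` on `D` is the local one. -/
def TwistsVertical (φ : ℝ → Diffeomorph (JCot d) (JCot d) (Cot d M) (Cot d M) ∞) : Prop :=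
  ∀ (t₀ : ℝ) (x₀ : Cot d M), ∃ ε > 0, ∃ a > 0,
    ∃ F : OpenPartialHomeomorph (Cot d M) (Rn d × Rn d),
      IsVerticallyFoliated F ∧ x₀ ∈ F.source ∧ F x₀ = 0 ∧
      F.target = box d (Ioo (-a) a) ×ˢ box d (Ioo (-a) a) ∧
      ∀ t ∈ Ioo (t₀ - ε) (t₀ + ε), ∃ G : Set (Cot d M),
        G = (fun y => φ t ((φ t₀).symm y)) '' (F.symm '' ({0} ×ˢ box d (Ioo (-(a / 2)) (a / 2)))) ∧
        G ⊆ F.source ∧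
        ∃ (D : Set (Rn d)) (g : Rn d → ℝ), IsOpen D ∧ DifferentiableOn ℝ g D ∧
          F '' G = {z | z.2 ∈ D ∧ z.1 = gradient g z.2} ∧
          (t₀ ≤ t → LocallyConvexOn D g) ∧ (t ≤ t₀ → LocallyConvexOn D (-g))

/-- The Lagrangian path `t ↦ Dφ_t(L)`. -/
def dynPath (φ : ℝ → Diffeomorph (JCot d) (JCot d) (Cot d M) (Cot d M) ∞)
    (L : SubspaceAt d M) (t : ℝ) : SubspaceAt d M :=
  L.push (φ t)

/-- The dynamical Maslov index `DMI(L, (φ_t)_{t ∈ [α, β]})`. -/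
def dynMaslovIndex (φ : ℝ → Diffeomorph (JCot d) (JCot d) (Cot d M) (Cot d M) ∞)
    (L : SubspaceAt d M) (α β : ℝ) : ℤ :=
  maslovIndex α β (dynPath φ L)

end CotangentMaslov

end

/-!
In a vertically foliated chart `F` a Lagrangian subspace transverse to the horizontal foliation is
the graph `q = S p` of a symmetric matrix `S`, its slope (`IsSlope`). The subspace is in the
singular cycle iff `det S = 0`, and the index of its height over the vertical is the positive index
of `S`. The argument is about the indices of paths of slopes.

*The index is well defined.* For two charts, the difference of the indices of the slopes of a
nonsingular Lagrangian subspace is, up to a constant, the index of a symmetric matrix that depends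
continuously on the subspace and remains nondegenerate on the singular cycle
(`posIndex_add_negIndex_eq`, `exists_posIndex_eq_add`). Hence a positive crossing lowers by one the
index of the slope in every chart, a negative crossing raises it by one, and the signed number of
crossings of a path in general position is computed from the indices at the ends and from the locally
constant differences between consecutive charts of a partition (`HasGoodCrossings.signedCrossings_eq`).
All these data are stable, so that they are shared by all paths close to a given one
(`exists_signedCrossings_eq`).

*General position.* A dynamical path becomes in general position by perturbing its initial
subspace. On a short time interval this amounts to adding a constant symmetric matrix to a path of
symmetric matrices so that the determinant has only simple zeros (`exists_simple_zeros`), which is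
proved by induction on the size: the border and then the corner entry are chosen, the latter by
the one-dimensional Sard lemma. At a simple zero the kernel is a line and the index jumps by one,
so that the crossing is positive or negative (`IsContFrame.isCrossing_of_simple_zero`). Simple zeros
are stable, so that the intervals of a partition can be treated one after the other
(`exists_inGeneralPosition`).

*The sign.* A dynamical path `Dφ_t(L)` never has a positive crossing
(`not_isPositiveCrossing_dynPath`). Let `U` be the subspace for which `Dφ_{t₁}(U)` is vertical. By
the twist condition, the slope `R t` of `Dφ_t(U)` is a limit of difference quotients of the gradient
of a concave function for `t ≤ t₁`, so that it is nonpositive. A shear `(q, p) ↦ (q, p - s q)` with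
`s ≥ 0` preserves this sign and makes `Dφ_{t₁}(L)` transverse to the horizontal foliation of the
chart; let `S t` be the slope of `Dφ_t(L)`. The kernel of `S t - R t` has the dimension of `L ⊓ U`,
which does not depend on `t`, and `R t₁ = 0`. Since the indices are lower semicontinuous, `S t - R t`
has the same index as `S t₁` for `t` close to `t₁`, so that the index of `S t ≤ S t - R t` is at most
that of `S t₁` for `t < t₁`, whereas a positive crossing would make it larger by one.

A dynamical path in general position close to `Dφ_t(L)` therefore has only negative crossings, and
its signed number of crossings, which is the Maslov index, is nonpositive.
-/

open scoped Matrix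

noncomputable section

namespace CotangentMaslov

/-! ### Indices of quadratic forms given by matrices -/

section Index

variable {n m : Type*} [Fintype n] [DecidableEq n] [Fintype m] [DecidableEq m]

/-- The positive index of inertia of the quadratic form `u ↦ u ⬝ᵥ H *ᵥ u`. -/
def posIndex (H : Matrix n n ℝ) : ℕ := sigPos H.toQuadraticForm'

/-- The negative index of inertia of the quadratic form `u ↦ u ⬝ᵥ H *ᵥ u`. -/
def negIndex (H : Matrix n n ℝ) : ℕ := sigNeg H.toQuadraticForm'

lemma toQuadraticForm'_apply (H : Matrix n n ℝ) (u : n → ℝ) :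
    H.toQuadraticForm' u = u ⬝ᵥ H *ᵥ u := by
  simp [Matrix.toQuadraticForm', Matrix.toLinearMap₂'_apply']

lemma posIndex_neg (H : Matrix n n ℝ) : posIndex (-H) = negIndex H := by
  unfold posIndex negIndex
  rw [← sigPos_neg]
  congr 1
  ext u
  simp [toQuadraticForm'_apply, Matrix.neg_mulVec]

lemma negIndex_neg (H : Matrix n n ℝ) : negIndex (-H) = posIndex H := by
  rw [← posIndex_neg, neg_neg]

lemma exists_posIndex_eq (H : Matrix n n ℝ) :
    ∃ V : Submodule ℝ (n → ℝ), Module.finrank ℝ V = posIndex H ∧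
      ∀ u ∈ V, u ≠ 0 → 0 < u ⬝ᵥ H *ᵥ u := by
  obtain ⟨V, hV, hp⟩ := exists_finrank_eq_sigPos_and_posDef H.toQuadraticForm'
  refine ⟨V, hV, fun u hu h0 => ?_⟩
  have := hp ⟨u, hu⟩ (by simpa using h0)
  simpa [toQuadraticForm'_apply] using this

lemma le_posIndex {H : Matrix n n ℝ} {V : Submodule ℝ (n → ℝ)}
    (h : ∀ u ∈ V, u ≠ 0 → 0 < u ⬝ᵥ H *ᵥ u) : Module.finrank ℝ V ≤ posIndex H := by
  refine le_sigPos_of_posDef H.toQuadraticForm' (V := V) fun u hu => ?_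
  have := h u u.2 (by simpa using hu)
  simpa [toQuadraticForm'_apply] using this

lemma posIndex_mono {H H' : Matrix n n ℝ} (h : ∀ u, u ⬝ᵥ H *ᵥ u ≤ u ⬝ᵥ H' *ᵥ u) :
    posIndex H ≤ posIndex H' := by
  obtain ⟨V, hV, hp⟩ := exists_posIndex_eq H
  exact hV ▸ le_posIndex fun u hu h0 => (hp u hu h0).trans_le (h u)

lemma posIndex_add_negIndex {H : Matrix n n ℝ} (hH : H.IsSymm) :
    posIndex H + negIndex H + Module.finrank ℝ (LinearMap.ker H.mulVecLin) = Fintype.card n := by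
  have h := QuadraticForm.sigPos_add_sigNeg_add_radical (Q := H.toQuadraticForm')
  rw [Module.finrank_fintype_fun_eq_card] at h
  rw [← h]
  unfold posIndex negIndex
  suffices e : LinearMap.ker H.mulVecLin = H.toQuadraticForm'.radical by rw [e]
  have hp : ∀ u v, H.toQuadraticForm' (u + v) =
      H.toQuadraticForm' u + H.toQuadraticForm' v + 2 * (v ⬝ᵥ H *ᵥ u) := by
    intro u v
    have : u ⬝ᵥ H *ᵥ v = v ⬝ᵥ H *ᵥ u := by
      rw [Matrix.dotProduct_mulVec, ← Matrix.mulVec_transpose, hH, dotProduct_comm]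
    simp only [toQuadraticForm'_apply, Matrix.mulVec_add, dotProduct_add, add_dotProduct, this]
    ring
  ext u
  rw [LinearMap.mem_ker, QuadraticMap.mem_radical_iff']
  constructor
  · intro hu
    have hu' : H *ᵥ u = 0 := hu
    have h0 : H.toQuadraticForm' u = 0 := by simp [toQuadraticForm'_apply, hu']
    exact ⟨h0, fun v => by rw [hp, hu', h0]; simp⟩
  · rintro ⟨h0, hu⟩
    refine dotProduct_eq _ _ fun w => ?_
    have := hu w
    rw [hp, h0] at this
    simp only [zero_dotProduct]
    rw [Matrix.mulVecLin_apply, dotProduct_comm]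
    linarith

lemma posIndex_add_negIndex_of_det_ne_zero {H : Matrix n n ℝ} (hH : H.IsSymm) (hd : H.det ≠ 0) :
    posIndex H + negIndex H = Fintype.card n := by
  have := posIndex_add_negIndex hH
  have hk : LinearMap.ker H.mulVecLin = ⊥ := by
    rw [LinearMap.ker_eq_bot']
    intro u hu
    exact Matrix.eq_zero_of_mulVec_eq_zero hd hu
  rw [hk, finrank_bot] at this
  exact this

lemma posIndex_conj_le (H : Matrix n n ℝ) {A : Matrix n n ℝ} (hA : A.det ≠ 0) :
    posIndex (Aᵀ * H * A) ≤ posIndex H := by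
  obtain ⟨V, hV, hp⟩ := exists_posIndex_eq (Aᵀ * H * A)
  have hinj : Function.Injective A.mulVecLin := by
    rw [← LinearMap.ker_eq_bot, LinearMap.ker_eq_bot']
    exact fun u hu => Matrix.eq_zero_of_mulVec_eq_zero hA hu
  rw [← hV, (Submodule.equivMapOfInjective _ hinj V).finrank_eq]
  refine le_posIndex ?_
  rintro _ ⟨u, hu, rfl⟩ h0
  have h1 := hp u hu (by rintro rfl; simp at h0)
  rw [← Matrix.mulVec_mulVec, ← Matrix.mulVec_mulVec, Matrix.dotProduct_mulVec,
    Matrix.vecMul_transpose] at h1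
  exact h1

lemma posIndex_conj (H : Matrix n n ℝ) {A : Matrix n n ℝ} (hA : A.det ≠ 0) :
    posIndex (Aᵀ * H * A) = posIndex H := by
  refine le_antisymm (posIndex_conj_le H hA) ?_
  have hu : IsUnit A.det := isUnit_iff_ne_zero.2 hA
  have h := posIndex_conj_le (Aᵀ * H * A) (A := A⁻¹)
    (by rw [Matrix.det_nonsing_inv]; simpa using hA)
  have e : A⁻¹ᵀ * (Aᵀ * H * A) * A⁻¹ = H := by
    have h1 : A⁻¹ᵀ * Aᵀ = 1 := by rw [← Matrix.transpose_mul, Matrix.mul_nonsing_inv _ hu]; simp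
    calc A⁻¹ᵀ * (Aᵀ * H * A) * A⁻¹ = (A⁻¹ᵀ * Aᵀ) * H * (A * A⁻¹) := by
          simp only [Matrix.mul_assoc]
      _ = H := by rw [h1, Matrix.mul_nonsing_inv _ hu]; simp
  rwa [e] at h

lemma negIndex_conj (H : Matrix n n ℝ) {A : Matrix n n ℝ} (hA : A.det ≠ 0) :
    negIndex (Aᵀ * H * A) = negIndex H := by
  rw [← posIndex_neg, ← posIndex_neg, ← posIndex_conj (-H) hA]
  simp

/-- The positive index is lower semicontinuous. -/
lemma eventually_posIndex_ge (H₀ : Matrix n n ℝ) :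
    ∀ᶠ H in 𝓝 H₀, posIndex H₀ ≤ posIndex H := by
  obtain ⟨V, hV, hp⟩ := exists_posIndex_eq H₀
  have hK : IsCompact (Metric.sphere (0 : n → ℝ) 1 ∩ V) :=
    (isCompact_sphere _ _).inter_right V.closed_of_finiteDimensional
  have hc : Continuous fun z : Matrix n n ℝ × (n → ℝ) => z.2 ⬝ᵥ z.1 *ᵥ z.2 := by fun_prop
  have : ∀ᶠ H in 𝓝 H₀, ∀ u ∈ Metric.sphere (0 : n → ℝ) 1 ∩ V, 0 < u ⬝ᵥ H *ᵥ u := by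
    refine hK.eventually_forall_of_forall_eventually fun u hu => ?_
    have hne : u ≠ 0 := by
      rintro rfl
      simpa using hu.1
    exact hc.continuousAt.eventually (lt_mem_nhds (hp u hu.2 hne))
  filter_upwards [this] with H hH
  rw [← hV]
  refine le_posIndex fun u hu h0 => ?_
  have hn : 0 < ‖u‖ := norm_pos_iff.2 h0
  have h1 := hH (‖u‖⁻¹ • u) ⟨by simp [norm_smul, hn.ne'], V.smul_mem _ hu⟩
  rw [Matrix.mulVec_smul, dotProduct_smul, smul_dotProduct, smul_smul, smul_eq_mul] at h1
  exact pos_of_mul_pos_right h1 (by positivity)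

lemma eventually_negIndex_ge (H₀ : Matrix n n ℝ) :
    ∀ᶠ H in 𝓝 H₀, negIndex H₀ ≤ negIndex H := by
  have := (continuous_neg.tendsto H₀).eventually (eventually_posIndex_ge (-H₀))
  simpa only [posIndex_neg] using this

/-- The indices are locally constant on nondegenerate symmetric matrices. -/
lemma eventually_posIndex_eq {H₀ : Matrix n n ℝ} (hs : H₀.IsSymm) (hd : H₀.det ≠ 0) :
    ∀ᶠ H in 𝓝 H₀, H.IsSymm → posIndex H = posIndex H₀ ∧ negIndex H = negIndex H₀ := by
  filter_upwards [eventually_posIndex_ge H₀, eventually_negIndex_ge H₀] with H h1 h2 h3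
  have := posIndex_add_negIndex h3
  have := posIndex_add_negIndex_of_det_ne_zero hs hd
  omega

lemma posIndex_add_le_posIndex_fromBlocks (A : Matrix n n ℝ) (B : Matrix m m ℝ) :
    posIndex A + posIndex B ≤ posIndex (Matrix.fromBlocks A 0 0 B) := by
  obtain ⟨V, hV, hp⟩ := exists_posIndex_eq A
  obtain ⟨W, hW, hq⟩ := exists_posIndex_eq B
  let f : (V × W) →ₗ[ℝ] (n ⊕ m → ℝ) :=
    (LinearEquiv.sumArrowLequivProdArrow n m ℝ ℝ).symm.toLinearMap ∘ₗ V.subtype.prodMap W.subtype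
  have he : ∀ z, f z = Sum.elim (z.1 : n → ℝ) (z.2 : m → ℝ) := fun z => rfl
  have hf : Function.Injective f :=
    (LinearEquiv.sumArrowLequivProdArrow n m ℝ ℝ).symm.injective.comp
      (Function.Injective.prodMap V.injective_subtype W.injective_subtype)
  rw [← hV, ← hW, ← Module.finrank_prod, ← LinearMap.finrank_range_of_inj hf]
  refine le_posIndex ?_
  rintro _ ⟨⟨⟨v, hv⟩, ⟨w, hw⟩⟩, rfl⟩ h0
  simp only [he, Matrix.fromBlocks_mulVec, Sum.elim_comp_inl, Sum.elim_comp_inr,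
    Matrix.zero_mulVec, add_zero, zero_add, sumElim_dotProduct_sumElim]
  by_cases h1 : v = 0
  · have h2 : w ≠ 0 := by
      rintro rfl
      subst h1
      exact h0 (map_zero f)
    simpa [h1] using hq w hw h2
  · have := hp v hv h1
    by_cases h2 : w = 0
    · simpa [h2] using this
    · exact add_pos this (hq w hw h2)

lemma negIndex_fromBlocks {A : Matrix n n ℝ} {B : Matrix m m ℝ} (hA : A.IsSymm) (hB : B.IsSymm)
    (hAd : A.det ≠ 0) (hBd : B.det ≠ 0) :
    negIndex (Matrix.fromBlocks A 0 0 B) = negIndex A + negIndex B := by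
  have h1 := posIndex_add_le_posIndex_fromBlocks A B
  have h2 := posIndex_add_le_posIndex_fromBlocks (-A) (-B)
  have e : Matrix.fromBlocks (-A) 0 0 (-B) = -Matrix.fromBlocks A 0 0 B := by
    simp [Matrix.fromBlocks_neg]
  rw [e] at h2
  simp only [posIndex_neg] at h2
  have h3 := posIndex_add_negIndex_of_det_ne_zero hA hAd
  have h4 := posIndex_add_negIndex_of_det_ne_zero hB hBd
  have h5 := posIndex_add_negIndex_of_det_ne_zero (H := Matrix.fromBlocks A 0 0 B)
    (by rw [Matrix.IsSymm, Matrix.fromBlocks_transpose]; simp [hA.eq, hB.eq])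
    (by rw [Matrix.det_fromBlocks_zero₂₁]; exact mul_ne_zero hAd hBd)
  rw [Fintype.card_sum] at h5
  omega

/-- The sign of the determinant of a nondegenerate symmetric matrix is given by the parity of its
negative index. -/
lemma det_mul_neg_one_pow_negIndex_pos {H : Matrix n n ℝ} (hs : H.IsSymm) (hd : H.det ≠ 0) :
    0 < H.det * (-1) ^ negIndex H := by
  have hH : H.IsHermitian := by
    rw [Matrix.IsHermitian, Matrix.conjTranspose_eq_transpose_of_trivial]
    exact hs
  -- The negative index is the number of negative eigenvalues.
  have hneg : negIndex H = (Finset.univ.filter fun i => hH.eigenvalues i < 0).card := by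
    have e : negIndex H = negIndex (Matrix.diagonal hH.eigenvalues) := by
      let U : Matrix n n ℝ := hH.eigenvectorUnitary
      have hU : Uᵀ * U = 1 := by
        have := Unitary.coe_star_mul_self hH.eigenvectorUnitary
        simpa [Matrix.star_eq_conjTranspose] using this
      have hUd : U.det ≠ 0 := by
        intro h
        have := congrArg Matrix.det hU
        simp [h] at this
      rw [← negIndex_conj H hUd]
      congr 1
      have := hH.conjStarAlgAut_star_eigenvectorUnitary
      simpa [Unitary.conjStarAlgAut_star_apply, Matrix.star_eq_conjTranspose] using this
    rw [e, ← Set.ncard_coe_finset, Finset.coe_filter]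
    simp only [Finset.mem_univ, true_and]
    refine QuadraticForm.sigNeg_of_equiv_weightedSumSquares ⟨⟨LinearEquiv.refl ℝ _, fun u => ?_⟩⟩
    simp [toQuadraticForm'_apply, Matrix.mulVec_diagonal, dotProduct,
      QuadraticMap.weightedSumSquares_apply, mul_left_comm]
  have hdet : H.det = ∏ i, hH.eigenvalues i := by
    simpa using hH.det_eq_prod_eigenvalues
  have hne : ∀ i, hH.eigenvalues i ≠ 0 := by
    intro i hi
    exact hd (hdet.trans (Finset.prod_eq_zero (Finset.mem_univ i) hi))
  have hpow : (-1 : ℝ) ^ negIndex H = ∏ i, if hH.eigenvalues i < 0 then (-1 : ℝ) else 1 := by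
    rw [hneg, Finset.prod_ite]
    simp
  rw [hpow, hdet, ← Finset.prod_mul_distrib]
  refine Finset.prod_pos fun i _ => ?_
  split_ifs with h
  · linarith
  · have := lt_of_le_of_ne (not_lt.1 h) (hne i).symm
    linarith

/-- When the determinant of a path of symmetric matrices has a simple zero at which the kernel is a
line, the positive index jumps by one there. -/
lemma posIndex_jump {H : ℝ → Matrix n n ℝ} {t₀ f' : ℝ} (hs : ∀ᶠ t in 𝓝 t₀, (H t).IsSymm)
    (hc : ContinuousAt H t₀) (hd : HasDerivAt (fun t => (H t).det) f' t₀) (hf' : f' ≠ 0)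
    (h0 : (H t₀).det = 0) (hk : Module.finrank ℝ (LinearMap.ker (H t₀).mulVecLin) = 1) :
    (∀ᶠ t in 𝓝[≠] t₀, (H t).det ≠ 0) ∧
    (((∀ᶠ t in 𝓝[<] t₀, posIndex (H t) = posIndex (H t₀) + 1) ∧
        ∀ᶠ t in 𝓝[>] t₀, posIndex (H t) = posIndex (H t₀)) ∨
      ((∀ᶠ t in 𝓝[<] t₀, posIndex (H t) = posIndex (H t₀)) ∧
        ∀ᶠ t in 𝓝[>] t₀, posIndex (H t) = posIndex (H t₀) + 1)) := by
  have hne : ∀ᶠ t in 𝓝[≠] t₀, (H t).det ≠ 0 := by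
    have := hd.eventually_ne hf' (c := 0)
    exact this
  refine ⟨hne, ?_⟩
  have hr := posIndex_add_negIndex hs.self_of_nhds
  rw [hk] at hr
  have key : ∀ᶠ t in 𝓝 t₀, (H t).det ≠ 0 →
      (posIndex (H t) = posIndex (H t₀) ∨ posIndex (H t) = posIndex (H t₀) + 1) ∧
      posIndex (H t) + negIndex (H t) = Fintype.card n ∧
      0 < (H t).det * (-1) ^ negIndex (H t) := by
    filter_upwards [hs, hc.eventually (eventually_posIndex_ge (H t₀)),
      hc.eventually (eventually_negIndex_ge (H t₀))] with t h1 h2 h3 h4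
    have h5 := posIndex_add_negIndex_of_det_ne_zero h1 h4
    exact ⟨by omega, h5, det_mul_neg_one_pow_negIndex_pos h1 h4⟩
  -- On each side of `t₀` the determinant has a constant sign, which determines the index.
  have side : ∀ (l : Filter ℝ), l ≤ 𝓝 t₀ → ∀ c : ℝ, c ≠ 0 → (∀ᶠ t in l, 0 < (H t).det * c) →
      ∀ᶠ t in l, posIndex (H t) =
        if 0 < c * (-1) ^ (Fintype.card n - posIndex (H t₀)) then posIndex (H t₀)
        else posIndex (H t₀) + 1 := by
    intro l hl c hc0 hlc
    filter_upwards [hl key, hlc] with t h1 h2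
    obtain ⟨h3, h4, h5⟩ := h1 (by rintro h; simp [h] at h2)
    have h6 : 0 < c * (-1) ^ negIndex (H t) := by
      have : 0 < ((H t).det * (H t).det) * (c * (-1) ^ negIndex (H t)) := by
        calc 0 < ((H t).det * c) * ((H t).det * (-1) ^ negIndex (H t)) := mul_pos h2 h5
          _ = _ := by ring
      exact pos_of_mul_pos_right this (mul_self_nonneg _)
    rcases h3 with h3 | h3
    · have : negIndex (H t) = Fintype.card n - posIndex (H t₀) := by omega
      rw [this] at h6
      rw [if_pos h6, h3]
    · have : Fintype.card n - posIndex (H t₀) = negIndex (H t) + 1 := by omega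
      rw [this, if_neg, h3]
      rw [pow_succ]
      linarith
  have hsgn : (∀ᶠ t in 𝓝[<] t₀, 0 < (H t).det * -f') ∧ ∀ᶠ t in 𝓝[>] t₀, 0 < (H t).det * f' := by
    have hd' : HasDerivAt (fun t => (H t).det * f') (f' * f') t₀ := hd.mul_const f'
    have hpos : 0 < f' * f' := mul_self_pos.2 hf'
    have h1 := hasDerivWithinAt_iff_tendsto_slope.1 (hd'.hasDerivWithinAt (s := Iio t₀))
    have h2 := hasDerivWithinAt_iff_tendsto_slope.1 (hd'.hasDerivWithinAt (s := Ioi t₀))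
    have e1 : Iio t₀ \ {t₀} = Iio t₀ := by ext; simp +contextual
    have e2 : Ioi t₀ \ {t₀} = Ioi t₀ := by ext; simp +contextual
    rw [e1] at h1
    rw [e2] at h2
    constructor
    · filter_upwards [h1.eventually (lt_mem_nhds hpos), self_mem_nhdsWithin] with t h3 h4
      rw [slope_def_field, h0, zero_mul, sub_zero, div_pos_iff] at h3
      have : t - t₀ < 0 := sub_neg.2 h4
      rcases h3 with h3 | h3 <;> linarith [h3.1, h3.2]
    · filter_upwards [h2.eventually (lt_mem_nhds hpos), self_mem_nhdsWithin] with t h3 h4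
      rw [slope_def_field, h0, zero_mul, sub_zero, div_pos_iff] at h3
      have : 0 < t - t₀ := sub_pos.2 h4
      rcases h3 with h3 | h3 <;> linarith [h3.1, h3.2]
  have hL := side _ nhdsWithin_le_nhds (-f') (neg_ne_zero.2 hf') hsgn.1
  have hR := side _ nhdsWithin_le_nhds f' hf' hsgn.2
  by_cases hcase : 0 < f' * (-1) ^ (Fintype.card n - posIndex (H t₀))
  · left
    rw [if_neg (by rw [neg_mul]; linarith)] at hL
    rw [if_pos hcase] at hR
    exact ⟨hL, hR⟩
  · right
    have : 0 < -f' * (-1) ^ (Fintype.card n - posIndex (H t₀)) := by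
      have hne0 : f' * (-1) ^ (Fintype.card n - posIndex (H t₀)) ≠ 0 :=
        mul_ne_zero hf' (pow_ne_zero _ (by norm_num))
      have := lt_of_le_of_ne (not_lt.1 hcase) hne0
      linarith
    rw [if_pos this] at hL
    rw [if_neg hcase] at hR
    exact ⟨hL, hR⟩

/-- The symmetric matrix comparing the heights over the vertical of a Lagrangian subspace with
respect to two horizontal subspaces. -/
def comparisonMatrix (S g : Matrix n n ℝ) : Matrix (n ⊕ n) (n ⊕ n) ℝ :=
  Matrix.fromBlocks (-S) 1 1 g

lemma comparisonMatrix_isSymm {n : Type*} [DecidableEq n] {S g : Matrix n n ℝ}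
    (hS : S.IsSymm) (hg : g.IsSymm) :
    (comparisonMatrix S g).IsSymm := by
  rw [comparisonMatrix, Matrix.IsSymm, Matrix.fromBlocks_transpose]
  simp [hS.eq, hg.eq]

lemma comparisonMatrix_det_ne_zero {S G₁ G₂ B : Matrix n n ℝ}
    (hB : G₁ᵀ * B = 1) (hT : (G₂ * S + B).det ≠ 0) :
    (comparisonMatrix S (G₁ᵀ * G₂)).det ≠ 0 := by
  intro h
  have e : (comparisonMatrix S (G₁ᵀ * G₂)) * Matrix.fromBlocks 1 0 S 1 =
      Matrix.fromBlocks 0 1 (G₁ᵀ * (G₂ * S + B)) (G₁ᵀ * G₂) := by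
    rw [comparisonMatrix, Matrix.fromBlocks_multiply]
    simp [Matrix.mul_add, hB, Matrix.mul_assoc, add_comm]
  have e2 : (Matrix.fromBlocks 0 1 (G₁ᵀ * (G₂ * S + B)) (G₁ᵀ * G₂) : Matrix (n ⊕ n) (n ⊕ n) ℝ) *
      (Matrix.fromBlocks 0 1 1 0 : Matrix (n ⊕ n) (n ⊕ n) ℝ) =
      Matrix.fromBlocks 1 0 (G₁ᵀ * G₂) (G₁ᵀ * (G₂ * S + B)) := by
    rw [Matrix.fromBlocks_multiply]
    simp
  have h3 := congrArg Matrix.det e2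
  rw [← e, Matrix.det_mul, Matrix.det_mul, h, zero_mul, zero_mul, Matrix.det_fromBlocks_zero₁₂,
    Matrix.det_mul] at h3
  have h4 := congrArg Matrix.det hB
  rw [Matrix.det_mul] at h4
  simp only [Matrix.det_one, one_mul] at h3 h4
  rcases mul_eq_zero.1 h3.symm with h5 | h5
  · simp [h5] at h4
  · exact hT h5

/-- The index of the height with respect to one horizontal subspace is, up to a locally constant
term, its index with respect to another one. Here `[[G₁, 0], [G₂, B]]` is the symplectic change of
coordinates, `S` and `S'` are the slopes of the Lagrangian subspace in both coordinates. -/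
lemma posIndex_add_negIndex_eq {S S' G₁ G₂ B : Matrix n n ℝ} (hS : S.IsSymm)
    (hB : G₁ᵀ * B = 1) (hg : (G₁ᵀ * G₂).IsSymm) (hT : (G₂ * S + B).det ≠ 0)
    (hSd : S.det ≠ 0) (hS' : S' * (G₂ * S + B) = G₁ * S) :
    posIndex S + negIndex S' = negIndex (comparisonMatrix S (G₁ᵀ * G₂)) := by
  set g := G₁ᵀ * G₂ with hgdef
  have hBt : Bᵀ * G₁ = 1 := by
    have := congrArg Matrix.transpose hB
    simpa using this
  have hg' : G₂ᵀ * G₁ = g := by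
    have := hg.eq
    rwa [hgdef, Matrix.transpose_mul, Matrix.transpose_transpose] at this
  -- `S'` is congruent to `S * g * S + S`, and the comparison matrix to the block diagonal matrix
  -- of `-S` and `S * g * S + S`.
  have e1 : (G₂ * S + B)ᵀ * S' * (G₂ * S + B) = S * g * S + S := by
    rw [Matrix.mul_assoc, hS', Matrix.transpose_add, Matrix.transpose_mul, hS.eq,
      ← Matrix.mul_assoc, Matrix.add_mul, hBt, Matrix.mul_assoc S, hg', Matrix.add_mul]
    simp
  have hA : (Matrix.fromBlocks 1 1 0 S : Matrix (n ⊕ n) (n ⊕ n) ℝ).det ≠ 0 := by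
    rw [Matrix.det_fromBlocks_zero₂₁]
    simpa using hSd
  have e2 : (Matrix.fromBlocks 1 1 0 S)ᵀ * comparisonMatrix S g * Matrix.fromBlocks 1 1 0 S =
      Matrix.fromBlocks (-S) 0 0 (S * g * S + S) := by
    rw [comparisonMatrix, Matrix.fromBlocks_transpose, Matrix.fromBlocks_multiply,
      Matrix.fromBlocks_multiply]
    simp [hS.eq, Matrix.add_mul, add_comm]
  have hdet : (comparisonMatrix S g).det ≠ 0 := comparisonMatrix_det_ne_zero hB hT
  have hd2 : (S * g * S + S).det ≠ 0 := by
    intro h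
    have := congrArg Matrix.det e2
    rw [Matrix.det_mul, Matrix.det_mul, Matrix.det_fromBlocks_zero₂₁ (-S), h, mul_zero,
      Matrix.det_transpose] at this
    simp only [mul_eq_zero, hA, hdet, or_self] at this
  have hs2 : (S * g * S + S).IsSymm := by
    rw [Matrix.IsSymm, Matrix.transpose_add, Matrix.transpose_mul, Matrix.transpose_mul, hS.eq,
      hg.eq, ← Matrix.mul_assoc S g S]
  rw [← negIndex_conj _ hA, e2, negIndex_fromBlocks (by simpa [Matrix.IsSymm] using hS.eq) hs2
    (by simpa [Matrix.det_neg] using hSd) hd2, negIndex_neg, ← e1, negIndex_conj _ hT]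

end Index

/-! ### Paths of symmetric matrices whose determinant has only simple zeros -/

section SimpleZeros

variable {n m : Type*} [Fintype n] [DecidableEq n] [Fintype m] [DecidableEq m]

/-- The derivative of the determinant along a path of matrices: one row is differentiated at a
time. -/
lemma hasDerivAt_det {A : ℝ → Matrix n n ℝ} {t : ℝ}
    (hA : ∀ i j, DifferentiableAt ℝ (fun s => A s i j) t) :
    HasDerivAt (fun s => (A s).det)
      (∑ i, ((A t).updateRow i fun j => deriv (fun s => A s i j) t).det) t := by
  let f : ContinuousMultilinearMap ℝ (fun _ : n => n → ℝ) ℝ :=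
    { (Matrix.detRowAlternating (n := n) (R := ℝ)).toMultilinearMap with
      cont := (continuous_id (X := Matrix n n ℝ)).matrix_det }
  have hf : ∀ B : Matrix n n ℝ, f B = B.det := fun B => rfl
  have hr : ∀ i, HasFDerivAt (fun s => A s i)
      (ContinuousLinearMap.toSpanSingleton ℝ fun j => deriv (fun s => A s i j) t) t := by
    intro i
    exact (hasDerivAt_pi.2 fun j => (hA i j).hasDerivAt).hasFDerivAt
  have h := (HasFDerivAt.multilinear_comp (f := f) hr).hasDerivAt
  refine h.congr_deriv ?_
  rw [sum_apply]
  refine Finset.sum_congr rfl fun i _ => ?_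
  rw [ContinuousLinearMap.comp_apply, ContinuousLinearMap.toSpanSingleton_apply, one_smul]
  rfl

lemma differentiableAt_det {A : ℝ → Matrix n n ℝ} {t : ℝ}
    (hA : ∀ i j, DifferentiableAt ℝ (fun s => A s i j) t) :
    DifferentiableAt ℝ (fun s => (A s).det) t :=
  (hasDerivAt_det hA).differentiableAt

/-- At a simple zero of the determinant the kernel is at most a line. -/
lemma mem_span_of_deriv_det_ne_zero {A : ℝ → Matrix n n ℝ} {t : ℝ}
    (hA : ∀ i j, DifferentiableAt ℝ (fun s => A s i j) t)
    (hd : deriv (fun s => (A s).det) t ≠ 0) {u v : n → ℝ} (hu : A t *ᵥ u = 0) (hv : A t *ᵥ v = 0)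
    (hv0 : v ≠ 0) : ∃ c : ℝ, u = c • v := by
  by_contra! hne
  refine hd ?_
  rw [(hasDerivAt_det hA).deriv]
  refine Finset.sum_eq_zero fun i _ => ?_
  -- A combination of `u` and `v` is also killed by the differentiated row.
  set r : n → ℝ := fun j => deriv (fun s => A s i j) t
  by_cases hrv : r ⬝ᵥ v = 0
  · refine Matrix.exists_mulVec_eq_zero_iff.1 ⟨v, hv0, ?_⟩
    ext k
    by_cases hk : k = i
    · subst hk
      simpa [Matrix.mulVec] using hrv
    · have := congrFun hv k
      simpa [Matrix.mulVec, hk] using this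
  · refine Matrix.exists_mulVec_eq_zero_iff.1 ⟨u - ((r ⬝ᵥ u) / (r ⬝ᵥ v)) • v, ?_, ?_⟩
    · intro h
      exact hne _ (sub_eq_zero.1 h)
    ext k
    by_cases hk : k = i
    · subst hk
      simp [Matrix.mulVec, dotProduct_sub, dotProduct_smul, hrv]
    · have h1 := congrFun hv k
      have h2 := congrFun hu k
      simp only [Matrix.mulVec, Pi.zero_apply] at h1 h2
      simp [Matrix.mulVec, hk, dotProduct_sub, dotProduct_smul, h1, h2]

lemma finrank_ker_eq_one {A : ℝ → Matrix n n ℝ} {t : ℝ}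
    (hA : ∀ i j, DifferentiableAt ℝ (fun s => A s i j) t)
    (hd : deriv (fun s => (A s).det) t ≠ 0) (h0 : (A t).det = 0) :
    Module.finrank ℝ (LinearMap.ker (A t).mulVecLin) = 1 := by
  obtain ⟨v, hv0, hv⟩ := Matrix.exists_mulVec_eq_zero_iff.2 h0
  refine finrank_eq_one (⟨v, hv⟩ : LinearMap.ker (A t).mulVecLin)
    (fun h => hv0 (congrArg Subtype.val h)) ?_
  rintro ⟨u, hu⟩
  obtain ⟨c, hc⟩ := mem_span_of_deriv_det_ne_zero hA hd hu hv hv0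
  exact ⟨c, Subtype.ext hc.symm⟩

/-- The zeros in `I` of the determinant of `A` are simple. -/
def HasSimpleDetZeros (I : Set ℝ) (A : ℝ → Matrix n n ℝ) : Prop :=
  ∀ t ∈ I, (A t).det = 0 → deriv (fun s => (A s).det) t ≠ 0

lemma finite_of_isCompact_of_isolated {s : Set ℝ} (hs : IsCompact s)
    (h : ∀ t ∈ s, ∀ᶠ z in 𝓝[≠] t, z ∉ s) : s.Finite := by
  refine hs.finite ?_
  rw [isDiscrete_iff_nhdsNE]
  intro t ht
  rw [← disjoint_iff, disjoint_principal_right]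
  exact h t ht

lemma finite_zeros_of_simple {f : ℝ → ℝ} {I : Set ℝ} (hI : IsCompact I)
    (hf : ∀ t ∈ I, DifferentiableAt ℝ f t) (h : ∀ t ∈ I, f t = 0 → deriv f t ≠ 0) :
    {t ∈ I | f t = 0}.Finite := by
  have hc : IsCompact {t ∈ I | f t = 0} := by
    refine hI.of_isClosed_subset ?_ (sep_subset _ _)
    exact ContinuousOn.preimage_isClosed_of_isClosed
      (fun t ht => (hf t ht).continuousAt.continuousWithinAt) hI.isClosed isClosed_singleton
  refine finite_of_isCompact_of_isolated hc ?_
  rintro t ⟨ht, h0⟩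
  filter_upwards [(hf t ht).hasDerivAt.eventually_ne (h t ht h0) (c := 0)] with z hz hz'
  exact hz hz'.2

lemma dense_dotProduct_ne {n : Type*} [Fintype n] {v : n → ℝ} (hv : v ≠ 0) (r : ℝ) :
    Dense {c : n → ℝ | v ⬝ᵥ c ≠ r} := by
  have hvv : v ⬝ᵥ v ≠ 0 := by simpa using hv
  intro c
  rw [mem_closure_iff_nhds]
  intro U hU
  by_cases hc : v ⬝ᵥ c = r
  · have h1 : Tendsto (fun s : ℝ => c + s • v) (𝓝[≠] 0) (𝓝 c) := by
      have : Continuous fun s : ℝ => c + s • v := by fun_prop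
      have := this.tendsto 0
      simp only [zero_smul, add_zero] at this
      exact this.mono_left nhdsWithin_le_nhds
    obtain ⟨s, hs, hs0⟩ := ((h1.eventually hU).and self_mem_nhdsWithin).exists
    refine ⟨_, hs, ?_⟩
    have : s * (v ⬝ᵥ v) ≠ 0 := mul_ne_zero hs0 hvv
    simpa [dotProduct_add, dotProduct_smul, hc] using this
  · exact ⟨c, mem_of_mem_nhds hU, hc⟩

/-- A symmetric matrix bordering a singular matrix with kernel a line is invertible as soon as the
border does not kill this line. -/
lemma det_bordered_ne_zero {M : Matrix m m ℝ} {b v : m → ℝ} (a : ℝ) (hM : M.IsSymm)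
    (hv : M *ᵥ v = 0) (hker : ∀ u, M *ᵥ u = 0 → ∃ c : ℝ, u = c • v) (hb : v ⬝ᵥ b ≠ 0) :
    (Matrix.fromBlocks (Matrix.of fun _ _ : Unit => a) (Matrix.of fun _ => b)
      (Matrix.of fun i _ => b i) M).det ≠ 0 := by
  intro h
  obtain ⟨w, hw0, hw⟩ := Matrix.exists_mulVec_eq_zero_iff.2 h
  refine hw0 ?_
  rw [Matrix.fromBlocks_mulVec] at hw
  have h1 : ∀ i, b i * w (Sum.inl ()) + (M *ᵥ (w ∘ Sum.inr)) i = 0 := by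
    intro i
    have := congrFun hw (Sum.inr i)
    simpa [Matrix.mulVec, dotProduct] using this
  have h2 : a * w (Sum.inl ()) + b ⬝ᵥ (w ∘ Sum.inr) = 0 := by
    have := congrFun hw (Sum.inl ())
    simpa [Matrix.mulVec, dotProduct] using this
  have h3 : w (Sum.inl ()) = 0 := by
    have h4 : v ⬝ᵥ (M *ᵥ (w ∘ Sum.inr)) = 0 := by
      rw [Matrix.dotProduct_mulVec, ← Matrix.mulVec_transpose, hM.eq, hv, zero_dotProduct]
    have h5 : v ⬝ᵥ (fun i => b i * w (Sum.inl ()) + (M *ᵥ (w ∘ Sum.inr)) i) = 0 := by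
      rw [funext h1]
      exact dotProduct_zero v
    have h6 : v ⬝ᵥ (fun i => b i * w (Sum.inl ()) + (M *ᵥ (w ∘ Sum.inr)) i) =
        w (Sum.inl ()) * (v ⬝ᵥ b) + v ⬝ᵥ (M *ᵥ (w ∘ Sum.inr)) := by
      simp only [dotProduct, mul_add, Finset.sum_add_distrib, Finset.mul_sum]
      congr 1
      exact Finset.sum_congr rfl fun i _ => by ring
    rw [h6, h4, add_zero] at h5
    exact (mul_eq_zero.1 h5).resolve_right hb
  obtain ⟨c, hc⟩ := hker (w ∘ Sum.inr) (by
    ext i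
    have := h1 i
    rwa [h3, mul_zero, zero_add] at this)
  have h7 : c = 0 := by
    rw [h3, mul_zero, zero_add, hc, dotProduct_smul, dotProduct_comm] at h2
    exact (mul_eq_zero.1 h2).resolve_right hb
  ext i
  rcases i with ⟨⟩ | i
  · exact h3
  · have := congrFun hc i
    simpa [h7] using this

/-- The induction step: once the minor has simple zeros, the border is chosen so that the matrix is
invertible at these zeros; elsewhere the determinant is, up to a nonzero factor, a function plus the
corner entry, so that almost every corner entry works by Sard's lemma. -/
lemma exists_simple_zeros_step {I : Set ℝ} (hI : IsCompact I)
    {Y : ℝ → Matrix (Unit ⊕ m) (Unit ⊕ m) ℝ}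
    (hY : ∀ t ∈ I, ∀ i j, DifferentiableAt ℝ (fun s => Y s i j) t)
    (hs : ∀ t ∈ I, ∀ᶠ s in 𝓝 t, (Y s).IsSymm) {ε : ℝ} (hε : 0 < ε)
    {C' : Matrix m m ℝ} (hC' : C'.IsSymm) (hCε : ∀ i j, |C' i j| < ε) (hC : HasSimpleDetZeros I fun t => (Y t).toBlocks₂₂ + C') :
    ∃ C : Matrix (Unit ⊕ m) (Unit ⊕ m) ℝ, C.IsSymm ∧ (∀ i j, |C i j| < ε) ∧
      HasSimpleDetZeros I fun t => Y t + C := by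
  set M : ℝ → Matrix m m ℝ := fun t => (Y t).toBlocks₂₂ + C' with hMdef
  have hMd : ∀ t ∈ I, ∀ i j, DifferentiableAt ℝ (fun s => M s i j) t := by
    intro t ht i j
    exact (hY t ht (Sum.inr i) (Sum.inr j)).add_const _
  have hMs : ∀ t ∈ I, (M t).IsSymm := by
    intro t ht
    refine Matrix.IsSymm.add ?_ hC'
    ext i j
    exact congrFun (congrFun (hs t ht).self_of_nhds (Sum.inr i)) (Sum.inr j)
  have hMdet : ∀ t ∈ I, DifferentiableAt ℝ (fun s => (M s).det) t := fun t ht =>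
    differentiableAt_det (hMd t ht)
  have hfin := finite_zeros_of_simple hI hMdet hC
  have hv : ∀ t, ∃ v : m → ℝ, t ∈ I → (M t).det = 0 → v ≠ 0 ∧ M t *ᵥ v = 0 := by
    intro t
    by_cases h : (M t).det = 0
    · obtain ⟨v, h1, h2⟩ := Matrix.exists_mulVec_eq_zero_iff.2 h
      exact ⟨v, fun _ _ => ⟨h1, h2⟩⟩
    · exact ⟨0, fun _ h' => absurd h' h⟩
  choose v hv using hv
  set b : ℝ → m → ℝ := fun t j => Y t (Sum.inr j) (Sum.inl ()) with hb
  -- The border `c` avoids finitely many hyperplanes.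
  obtain ⟨c, hcZ, hcε⟩ : ∃ c : m → ℝ,
      (∀ t ∈ {t ∈ I | (M t).det = 0}, v t ⬝ᵥ c ≠ -(v t ⬝ᵥ b t)) ∧ ∀ i, |c i| < ε := by
    have hd : Dense (⋂ t ∈ {t ∈ I | (M t).det = 0}, {c : m → ℝ | v t ⬝ᵥ c ≠ -(v t ⬝ᵥ b t)}) := by
      refine dense_biInter_of_isOpen (fun t _ => ?_) hfin.countable fun t ht => ?_
      · exact isOpen_ne_fun (by fun_prop) (by fun_prop)
      · exact dense_dotProduct_ne (hv t ht.1 ht.2).1 _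
    obtain ⟨c, hc1, hc2⟩ := hd.exists_mem_open (Metric.isOpen_ball (x := (0 : m → ℝ)) (ε := ε))
      ⟨0, Metric.mem_ball_self hε⟩
    refine ⟨c, by simpa using hc1, fun i => ?_⟩
    rw [mem_ball_zero_iff] at hc2
    exact (norm_le_pi_norm c i).trans_lt hc2
  let N : ℝ → ℝ → Matrix (Unit ⊕ m) (Unit ⊕ m) ℝ := fun a t =>
    Matrix.fromBlocks (Matrix.of fun _ _ => Y t (Sum.inl ()) (Sum.inl ()) + a)
      (Matrix.of fun _ => b t + c) (Matrix.of fun i _ => (b t + c) i) (M t)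
  have hNd : ∀ a, ∀ t ∈ I, DifferentiableAt ℝ (fun s => (N a s).det) t := by
    intro a t ht
    refine differentiableAt_det ?_
    rintro (i | i) (j | j)
    · exact (hY t ht _ _).add_const _
    · exact (hY t ht (Sum.inr j) (Sum.inl ())).add_const _
    · exact (hY t ht (Sum.inr i) (Sum.inl ())).add_const _
    · exact hMd t ht i j
  have hN : ∀ a t, (M t).det ≠ 0 →
      (N a t).det = (M t).det * ((N 0 t).det / (M t).det + a) := by
    intro a t h
    let _ : Invertible (M t) := Matrix.invertibleOfIsUnitDet _ (isUnit_iff_ne_zero.2 h)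
    have e : ∀ a, (N a t).det = (M t).det * (Y t (Sum.inl ()) (Sum.inl ()) + a -
        (Matrix.of (fun _ : Unit => b t + c) * ⅟(M t) *
          Matrix.of (fun i (_ : Unit) => (b t + c) i)) () ()) := by
      intro a
      rw [Matrix.det_fromBlocks₂₂, Matrix.det_unique (n := Unit)]
      rfl
    rw [e a, e 0]
    field_simp
    ring
  set g : ℝ → ℝ := fun t => (N 0 t).det / (M t).det with hg
  have hgd : ∀ t ∈ I, (M t).det ≠ 0 → DifferentiableAt ℝ g t := fun t ht h =>
    (hNd 0 t ht).div (hMdet t ht) h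
  -- The corner `a` is chosen so that `-a` is a regular value of `g`.
  obtain ⟨a, ha, haε⟩ : ∃ a, (∀ t ∈ I, (M t).det ≠ 0 → g t = -a → deriv g t ≠ 0) ∧ |a| < ε := by
    set K : Set ℝ := {t | t ∈ I ∧ (M t).det ≠ 0 ∧ deriv g t = 0} with hK
    have h0 : MeasureTheory.volume (g '' K) = 0 := by
      refine MeasureTheory.addHaar_image_eq_zero_of_det_fderivWithin_eq_zero (f' := fun t => 0)
        _ (fun t ht => ?_) fun t _ => ?_
      · have := (hgd t ht.1 ht.2.1).hasDerivAt.hasFDerivAt.hasFDerivWithinAt (s := K)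
        rw [ht.2.2] at this
        simpa using this
      · simp [ContinuousLinearMap.det]
    have h1 : ¬ Ioo (-ε) ε ⊆ g '' K := by
      intro h
      have := MeasureTheory.measure_mono_null h h0
      rw [Real.volume_Ioo] at this
      have : ε - -ε ≤ 0 := by simpa using this
      linarith
    obtain ⟨x, hx, hxK⟩ := Set.not_subset.1 h1
    refine ⟨-x, fun t ht hM hgt hd => hxK ⟨t, ⟨ht, hM, hd⟩, by simpa using hgt⟩, ?_⟩
    rw [abs_neg]
    exact abs_lt.2 hx
  refine ⟨Matrix.fromBlocks (Matrix.of fun _ _ => a) (Matrix.of fun _ => c)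
    (Matrix.of fun i _ => c i) C', ?_, ?_, ?_⟩
  · rw [Matrix.isSymm_fromBlocks_iff]
    exact ⟨by ext; rfl, by ext; rfl, by ext; rfl, hC'⟩
  · rintro (i | i) (j | j)
    · exact haε
    · exact hcε j
    · exact hcε i
    · exact hCε i j
  · set C : Matrix (Unit ⊕ m) (Unit ⊕ m) ℝ := Matrix.fromBlocks (Matrix.of fun _ _ => a)
      (Matrix.of fun _ => c) (Matrix.of fun i _ => c i) C' with hCdef
    have heq : ∀ t ∈ I, (fun s => (Y s + C).det) =ᶠ[𝓝 t] fun s => (N a s).det := by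
      intro t ht
      filter_upwards [hs t ht] with s hsym
      congr 1
      ext (i | i) (j | j)
      · rfl
      · have : Y s (Sum.inl ()) (Sum.inr j) = Y s (Sum.inr j) (Sum.inl ()) :=
          congrFun (congrFun hsym (Sum.inr j)) (Sum.inl ())
        simp [N, hCdef, hb, this]
      · rfl
      · rfl
    intro t ht h0
    simp only at h0 ⊢
    rw [(heq t ht).deriv_eq]
    replace h0 : (N a t).det = 0 := (heq t ht).self_of_nhds.symm.trans h0
    by_cases hMt : (M t).det = 0
    · exfalso
      obtain ⟨hv0, hvM⟩ := hv t ht hMt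
      refine det_bordered_ne_zero (b := b t + c) (v := v t) _ (hMs t ht) hvM (fun u hu => ?_) ?_ h0
      · exact mem_span_of_deriv_det_ne_zero (hMd t ht) (hC t ht hMt) hu hvM hv0
      · rw [dotProduct_add]
        have := hcZ t ⟨ht, hMt⟩
        intro h
        exact this (by linarith)
    · have hga : g t = -a := by
        rw [hN a t hMt] at h0
        have := (mul_eq_zero.1 h0).resolve_left hMt
        simp only [hg]
        linarith
      have hnear : (fun s => (N a s).det) =ᶠ[𝓝 t] fun s => (M s).det * (g s + a) := by
        filter_upwards [(hMdet t ht).continuousAt.eventually_ne hMt] with s hs'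
        exact hN a s hs'
      rw [hnear.deriv_eq]
      have hd := (hMdet t ht).hasDerivAt.mul ((hgd t ht hMt).hasDerivAt.add_const a)
      have hd' : deriv (fun s => (M s).det * (g s + a)) t = _ := hd.deriv
      rw [hd', hga]
      simpa using ⟨hMt, ha t ht hMt hga⟩

/-- A path of symmetric matrices becomes transverse to the singular matrices after adding an
arbitrarily small constant symmetric matrix. -/
theorem exists_simple_zeros {N : ℕ} {I : Set ℝ} (hI : IsCompact I)
    {Y : ℝ → Matrix (Fin N) (Fin N) ℝ}
    (hY : ∀ t ∈ I, ∀ i j, DifferentiableAt ℝ (fun s => Y s i j) t)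
    (hs : ∀ t ∈ I, ∀ᶠ s in 𝓝 t, (Y s).IsSymm) {ε : ℝ} (hε : 0 < ε) :
    ∃ C : Matrix (Fin N) (Fin N) ℝ, C.IsSymm ∧ (∀ i j, |C i j| < ε) ∧
      HasSimpleDetZeros I fun t => Y t + C := by
  induction N with
  | zero =>
    refine ⟨0, by simp [Matrix.IsSymm], fun i => i.elim0, fun t _ h => ?_⟩
    simp at h
  | succ N ih =>
    let e : Unit ⊕ Fin N ≃ Fin (N + 1) :=
      (Equiv.sumCongr (Equiv.ofUnique Unit (Fin 1)) (Equiv.refl _)).trans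
        (finSumFinEquiv.trans (finCongr (add_comm 1 N)))
    let Z : ℝ → Matrix (Unit ⊕ Fin N) (Unit ⊕ Fin N) ℝ := fun t => (Y t).submatrix e e
    have hZ : ∀ t ∈ I, ∀ i j, DifferentiableAt ℝ (fun s => Z s i j) t := fun t ht i j =>
      hY t ht (e i) (e j)
    have hZs : ∀ t ∈ I, ∀ᶠ s in 𝓝 t, (Z s).IsSymm := fun t ht =>
      (hs t ht).mono fun s h => h.submatrix e
    obtain ⟨C', h1, h2, h3⟩ := ih (Y := fun t => (Z t).toBlocks₂₂) (fun t ht i j => hZ t ht _ _)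
      fun t ht => (hZs t ht).mono fun s h => by
        ext i j
        exact congrFun (congrFun h (Sum.inr i)) (Sum.inr j)
    obtain ⟨C, h4, h5, h6⟩ := exists_simple_zeros_step hI hZ hZs hε h1 h2 h3
    refine ⟨C.submatrix e.symm e.symm, h4.submatrix _, fun i j => h5 _ _, ?_⟩
    have hdet : ∀ t, (Y t + C.submatrix e.symm e.symm).det = (Z t + C).det := by
      intro t
      rw [← Matrix.det_submatrix_equiv_self e]
      congr 1
      ext i j
      simp [Z]
    intro t ht h0
    simp only [hdet] at h0 ⊢
    exact h6 t ht h0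

end SimpleZeros

/-! ### Differentials of vertically foliated charts -/

/- Shortcuts for the instance search on `T*M`. -/
namespace CotInstances

variable {d : ℕ} {M : Type*} [TopologicalSpace M] [ChartedSpace (Rn d) M]
  [IsManifold 𝓘(ℝ, Rn d) ∞ M]

scoped instance : TopologicalSpace (Cot d M) := inferInstance
scoped instance : ChartedSpace (ModelProd (Rn d) (Rn d →L[ℝ] ℝ)) (Cot d M) := inferInstance
scoped instance : IsManifold (JCot d) 1 (Cot d M) := inferInstance

end CotInstances

open scoped CotInstances

section Charts

variable {d : ℕ} {M : Type*} [TopologicalSpace M] [ChartedSpace (Rn d) M]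
  [IsManifold 𝓘(ℝ, Rn d) ∞ M]

/-- The image of a tangent vector of `T*M` by the differential of the chart `F`. -/
def chartVec (F : OpenPartialHomeomorph (Cot d M) (Rn d × Rn d)) (z : TTCot d M) : Rn d × Rn d :=
  dChart F z.proj z.2

lemma contMDiffOn_chartVec {F : OpenPartialHomeomorph (Cot d M) (Rn d × Rn d)}
    (hF : IsSmoothChart F) :
    ContMDiffOn (JCot d).tangent 𝓘(ℝ, Rn d × Rn d) ∞ (chartVec F)
      {z : TTCot d M | z.proj ∈ F.source} := by
  have hu : UniqueMDiffOn (JCot d) F.source := F.open_source.uniqueMDiffOn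
  have h1 := hF.1.contMDiffOn_tangentMapWithin (m := ∞) (by simp) hu
  have h2 := (contMDiff_snd_tangentBundle_modelSpace (Rn d × Rn d) 𝓘(ℝ, Rn d × Rn d)
    (n := ∞)).comp_contMDiffOn h1
  refine h2.congr fun z hz => ?_
  simp only [Function.comp, tangentMapWithin, chartVec, dChart]
  rw [mfderivWithin_of_isOpen F.open_source hz]
  rfl

lemma IsSmoothChart.mdifferentiable {F : OpenPartialHomeomorph (Cot d M) (Rn d × Rn d)}
    (hF : IsSmoothChart F) : F.MDifferentiable (JCot d) 𝓘(ℝ, Rn d × Rn d) :=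
  ⟨hF.1.mdifferentiableOn (by simp), hF.2.mdifferentiableOn (by simp)⟩

/-- The position coordinates of the image of a tangent vector by the differential of a chart. -/
def qC (F : OpenPartialHomeomorph (Cot d M) (Rn d × Rn d)) (x : Cot d M) :
    TCot x →ₗ[ℝ] (Fin d → ℝ) :=
  (WithLp.linearEquiv 2 ℝ (Fin d → ℝ)).toLinearMap ∘ₗ LinearMap.fst ℝ _ _ ∘ₗ
    (dChart F x).toLinearMap

/-- The momentum coordinates of the image of a tangent vector by the differential of a chart. -/
def pC (F : OpenPartialHomeomorph (Cot d M) (Rn d × Rn d)) (x : Cot d M) :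
    TCot x →ₗ[ℝ] (Fin d → ℝ) :=
  (WithLp.linearEquiv 2 ℝ (Fin d → ℝ)).toLinearMap ∘ₗ LinearMap.snd ℝ _ _ ∘ₗ
    (dChart F x).toLinearMap

lemma qC_apply (F : OpenPartialHomeomorph (Cot d M) (Rn d × Rn d)) (x : Cot d M) (v : TCot x) :
    qC F x v = (dChart F x v).1.ofLp := rfl

lemma pC_apply (F : OpenPartialHomeomorph (Cot d M) (Rn d × Rn d)) (x : Cot d M) (v : TCot x) :
    pC F x v = (dChart F x v).2.ofLp := rfl

lemma stdForm_eq (u v : Rn d × Rn d) :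
    stdForm u v = u.1.ofLp ⬝ᵥ v.2.ofLp - u.2.ofLp ⬝ᵥ v.1.ofLp := by
  simp [stdForm, EuclideanSpace.inner_eq_star_dotProduct, dotProduct_comm]

section SmoothChart

variable {F : OpenPartialHomeomorph (Cot d M) (Rn d × Rn d)} (hF : IsSmoothChart F)
  {x : Cot d M} (hx : x ∈ F.source)

/-- The differential of a chart as a linear isomorphism in position and momentum coordinates. -/
def coordEquiv : TCot x ≃ₗ[ℝ] (Fin d → ℝ) × (Fin d → ℝ) :=
  (hF.mdifferentiable.mfderiv hx).toLinearEquiv.trans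
    (LinearEquiv.prodCongr (WithLp.linearEquiv 2 ℝ (Fin d → ℝ))
      (WithLp.linearEquiv 2 ℝ (Fin d → ℝ)))

lemma coordEquiv_apply (v : TCot x) : coordEquiv hF hx v = (qC F x v, pC F x v) := rfl

lemma qC_symm (z : (Fin d → ℝ) × (Fin d → ℝ)) : qC F x ((coordEquiv hF hx).symm z) = z.1 :=
  congrArg Prod.fst ((coordEquiv hF hx).apply_symm_apply z)

lemma pC_symm (z : (Fin d → ℝ) × (Fin d → ℝ)) : pC F x ((coordEquiv hF hx).symm z) = z.2 :=
  congrArg Prod.snd ((coordEquiv hF hx).apply_symm_apply z)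

include hF hx in
lemma eq_of_coords {u v : TCot x} (h1 : qC F x u = qC F x v) (h2 : pC F x u = pC F x v) :
    u = v :=
  (coordEquiv hF hx).injective (Prod.ext h1 h2)

end SmoothChart

lemma finrank_tangent (x : Cot d M) : Module.finrank ℝ (TCot x) = d + d := by
  have : Module.finrank ℝ (Rn d × (Rn d →L[ℝ] ℝ)) = d + d := by
    rw [Module.finrank_prod,
      ← (LinearMap.toContinuousLinearMap (𝕜 := ℝ) (E := Rn d) (F' := ℝ)).finrank_eq]
    simp
  exact this

instance (x : Cot d M) : FiniteDimensional ℝ (TCot x) :=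
  inferInstanceAs (FiniteDimensional ℝ (Rn d × (Rn d →L[ℝ] ℝ)))

lemma finrank_vert (x : Cot d M) : Module.finrank ℝ (vert x) = d := by
  set e := trivializationAt (Rn d →L[ℝ] ℝ)
    (fun q : M => TangentSpace 𝓘(ℝ, Rn d) q →L[ℝ] Bundle.Trivial M ℝ q) x.proj with he
  have hx : x ∈ e.source := FiberBundle.mem_trivializationAt_proj_source
  have hm : e.toOpenPartialHomeomorph.MDifferentiable (JCot d)
      (𝓘(ℝ, Rn d).prod 𝓘(ℝ, Rn d →L[ℝ] ℝ)) :=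
    ⟨(e.contMDiffOn (n := ∞) (IB := 𝓘(ℝ, Rn d))).mdifferentiableOn (by simp),
      (e.contMDiffOn_symm (n := ∞) (IB := 𝓘(ℝ, Rn d))).mdifferentiableOn (by simp)⟩
  have hsurj : Function.Surjective (mfderiv (JCot d) 𝓘(ℝ, Rn d) (proj : Cot d M → M) x) := by
    have h1 := (hasMFDerivAt_fst (I := 𝓘(ℝ, Rn d)) (I' := 𝓘(ℝ, Rn d →L[ℝ] ℝ)) (e x)).comp x
      (hm.mdifferentiableAt hx).hasMFDerivAt
    have h2 : (proj : Cot d M → M) =ᶠ[𝓝 x] Prod.fst ∘ e := by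
      filter_upwards [e.open_source.mem_nhds hx] with y hy
      exact (e.coe_fst hy).symm
    have h3 := (h1.congr_of_eventuallyEq h2).mfderiv
    rw [h3]
    exact Prod.fst_surjective.comp (hm.mfderiv_surjective hx)
  have h := LinearMap.finrank_range_add_finrank_ker
    (mfderiv (JCot d) 𝓘(ℝ, Rn d) (proj : Cot d M → M) x).toLinearMap
  rw [LinearMap.range_eq_top.2 hsurj, finrank_top, finrank_tangent] at h
  have h2 : Module.finrank ℝ (TangentSpace 𝓘(ℝ, Rn d) (proj x)) = d := by
    have : Module.finrank ℝ (Rn d) = d := by simp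
    exact this
  rw [h2] at h
  exact Nat.add_left_cancel h

/-- In a vertically foliated chart the vertical is the space of vectors without position
component. -/
lemma mem_vert_iff {F : OpenPartialHomeomorph (Cot d M) (Rn d × Rn d)}
    (hF : IsVerticallyFoliated F) {x : Cot d M} (hx : x ∈ F.source) (v : TCot x) :
    v ∈ vert x ↔ qC F x v = 0 := by
  have hs := hF.1
  have hm := hs.mdifferentiable
  obtain ⟨-, -, I, J, -, -, ht, hfib⟩ := hF
  -- The fibre directions of the chart are tangent to the cotangent fibre.
  have hle : LinearMap.ker (qC F x) ≤ vert x := by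
    intro u hu
    set w : Rn d × Rn d := dChart F x u with hw
    have hw1 : w.1 = 0 := by
      have : w.1.ofLp = 0 := hu
      ext i
      exact congrFun this i
    let c : ℝ → Rn d × Rn d := fun s => F x + s • w
    have hc : HasDerivAt c w 0 := by
      have := ((hasDerivAt_id (0 : ℝ)).smul_const w).const_add (F x)
      rwa [one_smul] at this
    have hc0 : c 0 = F x := by simp [c]
    have hFx : F x ∈ F.target := F.map_source hx
    have hev : ∀ᶠ s in 𝓝 (0 : ℝ), proj (F.symm (c s)) = proj x := by
      have h1 : ∀ᶠ s in 𝓝 (0 : ℝ), c s ∈ F.target :=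
        hc.continuousAt.eventually (by rw [hc0]; exact F.open_target.mem_nhds hFx)
      filter_upwards [h1] with s hs1
      have h2 : c s ∈ ({(F x).1} : Set (Rn d)) ×ˢ box d J := by
        refine ⟨by simp [c, hw1], ?_⟩
        rw [ht] at hs1
        exact hs1.2
      rw [← hfib x hx] at h2
      obtain ⟨y, ⟨hy1, hy2⟩, hy3⟩ := h2
      rw [← hy3, F.left_inv hy2]
      exact hy1
    have hp : MDifferentiableAt (JCot d) 𝓘(ℝ, Rn d) (proj : Cot d M → M) (F.symm (c 0)) :=
      mdifferentiableAt_proj _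
    have hFs : MDifferentiableAt 𝓘(ℝ, Rn d × Rn d) (JCot d) F.symm (c 0) := by
      rw [hc0]
      exact hm.mdifferentiableAt_symm hFx
    have h3 := (hp.hasMFDerivAt.comp (c 0) hFs.hasMFDerivAt).comp (0 : ℝ)
      hc.hasFDerivAt.hasMFDerivAt
    have h5 := hasMFDerivAt_unique (h3.congr_of_eventuallyEq
      (show (fun _ : ℝ => proj x) =ᶠ[𝓝 0] _ from hev.mono fun s hs => hs.symm))
      (hasMFDerivAt_const (proj x) (0 : ℝ))
    have h6 : mfderiv (JCot d) 𝓘(ℝ, Rn d) (proj : Cot d M → M) (F.symm (c 0))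
        (mfderiv 𝓘(ℝ, Rn d × Rn d) (JCot d) F.symm (c 0) w) = 0 := by
      have h7 := DFunLike.congr_fun h5 (1 : ℝ)
      have h8 : (ContinuousLinearMap.toSpanSingleton ℝ w) (1 : ℝ) = w := by simp
      rw [← h8]
      exact h7
    rw [hc0, F.left_inv hx] at h6
    have h9 : mfderiv 𝓘(ℝ, Rn d × Rn d) (JCot d) F.symm (F x) w = u :=
      DFunLike.congr_fun (hm.symm_comp_deriv hx) u
    exact (congrArg (mfderiv (JCot d) 𝓘(ℝ, Rn d) (proj : Cot d M → M) x) h9).symm.trans h6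
  have heq : LinearMap.ker (qC F x) = vert x := by
    refine Submodule.eq_of_le_of_finrank_eq hle ?_
    rw [finrank_vert]
    have h := LinearMap.finrank_range_add_finrank_ker (qC F x)
    have hsurj : Function.Surjective (qC F x) := fun z => ⟨_, qC_symm hs hx (z, 0)⟩
    rw [LinearMap.range_eq_top.2 hsurj, finrank_top, finrank_tangent,
      Module.finrank_fintype_fun_eq_card, Fintype.card_fin] at h
    exact Nat.add_left_cancel h
  rw [← heq, LinearMap.mem_ker]

end Charts

/-! ### Slopes of Lagrangian subspaces in a chart -/

section Slopes

variable {d : ℕ} {M : Type*} [TopologicalSpace M] [ChartedSpace (Rn d) M]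
  [IsManifold 𝓘(ℝ, Rn d) ∞ M]

/-- `S` is the slope of `L` in the chart `F`: in the coordinates of `F`, the subspace `L` is the
graph `q = S p` over the momentum coordinates. -/
def IsSlope (F : OpenPartialHomeomorph (Cot d M) (Rn d × Rn d)) (L : SubspaceAt d M)
    (S : Matrix (Fin d) (Fin d) ℝ) : Prop :=
  L.pt ∈ F.source ∧ ∀ z, z ∈ L.sub ↔ qC F L.pt z = S *ᵥ pC F L.pt z

variable {F : OpenPartialHomeomorph (Cot d M) (Rn d × Rn d)} {L : SubspaceAt d M}
  {S S' : Matrix (Fin d) (Fin d) ℝ}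

/-- The symplectic form in the coordinates of a vertically foliated chart. -/
lemma omega_eq (hF : IsVerticallyFoliated F) {x : Cot d M} (hx : x ∈ F.source) (u v : TCot x) :
    omega x u v = qC F x u ⬝ᵥ pC F x v - pC F x u ⬝ᵥ qC F x v := by
  rw [← hF.2.1 x hx u v, stdForm_eq]
  rfl

lemma IsSlope.mem (h : IsSlope F L S) (hF : IsSmoothChart F) (p : Fin d → ℝ) :
    (coordEquiv hF h.1).symm (S *ᵥ p, p) ∈ L.sub := by
  rw [h.2, qC_symm, pC_symm]

lemma IsSlope.unique (hF : IsSmoothChart F) (h : IsSlope F L S) (h' : IsSlope F L S') :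
    S = S' := by
  refine Matrix.ext_of_mulVec_single fun i => ?_
  have := (h'.2 _).1 (h.mem hF (Pi.single i 1))
  rwa [qC_symm, pC_symm] at this

lemma dotProduct_mulVec_comm_of_isSymm {n : Type*} [Fintype n] {S : Matrix n n ℝ} (hS : S.IsSymm)
    (u v : n → ℝ) : (S *ᵥ u) ⬝ᵥ v = u ⬝ᵥ (S *ᵥ v) := by
  rw [Matrix.dotProduct_mulVec, ← Matrix.mulVec_transpose, hS.eq]

lemma isSymm_of_dotProduct_mulVec {n : Type*} [Fintype n] [DecidableEq n] {S : Matrix n n ℝ}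
    (h : ∀ u v, (S *ᵥ u) ⬝ᵥ v = u ⬝ᵥ (S *ᵥ v)) : S.IsSymm := by
  ext i j
  have := h (Pi.single i 1) (Pi.single j 1)
  simpa using this

lemma IsSlope.isSymm (hF : IsVerticallyFoliated F) (h : IsSlope F L S)
    (hL : ∀ u ∈ L.sub, ∀ v ∈ L.sub, omega L.pt u v = 0) : S.IsSymm := by
  refine isSymm_of_dotProduct_mulVec fun u v => ?_
  have := hL _ (h.mem hF.1 u) _ (h.mem hF.1 v)
  rw [omega_eq hF h.1, qC_symm, qC_symm, pC_symm, pC_symm] at this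
  linarith

lemma IsSlope.isLagrangian (hF : IsVerticallyFoliated F) (h : IsSlope F L S) (hS : S.IsSymm) :
    L.IsLagrangian := by
  intro u
  constructor
  · intro hu v hv
    rw [omega_eq hF h.1, (h.2 u).1 hu, (h.2 v).1 hv, dotProduct_mulVec_comm_of_isSymm hS, sub_self]
  · intro hu
    rw [h.2]
    refine dotProduct_eq _ _ fun p => ?_
    have := hu _ (h.mem hF.1 p)
    rw [omega_eq hF h.1, qC_symm, pC_symm, ← dotProduct_mulVec_comm_of_isSymm hS] at this
    linarith

lemma SubspaceAt.IsLagrangian.isotropic (hL : L.IsLagrangian) :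
    ∀ u ∈ L.sub, ∀ v ∈ L.sub, omega L.pt u v = 0 := fun u hu => (hL u).1 hu

lemma IsSlope.finrank_inf {x : Cot d M} {A B : Submodule ℝ (TCot x)}
    (hF : IsSmoothChart F) (h : IsSlope F ⟨x, A⟩ S) (h' : IsSlope F ⟨x, B⟩ S') :
    Module.finrank ℝ (A ⊓ B : Submodule ℝ (TCot x)) =
      Module.finrank ℝ (LinearMap.ker (S - S').mulVecLin) := by
  have hker : ∀ p, p ∈ LinearMap.ker (S - S').mulVecLin ↔ S *ᵥ p = S' *ᵥ p := by
    intro p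
    rw [LinearMap.mem_ker, Matrix.mulVecLin_apply, Matrix.sub_mulVec, sub_eq_zero]
  let f : (A ⊓ B : Submodule ℝ (TCot x)) →ₗ[ℝ] (Fin d → ℝ) := pC F x ∘ₗ Submodule.subtype _
  have hinj : Function.Injective f := by
    rintro ⟨u, hu⟩ ⟨v, hv⟩ huv
    have huv' : pC F x u = pC F x v := huv
    refine Subtype.ext (eq_of_coords hF h.1 ?_ huv')
    have h1 : qC F x u = S *ᵥ pC F x u := (h.2 u).1 hu.1
    have h2 : qC F x v = S *ᵥ pC F x v := (h.2 v).1 hv.1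
    rw [h1, h2, huv']
  rw [← LinearMap.finrank_range_of_inj hinj]
  suffices e : LinearMap.range f = LinearMap.ker (S - S').mulVecLin by rw [e]
  ext p
  rw [hker]
  constructor
  · rintro ⟨⟨u, hu⟩, rfl⟩
    exact ((h.2 u).1 hu.1).symm.trans ((h'.2 u).1 hu.2)
  · intro hp
    refine ⟨⟨_, h.mem hF p, ?_⟩, pC_symm hF h.1 _⟩
    have := h'.mem hF p
    rwa [← hp] at this

lemma isSlope_vert (hF : IsVerticallyFoliated F) {x : Cot d M} (hx : x ∈ F.source) :
    IsSlope F ⟨x, vert x⟩ 0 :=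
  ⟨hx, fun z => by rw [mem_vert_iff hF hx z, Matrix.zero_mulVec]⟩

lemma IsSlope.finrank_inf_vert (hF : IsVerticallyFoliated F) (h : IsSlope F L S) :
    Module.finrank ℝ (L.sub ⊓ vert L.pt : Submodule ℝ (TCot L.pt)) =
      Module.finrank ℝ (LinearMap.ker S.mulVecLin) := by
  have := IsSlope.finrank_inf (x := L.pt) (A := L.sub) hF.1 h (isSlope_vert hF h.1)
  rwa [sub_zero] at this

lemma IsSlope.regularSingular_iff (hF : IsVerticallyFoliated F) (h : IsSlope F L S) :
    L.RegularSingular ↔ Module.finrank ℝ (LinearMap.ker S.mulVecLin) = 1 := by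
  rw [SubspaceAt.RegularSingular, h.finrank_inf_vert hF]

lemma IsSlope.singular_iff (hF : IsVerticallyFoliated F) (h : IsSlope F L S) :
    L.Singular ↔ S.det = 0 := by
  rw [SubspaceAt.Singular, ← Matrix.exists_mulVec_eq_zero_iff]
  have : L.sub ⊓ vert L.pt = ⊥ ↔ LinearMap.ker S.mulVecLin = ⊥ := by
    rw [← Submodule.finrank_eq_zero, ← Submodule.finrank_eq_zero, h.finrank_inf_vert hF]
  rw [Ne, this, LinearMap.ker_eq_bot']
  push Not
  exact exists_congr fun v => and_comm

lemma IsSlope.isCompl (hF : IsSmoothChart F) (h : IsSlope F L S) :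
    IsCompl (horiz F L.pt) L.sub := by
  have hK : ∀ z, z ∈ horiz F L.pt ↔ pC F L.pt z = 0 := by
    intro z
    constructor
    · intro hz
      have : (dChart F L.pt z).2 = 0 := hz
      rw [pC_apply, this]
      rfl
    · intro hz
      have : (dChart F L.pt z).2 = 0 := by
        ext i
        exact congrFun hz i
      exact this
  rw [isCompl_iff, disjoint_iff, codisjoint_iff, Submodule.eq_bot_iff, Submodule.eq_top_iff']
  constructor
  · rintro z ⟨h1, h2⟩
    have h3 := (hK z).1 h1
    have h4 := (h.2 z).1 h2
    rw [h3, Matrix.mulVec_zero] at h4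
    exact eq_of_coords hF h.1 (h4.trans (map_zero _).symm) (h3.trans (map_zero _).symm)
  · intro z
    refine Submodule.mem_sup.2 ⟨z - (coordEquiv hF h.1).symm (S *ᵥ pC F L.pt z, pC F L.pt z),
      ?_, _, h.mem hF _, sub_add_cancel _ _⟩
    rw [hK, map_sub, pC_symm, sub_self]

lemma exists_isSlope_of_isCompl (hF : IsSmoothChart F) (hx : L.pt ∈ F.source)
    (h : IsCompl (horiz F L.pt) L.sub) : ∃ S, IsSlope F L S := by
  let f : L.sub →ₗ[ℝ] (Fin d → ℝ) := pC F L.pt ∘ₗ L.sub.subtype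
  have hK : ∀ z, pC F L.pt z = 0 → z ∈ horiz F L.pt := by
    intro z hz
    have : (dChart F L.pt z).2 = 0 := by
      ext i
      exact congrFun hz i
    exact this
  have hK' : ∀ z ∈ horiz F L.pt, pC F L.pt z = 0 := by
    intro z hz
    have : (dChart F L.pt z).2 = 0 := hz
    rw [pC_apply, this]
    rfl
  have hinj : Function.Injective f := by
    rw [← LinearMap.ker_eq_bot, LinearMap.ker_eq_bot']
    rintro ⟨z, hz⟩ h0
    exact Subtype.ext (Submodule.disjoint_def.1 h.disjoint z (hK z h0) hz)
  have hsurj : Function.Surjective f := by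
    intro p
    set z := (coordEquiv hF hx).symm (0, p)
    obtain ⟨k, hk, l, hl, hkl⟩ := Submodule.mem_sup.1
      (h.sup_eq_top ▸ Submodule.mem_top : z ∈ horiz F L.pt ⊔ L.sub)
    refine ⟨⟨l, hl⟩, ?_⟩
    have : pC F L.pt z = p := pC_symm hF hx _
    rw [← hkl, map_add, hK' k hk, zero_add] at this
    exact this
  let e := LinearEquiv.ofBijective f ⟨hinj, hsurj⟩
  refine ⟨LinearMap.toMatrix' (qC F L.pt ∘ₗ L.sub.subtype ∘ₗ e.symm.toLinearMap), hx, fun z => ?_⟩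
  rw [LinearMap.toMatrix'_mulVec]
  constructor
  · intro hz
    have : e.symm (pC F L.pt z) = ⟨z, hz⟩ := by
      rw [LinearEquiv.symm_apply_eq]
      rfl
    simp [this]
  · intro hz
    have h1 : pC F L.pt (e.symm (pC F L.pt z)) = pC F L.pt z := e.apply_symm_apply _
    have : z = e.symm (pC F L.pt z) := eq_of_coords hF hx hz h1.symm
    rw [this]
    exact (e.symm _).2

/-- The index of the height of `L` over the vertical is the positive index of the slope. -/
lemma IsSlope.hasHeightIndex_iff (hF : IsVerticallyFoliated F) (h : IsSlope F L S) (n : ℕ) :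
    HasHeightIndex F L n ↔ posIndex S = n := by
  have hV := (isSlope_vert hF h.1).isCompl hF.1
  have hL := h.isCompl hF.1
  have key : sigNeg (height (omega L.pt) (horiz F L.pt) (vert L.pt) L.sub hV hL) = posIndex S := by
    have hinj : Function.Injective (pC F L.pt ∘ₗ L.sub.subtype) := by
      rintro ⟨u, hu⟩ ⟨v, hv⟩ huv
      have huv' : pC F L.pt u = pC F L.pt v := huv
      refine Subtype.ext (eq_of_coords hF.1 h.1 ?_ huv')
      rw [(h.2 u).1 hu, (h.2 v).1 hv, huv']
    let eL : L.sub ≃ₗ[ℝ] (Fin d → ℝ) := LinearEquiv.ofBijective (pC F L.pt ∘ₗ L.sub.subtype)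
      ⟨hinj, fun p => ⟨⟨_, h.mem hF.1 p⟩, pC_symm hF.1 h.1 _⟩⟩
    let e := (Submodule.quotientEquivOfIsCompl _ _ hL).trans eL
    rw [← negIndex_neg]
    refine QuadraticMap.Equivalent.sigNeg_eq ⟨⟨e, fun v => ?_⟩⟩
    set a := Submodule.quotientEquivOfIsCompl _ _ hV v with ha
    set l := Submodule.quotientEquivOfIsCompl _ _ hL v with hl
    have hal : (a : TCot L.pt) - l ∈ horiz F L.pt := by
      rw [← Submodule.Quotient.eq, ha, hl, Submodule.mk_quotientEquivOfIsCompl_apply,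
        Submodule.mk_quotientEquivOfIsCompl_apply]
    have hp : pC F L.pt a = pC F L.pt l := by
      have h1 : (dChart F L.pt ((a : TCot L.pt) - l)).2 = 0 := hal
      have h2 : pC F L.pt ((a : TCot L.pt) - l) = 0 := by
        rw [pC_apply, h1]
        rfl
      rwa [map_sub, sub_eq_zero] at h2
    have hq : qC F L.pt a = 0 := (mem_vert_iff hF h.1 _).1 a.2
    have hql : qC F L.pt l = S *ᵥ pC F L.pt l := (h.2 _).1 l.2
    have h1 : height (omega L.pt) (horiz F L.pt) (vert L.pt) L.sub hV hL v = omega L.pt a l := rfl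
    have h2 : e v = pC F L.pt l := rfl
    change Matrix.toQuadraticForm' (-S) (e v) = _
    rw [h1, h2, toQuadraticForm'_apply, omega_eq hF h.1, hq, hp, hql, Matrix.neg_mulVec,
      zero_dotProduct, dotProduct_neg, zero_sub]
  constructor
  · rintro ⟨-, hV', hL', hn⟩
    rw [← key]
    exact hn
  · intro hn
    exact ⟨h.1, hV, hL, key.trans hn⟩

lemma HasHeightIndex.exists_isSlope (hF : IsSmoothChart F) {n : ℕ} (h : HasHeightIndex F L n) :
    ∃ S, IsSlope F L S :=
  let ⟨hx, _, hL, _⟩ := h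
  exists_isSlope_of_isCompl hF hx hL

end Slopes

/-! ### Frames and changes of charts -/

section Frames

variable {d : ℕ} {M : Type*} [TopologicalSpace M] [ChartedSpace (Rn d) M]
  [IsManifold 𝓘(ℝ, Rn d) ∞ M]

/-- The tangent vectors `w 0, …, w (d-1)` form a basis of `L`. -/
def IsFrameOf (w : Fin d → TTCot d M) (L : SubspaceAt d M) : Prop :=
  ∃ v : Fin d → TCot L.pt, (∀ i, w i = ⟨L.pt, v i⟩) ∧ LinearIndependent ℝ v ∧
    Submodule.span ℝ (range v) = L.sub

/-- The matrix of the position coordinates of a tuple of tangent vectors. -/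
def qMat (F : OpenPartialHomeomorph (Cot d M) (Rn d × Rn d)) (w : Fin d → TTCot d M) :
    Matrix (Fin d) (Fin d) ℝ :=
  Matrix.of fun j i => (chartVec F (w i)).1 j

/-- The matrix of the momentum coordinates of a tuple of tangent vectors. -/
def pMat (F : OpenPartialHomeomorph (Cot d M) (Rn d × Rn d)) (w : Fin d → TTCot d M) :
    Matrix (Fin d) (Fin d) ℝ :=
  Matrix.of fun j i => (chartVec F (w i)).2 j

variable {F F' : OpenPartialHomeomorph (Cot d M) (Rn d × Rn d)} {L : SubspaceAt d M}
  {w : Fin d → TTCot d M} {S S' : Matrix (Fin d) (Fin d) ℝ}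

lemma qMat_mulVec {x : Cot d M} {v : Fin d → TCot x} (hw : ∀ i, w i = ⟨x, v i⟩)
    (u : Fin d → ℝ) : qMat F w *ᵥ u = qC F x (∑ i, u i • v i) := by
  ext j
  rw [map_sum, Finset.sum_apply]
  simp only [Matrix.mulVec, dotProduct, qMat, Matrix.of_apply, map_smul, Pi.smul_apply,
    smul_eq_mul]
  refine Finset.sum_congr rfl fun i _ => ?_
  rw [hw i, mul_comm]
  rfl

lemma pMat_mulVec {x : Cot d M} {v : Fin d → TCot x} (hw : ∀ i, w i = ⟨x, v i⟩)
    (u : Fin d → ℝ) : pMat F w *ᵥ u = pC F x (∑ i, u i • v i) := by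
  ext j
  rw [map_sum, Finset.sum_apply]
  simp only [Matrix.mulVec, dotProduct, pMat, Matrix.of_apply, map_smul, Pi.smul_apply,
    smul_eq_mul]
  refine Finset.sum_congr rfl fun i _ => ?_
  rw [hw i, mul_comm]
  rfl

lemma IsFrameOf.isSlope (hF : IsSmoothChart F) (hw : IsFrameOf w L) (hx : L.pt ∈ F.source)
    (hP : (pMat F w).det ≠ 0) : IsSlope F L (qMat F w * (pMat F w)⁻¹) := by
  obtain ⟨v, h1, -, h3⟩ := hw
  have hu : IsUnit (pMat F w).det := isUnit_iff_ne_zero.2 hP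
  refine ⟨hx, fun z => ?_⟩
  rw [← h3, Submodule.mem_span_range_iff_exists_fun]
  constructor
  · rintro ⟨u, rfl⟩
    rw [← qMat_mulVec h1, ← pMat_mulVec h1, Matrix.mulVec_mulVec, Matrix.mul_assoc,
      Matrix.nonsing_inv_mul _ hu, Matrix.mul_one]
  · intro hz
    refine ⟨(pMat F w)⁻¹ *ᵥ pC F L.pt z, eq_of_coords hF hx ?_ ?_⟩
    · rw [← qMat_mulVec h1, hz, Matrix.mulVec_mulVec]
    · rw [← pMat_mulVec h1, Matrix.mulVec_mulVec, Matrix.mul_nonsing_inv _ hu, Matrix.one_mulVec]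

lemma IsSlope.det_pMat_ne_zero (hF : IsSmoothChart F) (hw : IsFrameOf w L) (h : IsSlope F L S) :
    (pMat F w).det ≠ 0 := by
  obtain ⟨v, h1, h2, h3⟩ := hw
  intro h0
  obtain ⟨u, hu0, hu⟩ := Matrix.exists_mulVec_eq_zero_iff.2 h0
  rw [pMat_mulVec h1] at hu
  have hmem : ∑ i, u i • v i ∈ L.sub := by
    rw [← h3, Submodule.mem_span_range_iff_exists_fun]
    exact ⟨u, rfl⟩
  have hq := (h.2 _).1 hmem
  rw [hu, Matrix.mulVec_zero] at hq
  have hz : ∑ i, u i • v i = 0 :=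
    eq_of_coords hF h.1 (hq.trans (map_zero _).symm) (hu.trans (map_zero _).symm)
  exact hu0 (funext fun i => Fintype.linearIndependent_iff.1 h2 u hz i)

lemma IsSlope.eq_qMat_mul (hF : IsSmoothChart F) (hw : IsFrameOf w L) (h : IsSlope F L S) :
    S = qMat F w * (pMat F w)⁻¹ :=
  h.unique hF (hw.isSlope hF h.1 (h.det_pMat_ne_zero hF hw))

lemma continuousAt_chartVec (hF : IsSmoothChart F) {z : TTCot d M} (hz : z.proj ∈ F.source) :
    ContinuousAt (chartVec F) z := by
  have hc : Continuous (TotalSpace.proj : TTCot d M → Cot d M) :=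
    FiberBundle.continuous_proj _ _
  exact (contMDiffOn_chartVec hF).continuousOn.continuousAt
    ((F.open_source.preimage hc).mem_nhds hz)

lemma continuousAt_qMat (hF : IsSmoothChart F) (hw : ∀ i, (w i).proj ∈ F.source) :
    ContinuousAt (qMat F) w := by
  refine continuousAt_pi.2 fun j => continuousAt_pi.2 fun i => ?_
  have h1 : ContinuousAt (fun w : Fin d → TTCot d M => chartVec F (w i)) w :=
    ContinuousAt.comp (f := fun w : Fin d → TTCot d M => w i) (continuousAt_chartVec hF (hw i))
      (continuous_apply i).continuousAt
  have h2 : Continuous fun y : Rn d × Rn d => y.1 j := by fun_prop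
  exact h2.continuousAt.comp h1

lemma continuousAt_pMat (hF : IsSmoothChart F) (hw : ∀ i, (w i).proj ∈ F.source) :
    ContinuousAt (pMat F) w := by
  refine continuousAt_pi.2 fun j => continuousAt_pi.2 fun i => ?_
  have h1 : ContinuousAt (fun w : Fin d → TTCot d M => chartVec F (w i)) w :=
    ContinuousAt.comp (f := fun w : Fin d → TTCot d M => w i) (continuousAt_chartVec hF (hw i))
      (continuous_apply i).continuousAt
  have h2 : Continuous fun y : Rn d × Rn d => y.2 j := by fun_prop
  exact h2.continuousAt.comp h1

lemma continuousAt_slope (hF : IsSmoothChart F) (hw : ∀ i, (w i).proj ∈ F.source)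
    (hP : (pMat F w).det ≠ 0) : ContinuousAt (fun w => qMat F w * (pMat F w)⁻¹) w := by
  have h1 := continuousAt_qMat hF hw
  have h2 := continuousAt_pMat hF hw
  have h3 : ContinuousAt (fun w => (pMat F w)⁻¹) w := by
    simp only [Matrix.inv_def, Ring.inverse_eq_inv']
    have h4 : ContinuousAt (fun w => (pMat F w).det) w :=
      (continuous_id.matrix_det).continuousAt.comp h2
    have h5 : ContinuousAt (fun w => (pMat F w).adjugate) w :=
      (continuous_id.matrix_adjugate).continuousAt.comp h2
    exact (h4.inv₀ hP).smul h5
  exact h1.mul h3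

/-- The tangent vector with given coordinates in the chart `F` at the point `x`, read in the
chart `F'`. -/
def transVec (F F' : OpenPartialHomeomorph (Cot d M) (Rn d × Rn d)) (x : Cot d M)
    (w : Rn d × Rn d) : Rn d × Rn d :=
  chartVec F' (tangentMap 𝓘(ℝ, Rn d × Rn d) (JCot d) F.symm ⟨F x, w⟩)

lemma tangentVector_ext {x y : Cot d M} (h : y = x) {u : TCot y} {v : TCot x}
    (huv : @Eq (Rn d × (Rn d →L[ℝ] ℝ)) u v) : (⟨y, u⟩ : TTCot d M) = ⟨x, v⟩ := by
  subst h
  exact congrArg (TotalSpace.mk y) huv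

lemma tangentMap_symm_apply (hF : IsSmoothChart F) {x : Cot d M} (hx : x ∈ F.source)
    (v : TCot x) :
    tangentMap 𝓘(ℝ, Rn d × Rn d) (JCot d) F.symm ⟨F x, dChart F x v⟩ = ⟨x, v⟩ :=
  tangentVector_ext (F.left_inv hx) (DFunLike.congr_fun (hF.mdifferentiable.symm_comp_deriv hx) v)

lemma transVec_apply (hF : IsSmoothChart F) {x : Cot d M} (hx : x ∈ F.source) (v : TCot x) :
    transVec F F' x (dChart F x v) = dChart F' x v := by
  rw [transVec, tangentMap_symm_apply hF hx]
  rfl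

lemma continuousAt_transVec (hF : IsSmoothChart F) (hF' : IsSmoothChart F') {x : Cot d M}
    (hx : x ∈ F.source) (hx' : x ∈ F'.source) (w : Rn d × Rn d) :
    ContinuousAt (fun y => transVec F F' y w) x := by
  have hu : UniqueMDiffOn 𝓘(ℝ, Rn d × Rn d) F.target := F.open_target.uniqueMDiffOn
  have h1 := hF.2.continuousOn_tangentMapWithin (by simp) hu
  have hFx : F x ∈ F.target := F.map_source hx
  have h2 : ContinuousAt
      (fun y => (⟨F y, w⟩ : TangentBundle 𝓘(ℝ, Rn d × Rn d) (Rn d × Rn d))) x := by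
    have h3 : Continuous fun z : Rn d × Rn d =>
        (⟨z, w⟩ : TangentBundle 𝓘(ℝ, Rn d × Rn d) (Rn d × Rn d)) := by
      have h4 : Continuous fun z : Rn d × Rn d =>
          ((z, w) : ModelProd (Rn d × Rn d) (Rn d × Rn d)) :=
        continuous_id.prodMk continuous_const
      exact (tangentBundleModelSpaceHomeomorph 𝓘(ℝ, Rn d × Rn d)).symm.continuous.comp h4
    exact h3.continuousAt.comp (F.continuousAt hx)
  have h5 : ContinuousAt (fun y => tangentMapWithin 𝓘(ℝ, Rn d × Rn d) (JCot d) F.symm F.target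
      ⟨F y, w⟩) x := by
    have hc : Continuous (TotalSpace.proj :
        TangentBundle 𝓘(ℝ, Rn d × Rn d) (Rn d × Rn d) → Rn d × Rn d) :=
      FiberBundle.continuous_proj _ _
    exact (h1.continuousAt ((F.open_target.preimage hc).mem_nhds hFx)).comp
      (f := fun y => (⟨F y, w⟩ : TangentBundle 𝓘(ℝ, Rn d × Rn d) (Rn d × Rn d))) h2
  have h6 : ContinuousAt (fun y => tangentMap 𝓘(ℝ, Rn d × Rn d) (JCot d) F.symm ⟨F y, w⟩) x := by
    refine h5.congr ?_
    filter_upwards [F.open_source.mem_nhds hx] with y hy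
    have hFy : F y ∈ F.target := F.map_source hy
    exact tangentMapWithin_eq_tangentMap (hu _ hFy) (hF.mdifferentiable.mdifferentiableAt_symm hFy)
  refine ContinuousAt.comp (f := fun y => tangentMap 𝓘(ℝ, Rn d × Rn d) (JCot d) F.symm ⟨F y, w⟩)
    (continuousAt_chartVec hF' ?_) h6
  change F.symm (F x) ∈ F'.source
  rwa [F.left_inv hx]

/-- The position coordinates in `F'` of the coordinate position vectors of `F`. -/
def transQ (F F' : OpenPartialHomeomorph (Cot d M) (Rn d × Rn d)) (x : Cot d M) :
    Matrix (Fin d) (Fin d) ℝ :=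
  Matrix.of fun j i => (transVec F F' x (EuclideanSpace.single i 1, 0)).1 j

/-- The momentum coordinates in `F'` of the coordinate position vectors of `F`. -/
def transP (F F' : OpenPartialHomeomorph (Cot d M) (Rn d × Rn d)) (x : Cot d M) :
    Matrix (Fin d) (Fin d) ℝ :=
  Matrix.of fun j i => (transVec F F' x (EuclideanSpace.single i 1, 0)).2 j

lemma continuousAt_transQ_mul_transP (hF : IsSmoothChart F) (hF' : IsSmoothChart F') {x : Cot d M}
    (hx : x ∈ F.source) (hx' : x ∈ F'.source) :
    ContinuousAt (fun y => (transQ F F' y)ᵀ * transP F F' y) x := by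
  have h1 : ContinuousAt (transQ F F') x := by
    refine continuousAt_pi.2 fun j => continuousAt_pi.2 fun i => ?_
    have h2 : Continuous fun y : Rn d × Rn d => y.1 j := by fun_prop
    exact h2.continuousAt.comp (continuousAt_transVec hF hF' hx hx' _)
  have h2 : ContinuousAt (transP F F') x := by
    refine continuousAt_pi.2 fun j => continuousAt_pi.2 fun i => ?_
    have h2 : Continuous fun y : Rn d × Rn d => y.2 j := by fun_prop
    exact h2.continuousAt.comp (continuousAt_transVec hF hF' hx hx' _)
  exact ((continuous_id.matrix_transpose).continuousAt.comp h1).mul h2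

lemma transVec_symm (hF : IsSmoothChart F) {x : Cot d M} (hx : x ∈ F.source)
    (a b : Rn d) :
    transVec F F' x (a, b) = dChart F' x ((coordEquiv hF hx).symm (a.ofLp, b.ofLp)) := by
  rw [← transVec_apply hF hx]
  congr 1
  exact Prod.ext (WithLp.ofLp_injective 2 (qC_symm hF hx (a.ofLp, b.ofLp)).symm)
    (WithLp.ofLp_injective 2 (pC_symm hF hx (a.ofLp, b.ofLp)).symm)

lemma transQ_mulVec (hF : IsSmoothChart F) {x : Cot d M} (hx : x ∈ F.source) (q : Fin d → ℝ) :
    transQ F F' x *ᵥ q = qC F' x ((coordEquiv hF hx).symm (q, 0)) := by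
  have : transQ F F' x = LinearMap.toMatrix' (qC F' x ∘ₗ (coordEquiv hF hx).symm.toLinearMap ∘ₗ
      LinearMap.inl ℝ (Fin d → ℝ) (Fin d → ℝ)) := by
    ext j i
    rw [LinearMap.toMatrix'_apply, transQ, Matrix.of_apply, transVec_symm hF hx]
    rfl
  rw [this, LinearMap.toMatrix'_mulVec]
  rfl

lemma transP_mulVec (hF : IsSmoothChart F) {x : Cot d M} (hx : x ∈ F.source) (q : Fin d → ℝ) :
    transP F F' x *ᵥ q = pC F' x ((coordEquiv hF hx).symm (q, 0)) := by
  have : transP F F' x = LinearMap.toMatrix' (pC F' x ∘ₗ (coordEquiv hF hx).symm.toLinearMap ∘ₗ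
      LinearMap.inl ℝ (Fin d → ℝ) (Fin d → ℝ)) := by
    ext j i
    rw [LinearMap.toMatrix'_apply, transP, Matrix.of_apply, transVec_symm hF hx]
    rfl
  rw [this, LinearMap.toMatrix'_mulVec]
  rfl

/-- The change of charts is block triangular, because both charts respect the vertical, and it is
symplectic, which gives the relations between its blocks. -/
lemma exists_trans_block (hF : IsVerticallyFoliated F) (hF' : IsVerticallyFoliated F')
    {x : Cot d M} (hx : x ∈ F.source) (hx' : x ∈ F'.source) :
    ∃ B : Matrix (Fin d) (Fin d) ℝ, (transQ F F' x)ᵀ * B = 1 ∧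
      ((transQ F F' x)ᵀ * transP F F' x).IsSymm ∧
      (∀ z : TCot x, qC F' x z = transQ F F' x *ᵥ qC F x z) ∧
      ∀ z : TCot x, pC F' x z = transP F F' x *ᵥ qC F x z + B *ᵥ pC F x z := by
  set e := coordEquiv hF.1 hx with he
  let B := LinearMap.toMatrix' (pC F' x ∘ₗ e.symm.toLinearMap ∘ₗ
    LinearMap.inr ℝ (Fin d → ℝ) (Fin d → ℝ))
  have hB : ∀ p, B *ᵥ p = pC F' x (e.symm (0, p)) := by
    intro p
    rw [LinearMap.toMatrix'_mulVec]
    rfl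
  have hv : ∀ p, qC F' x (e.symm (0, p)) = 0 := by
    intro p
    rw [← mem_vert_iff hF' hx', mem_vert_iff hF hx, qC_symm]
  have hz : ∀ z : TCot x, z = e.symm (qC F x z, 0) + e.symm (0, pC F x z) := by
    intro z
    rw [← map_add, Prod.mk_add_mk, add_zero, zero_add, he, ← coordEquiv_apply hF.1 hx,
      LinearEquiv.symm_apply_apply]
  have hom : ∀ u v : TCot x, qC F x u ⬝ᵥ pC F x v - pC F x u ⬝ᵥ qC F x v =
      qC F' x u ⬝ᵥ pC F' x v - pC F' x u ⬝ᵥ qC F' x v := fun u v =>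
    (omega_eq hF hx u v).symm.trans (omega_eq hF' hx' u v)
  refine ⟨B, ?_, ?_, fun z => ?_, fun z => ?_⟩
  · refine Matrix.ext_of_mulVec_single fun i => dotProduct_eq _ _ fun q => ?_
    have := hom (e.symm (q, 0)) (e.symm (0, Pi.single i 1))
    rw [qC_symm, pC_symm, pC_symm, hv, ← hB, ← transQ_mulVec hF.1 hx] at this
    simp only [zero_dotProduct, dotProduct_zero, sub_zero] at this
    rw [Matrix.one_mulVec, dotProduct_comm _ q, dotProduct_comm _ q, this, ← Matrix.mulVec_mulVec,
      Matrix.dotProduct_mulVec, Matrix.vecMul_transpose]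
  · refine isSymm_of_dotProduct_mulVec fun u v => ?_
    have := hom (e.symm (u, 0)) (e.symm (v, 0))
    rw [qC_symm, pC_symm, pC_symm, qC_symm, ← transQ_mulVec hF.1 hx, ← transP_mulVec hF.1 hx,
      ← transQ_mulVec hF.1 hx, ← transP_mulVec hF.1 hx] at this
    simp only [zero_dotProduct, dotProduct_zero, sub_zero] at this
    rw [← Matrix.mulVec_mulVec, ← Matrix.mulVec_mulVec, Matrix.dotProduct_mulVec u,
      Matrix.vecMul_transpose, dotProduct_comm, Matrix.dotProduct_mulVec, Matrix.vecMul_transpose,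
      dotProduct_comm]
    linarith
  · conv_lhs => rw [hz z]
    rw [map_add, hv, add_zero, transQ_mulVec hF.1 hx]
  · conv_lhs => rw [hz z]
    rw [map_add, hB, transP_mulVec hF.1 hx]

/-- The comparison matrix of two charts is symmetric and nondegenerate, also where `L` is singular;
out of the singular cycle its index compares the indices of the two slopes. -/
lemma IsSlope.comparison (hF : IsVerticallyFoliated F) (hF' : IsVerticallyFoliated F')
    (hL : L.IsLagrangian) (h : IsSlope F L S) (h' : IsSlope F' L S') :
    let N := comparisonMatrix S ((transQ F F' L.pt)ᵀ * transP F F' L.pt)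
    N.IsSymm ∧ N.det ≠ 0 ∧ (S.det ≠ 0 → posIndex S + negIndex S' = negIndex N) := by
  obtain ⟨B, hB, hg, hq, hp⟩ := exists_trans_block hF hF' h.1 h'.1
  have hS : S.IsSymm := h.isSymm hF hL.isotropic
  have hT : ∀ p, pC F' L.pt ((coordEquiv hF.1 h.1).symm (S *ᵥ p, p)) =
      (transP F F' L.pt * S + B) *ᵥ p := by
    intro p
    rw [hp, qC_symm, pC_symm, Matrix.add_mulVec, Matrix.mulVec_mulVec]
  have hTd : (transP F F' L.pt * S + B).det ≠ 0 := by
    intro h0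
    obtain ⟨p, hp0, hpz⟩ := Matrix.exists_mulVec_eq_zero_iff.2 h0
    rw [← hT] at hpz
    have h1 := (h'.2 _).1 (h.mem hF.1 p)
    rw [hpz, Matrix.mulVec_zero] at h1
    have h2 := eq_of_coords hF'.1 h'.1 (h1.trans (map_zero _).symm) (hpz.trans (map_zero _).symm)
    have h3 := pC_symm hF.1 h.1 (S *ᵥ p, p)
    rw [h2, map_zero] at h3
    exact hp0 h3.symm
  refine ⟨comparisonMatrix_isSymm hS hg, comparisonMatrix_det_ne_zero hB hTd, fun hSd => ?_⟩
  refine posIndex_add_negIndex_eq hS hB hg hTd hSd ?_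
  refine Matrix.ext_of_mulVec_single fun i => ?_
  have h1 := (h'.2 _).1 (h.mem hF.1 (Pi.single i 1))
  rw [hT, hq, qC_symm] at h1
  rw [← Matrix.mulVec_mulVec, ← Matrix.mulVec_mulVec, h1]

/-- The indices of the slopes of a Lagrangian subspace in two charts differ by an index that is
locally constant, also at singular subspaces. -/
lemma exists_posIndex_eq_add (hF : IsVerticallyFoliated F) (hF' : IsVerticallyFoliated F')
    {S₀ S₀' : Matrix (Fin d) (Fin d) ℝ} (hL : L.IsLagrangian) (h : IsSlope F L S₀)
    (h' : IsSlope F' L S₀') :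
    ∃ c : ℤ, ∀ w₀, IsFrameOf w₀ L → ∀ᶠ w in 𝓝 w₀, ∀ (L' : SubspaceAt d M) S S', IsFrameOf w L' →
      L'.IsLagrangian → ¬ L'.Singular → IsSlope F L' S → IsSlope F' L' S' →
        (posIndex S : ℤ) = posIndex S' + c := by
  -- In dimension `0` a frame does not determine its base point.
  rcases Nat.eq_zero_or_pos d with hd | hd
  · have : IsEmpty (Fin d) := by
      subst hd
      infer_instance
    refine ⟨0, fun w₀ _ => Eventually.of_forall fun w L' S S' _ _ _ _ _ => ?_⟩
    rw [Subsingleton.elim S S', add_zero]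
  set g : Cot d M → Matrix (Fin d) (Fin d) ℝ := fun x => (transQ F F' x)ᵀ * transP F F' x with hg
  obtain ⟨h1, h2, -⟩ := h.comparison hF hF' hL h'
  refine ⟨(negIndex (comparisonMatrix S₀ (g L.pt)) : ℤ) - d, fun w₀ hw₀ => ?_⟩
  have hpt : ∀ i, (w₀ i).proj = L.pt := by
    obtain ⟨v, hv, -⟩ := hw₀
    intro i
    rw [hv i]
  let i₀ : Fin d := ⟨0, hd⟩
  let N : (Fin d → TTCot d M) → Matrix (Fin d ⊕ Fin d) (Fin d ⊕ Fin d) ℝ := fun w =>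
    comparisonMatrix (qMat F w * (pMat F w)⁻¹) (g (w i₀).proj)
  have hN₀ : N w₀ = comparisonMatrix S₀ (g L.pt) := by
    simp only [N]
    rw [← h.eq_qMat_mul hF.1 hw₀, hpt]
  have hc : ContinuousAt N w₀ := by
    have hc1 := continuousAt_slope (w := w₀) hF.1 (fun i => by rw [hpt i]; exact h.1)
      (h.det_pMat_ne_zero hF.1 hw₀)
    have hc2 : ContinuousAt (fun w : Fin d → TTCot d M => g (w i₀).proj) w₀ := by
      have hcp : Continuous fun w : Fin d → TTCot d M => (w i₀).proj :=
        (FiberBundle.continuous_proj _ _).comp (continuous_apply i₀)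
      refine ContinuousAt.comp (g := g) ?_ hcp.continuousAt
      rw [hpt]
      exact continuousAt_transQ_mul_transP hF.1 hF'.1 h.1 h'.1
    have hc3 : Continuous fun z : Matrix (Fin d) (Fin d) ℝ × Matrix (Fin d) (Fin d) ℝ =>
        comparisonMatrix z.1 z.2 :=
      Continuous.matrix_fromBlocks continuous_fst.neg continuous_const continuous_const
        continuous_snd
    exact hc3.continuousAt.comp (hc1.prodMk hc2)
  have hev := hc.eventually (eventually_posIndex_eq (H₀ := N w₀) (by rwa [hN₀]) (by rwa [hN₀]))
  filter_upwards [hev] with w hw L' S S' hfr hL' hns hS hS'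
  obtain ⟨h3, -, h5⟩ := hS.comparison hF hF' hL' hS'
  have hNw : N w = comparisonMatrix S (g L'.pt) := by
    obtain ⟨v, hv, -⟩ := id hfr
    simp only [N]
    rw [← hS.eq_qMat_mul hF.1 hfr, hv i₀]
  rw [hNw, hN₀] at hw
  have h6 := (hw h3).2
  have hSd : S.det ≠ 0 := fun h0 => hns ((hS.singular_iff hF).2 h0)
  have hSd' : S'.det ≠ 0 := fun h0 => hns ((hS'.singular_iff hF').2 h0)
  have h7 := h5 hSd
  have h8 := posIndex_add_negIndex_of_det_ne_zero (hS'.isSymm hF' hL'.isotropic) hSd'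
  rw [Fintype.card_fin] at h8
  have h9 : negIndex (comparisonMatrix S ((transQ F F' L'.pt)ᵀ * transP F F' L'.pt)) =
      negIndex (comparisonMatrix S₀ (g L.pt)) := h6
  omega

end Frames

/-! ### Counting crossings through the indices of slopes -/

section Crossings

variable {d : ℕ} {M : Type*} [TopologicalSpace M] [ChartedSpace (Rn d) M]
  [IsManifold 𝓘(ℝ, Rn d) ∞ M]

/-- `Γ` is a continuous path of Lagrangian subspaces over `s`, with continuous frame `e`. -/
structure IsContFrame (s : Set ℝ) (e : ℝ → Fin d → TTCot d M) (Γ : ℝ → SubspaceAt d M) :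
    Prop where
  lagrangian : ∀ t ∈ s, (Γ t).IsLagrangian
  continuousOn_pt : ContinuousOn (fun t => (Γ t).pt) s
  continuousOn : ContinuousOn e s
  frame : ∀ t ∈ s, IsFrameOf (e t) (Γ t)

variable {s : Set ℝ} {e : ℝ → Fin d → TTCot d M} {Γ : ℝ → SubspaceAt d M} {t₀ : ℝ}
  {F F' : OpenPartialHomeomorph (Cot d M) (Rn d × Rn d)} {S₀ S₀' : Matrix (Fin d) (Fin d) ℝ}

lemma IsFrameOf.proj_eq {w : Fin d → TTCot d M} {L : SubspaceAt d M} (h : IsFrameOf w L)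
    (i : Fin d) : (w i).proj = L.pt := by
  obtain ⟨v, hv, -⟩ := h
  rw [hv i]

lemma IsContFrame.comp_neg (h : IsContFrame s e Γ) :
    IsContFrame (Neg.neg ⁻¹' s) (fun t => e (-t)) (fun t => Γ (-t)) where
  lagrangian _ ht := h.lagrangian _ ht
  continuousOn_pt := h.continuousOn_pt.comp continuous_neg.continuousOn (mapsTo_preimage _ _)
  continuousOn := h.continuousOn.comp continuous_neg.continuousOn (mapsTo_preimage _ _)
  frame _ ht := h.frame _ ht

/-- The slope in a fixed chart extends continuously along a path. -/
lemma IsContFrame.exists_slope_near (h : IsContFrame s e Γ) (ht₀ : t₀ ∈ s)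
    (hF : IsVerticallyFoliated F) (hS : IsSlope F (Γ t₀) S₀) :
    ∃ S : ℝ → Matrix (Fin d) (Fin d) ℝ, S t₀ = S₀ ∧ ContinuousWithinAt S s t₀ ∧
      ∀ᶠ t in 𝓝[s] t₀, IsSlope F (Γ t) (S t) := by
  have hd := hS.det_pMat_ne_zero hF.1 (h.frame t₀ ht₀)
  have hsrc : ∀ i, (e t₀ i).proj ∈ F.source := fun i => by
    rw [(h.frame t₀ ht₀).proj_eq]
    exact hS.1
  have hc : ContinuousWithinAt e s t₀ := h.continuousOn t₀ ht₀
  refine ⟨fun t => qMat F (e t) * (pMat F (e t))⁻¹, (hS.eq_qMat_mul hF.1 (h.frame t₀ ht₀)).symm,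
    (continuousAt_slope hF.1 hsrc hd).comp_continuousWithinAt hc, ?_⟩
  have h1 : ∀ᶠ t in 𝓝[s] t₀, (pMat F (e t)).det ≠ 0 := by
    have h2 : ContinuousAt (fun w => (pMat F w).det) (e t₀) :=
      (continuous_id.matrix_det).continuousAt.comp (continuousAt_pMat hF.1 hsrc)
    exact (h2.comp_continuousWithinAt hc).eventually_ne hd
  have h3 : ∀ᶠ t in 𝓝[s] t₀, (Γ t).pt ∈ F.source :=
    (h.continuousOn_pt t₀ ht₀).eventually (F.open_source.mem_nhds hS.1)
  filter_upwards [h1, h3, self_mem_nhdsWithin] with t h4 h5 h6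
  exact (h.frame t h6).isSlope hF.1 h5 h4

lemma IsContFrame.exists_posIndex_eq_add (h : IsContFrame s e Γ) (ht₀ : t₀ ∈ s)
    (hF : IsVerticallyFoliated F) (hF' : IsVerticallyFoliated F') (hS : IsSlope F (Γ t₀) S₀)
    (hS' : IsSlope F' (Γ t₀) S₀') :
    ∃ c : ℤ, ∀ᶠ t in 𝓝[s] t₀, ∀ S S', ¬ (Γ t).Singular → IsSlope F (Γ t) S →
      IsSlope F' (Γ t) S' → (posIndex S : ℤ) = posIndex S' + c := by
  obtain ⟨c, hc⟩ := CotangentMaslov.exists_posIndex_eq_add hF hF' (h.lagrangian t₀ ht₀) hS hS'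
  refine ⟨c, ?_⟩
  filter_upwards [(h.continuousOn t₀ ht₀).eventually (hc _ (h.frame t₀ ht₀)),
    self_mem_nhdsWithin] with t ht hts S S' h1 h2 h3
  exact ht (Γ t) S S' (h.frame t hts) (h.lagrangian t hts) h1 h2 h3

lemma IsContFrame.eventually_of_not_singular (h : IsContFrame s e Γ) (ht₀ : t₀ ∈ s)
    (hF : IsVerticallyFoliated F) (hS : IsSlope F (Γ t₀) S₀) (hns : ¬ (Γ t₀).Singular) :
    ∀ᶠ t in 𝓝[s] t₀, ¬ (Γ t).Singular ∧ ∀ S, IsSlope F (Γ t) S → posIndex S = posIndex S₀ := by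
  obtain ⟨S, hS0, hSc, hSs⟩ := h.exists_slope_near ht₀ hF hS
  have hd : S₀.det ≠ 0 := fun h0 => hns ((hS.singular_iff hF).2 h0)
  have hsym := hS.isSymm hF (h.lagrangian t₀ ht₀).isotropic
  have h1 := hSc.eventually (by rw [hS0]; exact eventually_posIndex_eq hsym hd)
  have h2 : ∀ᶠ t in 𝓝[s] t₀, (S t).det ≠ 0 :=
    ((continuous_id.matrix_det).continuousAt.comp_continuousWithinAt hSc).eventually_ne
      (by simpa [hS0] using hd)
  filter_upwards [h1, h2, hSs, self_mem_nhdsWithin] with t h3 h4 h5 h6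
  refine ⟨fun h7 => h4 ((h5.singular_iff hF).1 h7), fun T hT => ?_⟩
  rw [hT.unique hF.1 h5]
  exact (h3 (h5.isSymm hF (h.lagrangian t h6).isotropic)).1

/-- At a positive crossing the positive index of the slope in any chart decreases by one. -/
lemma IsContFrame.of_isPositiveCrossing (h : IsContFrame s e Γ) (hs : s ∈ 𝓝 t₀)
    (hF : IsVerticallyFoliated F) (hS : IsSlope F (Γ t₀) S₀) (hc : IsPositiveCrossing Γ t₀) :
    (∀ᶠ t in 𝓝[<] t₀, ∀ S, IsSlope F (Γ t) S → posIndex S = posIndex S₀ + 1) ∧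
      (∀ᶠ t in 𝓝[>] t₀, ∀ S, IsSlope F (Γ t) S → posIndex S = posIndex S₀) ∧
      ∀ᶠ t in 𝓝[≠] t₀, ¬ (Γ t).Singular := by
  have ht₀ : t₀ ∈ s := mem_of_mem_nhds hs
  obtain ⟨hreg, F', hF', n, hn, ε, hε, hbef, haft⟩ := hc
  obtain ⟨S₀', hS'⟩ := hn.exists_isSlope hF'.1
  obtain ⟨c, hch⟩ := h.exists_posIndex_eq_add ht₀ hF hF' hS hS'
  obtain ⟨S, hS0, hSc, hSs⟩ := h.exists_slope_near ht₀ hF hS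
  rw [nhdsWithin_eq_nhds.2 hs] at hch hSs
  have hSc' : ContinuousAt S t₀ := hSc.continuousAt hs
  have hlow := hSc'.eventually (by rw [hS0]; exact eventually_posIndex_ge S₀)
  have hlow' := hSc'.eventually (by rw [hS0]; exact eventually_negIndex_ge S₀)
  have hI1 : ∀ᶠ t in 𝓝[<] t₀, t ∈ Ioo (t₀ - ε) t₀ := Ioo_mem_nhdsLT (by linarith)
  have hI2 : ∀ᶠ t in 𝓝[>] t₀, t ∈ Ioo t₀ (t₀ + ε) := Ioo_mem_nhdsGT (by linarith)
  have b1 : ∀ᶠ t in 𝓝[<] t₀, ∀ T, IsSlope F (Γ t) T → (posIndex T : ℤ) = n + 1 + c := by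
    filter_upwards [nhdsWithin_le_nhds hch, hI1] with t h1 h2 T hT
    obtain ⟨h3, h4⟩ := hbef t h2
    obtain ⟨T', hT'⟩ := h4.exists_isSlope hF'.1
    rw [h1 T T' h3 hT hT', (hT'.hasHeightIndex_iff hF' _).1 h4]
    push_cast
    ring
  have b2 : ∀ᶠ t in 𝓝[>] t₀, ∀ T, IsSlope F (Γ t) T → (posIndex T : ℤ) = n + c := by
    filter_upwards [nhdsWithin_le_nhds hch, hI2] with t h1 h2 T hT
    obtain ⟨h3, h4⟩ := haft t h2
    obtain ⟨T', hT'⟩ := h4.exists_isSlope hF'.1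
    rw [h1 T T' h3 hT hT', (hT'.hasHeightIndex_iff hF' _).1 h4]
  have hsym := hS.isSymm hF (h.lagrangian t₀ ht₀).isotropic
  have hrank := posIndex_add_negIndex hsym
  rw [(hS.regularSingular_iff hF).1 hreg, Fintype.card_fin] at hrank
  -- Semicontinuity of both indices at `t₀` forces the index of `S₀` to be `n + c`.
  have hle1 : (posIndex S₀ : ℤ) ≤ n + c := by
    obtain ⟨t, h1, h2, h3⟩ := (b2.and ((hlow.filter_mono nhdsWithin_le_nhds).and
      (hSs.filter_mono nhdsWithin_le_nhds))).exists
    have := h1 _ h3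
    have h2' : posIndex S₀ ≤ posIndex (S t) := h2
    omega
  have hle2 : (n : ℤ) + c ≤ posIndex S₀ := by
    obtain ⟨t, h1, h2, h3, h4, h5⟩ := (b1.and ((hlow'.filter_mono nhdsWithin_le_nhds).and
      ((hSs.filter_mono nhdsWithin_le_nhds).and (hI1.and (nhdsWithin_le_nhds hs))))).exists
    have h6 := h1 _ h3
    have h2' : negIndex S₀ ≤ negIndex (S t) := h2
    have h7 := posIndex_add_negIndex_of_det_ne_zero
      (h3.isSymm hF (h.lagrangian t h5).isotropic)
      (fun h0 => (hbef t h4).1 ((h3.singular_iff hF).2 h0))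
    rw [Fintype.card_fin] at h7
    omega
  refine ⟨b1.mono fun t ht T hT => ?_, b2.mono fun t ht T hT => ?_, ?_⟩
  · have := ht T hT
    omega
  · have := ht T hT
    omega
  · rw [← nhdsLT_sup_nhdsGT, eventually_sup]
    exact ⟨hI1.mono fun t ht => (hbef t ht).1, hI2.mono fun t ht => (haft t ht).1⟩

/-- At a negative crossing the positive index of the slope in any chart increases by one. -/
lemma IsContFrame.of_isNegativeCrossing (h : IsContFrame s e Γ) (hs : s ∈ 𝓝 t₀)
    (hF : IsVerticallyFoliated F) (hS : IsSlope F (Γ t₀) S₀) (hc : IsNegativeCrossing Γ t₀) :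
    (∀ᶠ t in 𝓝[<] t₀, ∀ S, IsSlope F (Γ t) S → posIndex S = posIndex S₀) ∧
      (∀ᶠ t in 𝓝[>] t₀, ∀ S, IsSlope F (Γ t) S → posIndex S = posIndex S₀ + 1) ∧
      ∀ᶠ t in 𝓝[≠] t₀, ¬ (Γ t).Singular := by
  have hs' : Neg.neg ⁻¹' s ∈ 𝓝 (-t₀) := by
    refine continuous_neg.continuousAt.preimage_mem_nhds ?_
    rwa [neg_neg]
  obtain ⟨h1, h2, h3⟩ := h.comp_neg.of_isPositiveCrossing (S₀ := S₀) hs' hF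
    (by simpa only [neg_neg] using hS) hc
  have e1 : Tendsto Neg.neg (𝓝[<] t₀) (𝓝[>] (-t₀)) := tendsto_neg_nhdsLT
  have e2 : Tendsto Neg.neg (𝓝[>] t₀) (𝓝[<] (-t₀)) := tendsto_neg_nhdsGT
  refine ⟨?_, ?_, ?_⟩
  · simpa only [neg_neg] using e1.eventually h2
  · simpa only [neg_neg] using e2.eventually h1
  · rw [← nhdsLT_sup_nhdsGT, eventually_sup] at h3 ⊢
    exact ⟨by simpa only [neg_neg] using e1.eventually h3.2,
      by simpa only [neg_neg] using e2.eventually h3.1⟩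

end Crossings

/-! ### The signed number of crossings of a path in general position -/

section Counting

/-- The number of points of `P` up to `t`, minus the number of points of `N` before `t`. The value
at a point of `P` or `N` is chosen to fit the index of the slope, which takes at a crossing the
smaller one of its values on both sides. -/
def countUpTo (P N : Set ℝ) (t : ℝ) : ℤ := ((P ∩ Iic t).ncard : ℤ) - ((N ∩ Iio t).ncard : ℤ)

lemma eventually_lt_of_lt {Z : Set ℝ} (hZ : Z.Finite) (t₀ : ℝ) :
    ∀ᶠ t in 𝓝[<] t₀, ∀ z ∈ Z, z < t₀ → z < t := by
  rw [eventually_all_finite hZ]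
  intro z _
  rcases lt_or_ge z t₀ with h | h
  · filter_upwards [Ioo_mem_nhdsLT h] with t ht _
    exact ht.1
  · exact Eventually.of_forall fun t h' => absurd h' h.not_gt

lemma eventually_gt_of_gt {Z : Set ℝ} (hZ : Z.Finite) (t₀ : ℝ) :
    ∀ᶠ t in 𝓝[>] t₀, ∀ z ∈ Z, t₀ < z → t < z := by
  rw [eventually_all_finite hZ]
  intro z _
  rcases lt_or_ge t₀ z with h | h
  · filter_upwards [Ioo_mem_nhdsGT h] with t ht _
    exact ht.2
  · exact Eventually.of_forall fun t h' => absurd h' h.not_gt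

lemma countUpTo_left {P N : Set ℝ} (hP : P.Finite) (hN : N.Finite) (t₀ : ℝ) :
    ∀ᶠ t in 𝓝[<] t₀, (t₀ ∈ P → countUpTo P N t = countUpTo P N t₀ - 1) ∧
      (t₀ ∉ P → countUpTo P N t = countUpTo P N t₀) := by
  filter_upwards [eventually_lt_of_lt hP t₀, eventually_lt_of_lt hN t₀, self_mem_nhdsWithin]
    with t h1 h2 h3
  have h3' : t < t₀ := h3
  have hN' : N ∩ Iio t = N ∩ Iio t₀ := by
    ext z
    exact ⟨fun h => ⟨h.1, lt_trans h.2 h3'⟩, fun h => ⟨h.1, h2 z h.1 h.2⟩⟩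
  have hP' : P ∩ Iic t = (P ∩ Iic t₀) \ {t₀} := by
    ext z
    refine ⟨fun h => ⟨⟨h.1, h.2.trans h3'.le⟩, fun h' => ?_⟩, fun h => ⟨h.1.1, ?_⟩⟩
    · have h4 : z = t₀ := h'
      exact absurd (h4 ▸ h.2 : t₀ ≤ t) h3'.not_ge
    · exact (h1 z h.1.1 (lt_of_le_of_ne h.1.2 h.2)).le
  unfold countUpTo
  rw [hN', hP']
  refine ⟨fun h => ?_, fun h => ?_⟩
  · have h4 := Set.ncard_sdiff_singleton_add_one (s := P ∩ Iic t₀) ⟨h, le_refl t₀⟩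
      (hP.subset inter_subset_left)
    omega
  · rw [Set.sdiff_singleton_eq_self fun h' => h h'.1]

lemma countUpTo_right {P N : Set ℝ} (hP : P.Finite) (hN : N.Finite) (t₀ : ℝ) :
    ∀ᶠ t in 𝓝[>] t₀, (t₀ ∈ N → countUpTo P N t = countUpTo P N t₀ - 1) ∧
      (t₀ ∉ N → countUpTo P N t = countUpTo P N t₀) := by
  filter_upwards [eventually_gt_of_gt hP t₀, eventually_gt_of_gt hN t₀, self_mem_nhdsWithin]
    with t h1 h2 h3
  have h3' : t₀ < t := h3
  have hP' : P ∩ Iic t = P ∩ Iic t₀ := by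
    ext z
    exact ⟨fun h => ⟨h.1, not_lt.1 fun h' => (h1 z h.1 h').not_ge h.2⟩,
      fun h => ⟨h.1, h.2.trans h3'.le⟩⟩
  have hN' : N ∩ Iio t₀ = (N ∩ Iio t) \ {t₀} := by
    ext z
    refine ⟨fun h => ⟨⟨h.1, lt_trans h.2 h3'⟩, ?_⟩, fun h => ⟨h.1.1, ?_⟩⟩
    · exact (show z < t₀ from h.2).ne
    · exact lt_of_le_of_ne (not_lt.1 fun h' => (h2 z h.1.1 h').not_gt h.1.2) h.2
  unfold countUpTo
  rw [hN', hP']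
  refine ⟨fun h => ?_, fun h => ?_⟩
  · have h4 := Set.ncard_sdiff_singleton_add_one (s := N ∩ Iio t) ⟨h, h3'⟩
      (hN.subset inter_subset_left)
    omega
  · rw [Set.sdiff_singleton_eq_self fun h' => h h'.1]

variable {d : ℕ} {M : Type*} [TopologicalSpace M] [ChartedSpace (Rn d) M]
  [IsManifold 𝓘(ℝ, Rn d) ∞ M]

/-- The set of positive crossings of a path over `[α, β]`. -/
def posSet (α β : ℝ) (Γ : ℝ → SubspaceAt d M) : Set ℝ := {t ∈ Icc α β | IsPositiveCrossing Γ t}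

/-- The set of negative crossings of a path over `[α, β]`. -/
def negSet (α β : ℝ) (Γ : ℝ → SubspaceAt d M) : Set ℝ := {t ∈ Icc α β | IsNegativeCrossing Γ t}

lemma SubspaceAt.RegularSingular.singular {L : SubspaceAt d M} (h : L.RegularSingular) :
    L.Singular := by
  intro h0
  rw [SubspaceAt.RegularSingular, h0, finrank_bot] at h
  exact zero_ne_one h

lemma IsPositiveCrossing.singular {Γ : ℝ → SubspaceAt d M} {t : ℝ} (h : IsPositiveCrossing Γ t) :
    (Γ t).Singular := h.1.singular

lemma IsNegativeCrossing.singular {Γ : ℝ → SubspaceAt d M} {t : ℝ} (h : IsNegativeCrossing Γ t) :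
    (Γ t).Singular := by
  have h1 : (Γ (- -t)).Singular :=
    IsPositiveCrossing.singular (Γ := fun s => Γ (-s)) (t := -t) h
  rwa [neg_neg] at h1

/-- A path over `[α, β]` with a continuous frame, whose ends are not in the singular cycle and whose
crossings are positive or negative. -/
structure HasGoodCrossings (α β : ℝ) (e : ℝ → Fin d → TTCot d M) (Γ : ℝ → SubspaceAt d M) :
    Prop where
  frame : IsContFrame (Icc α β) e Γ
  left : ¬ (Γ α).Singular
  right : ¬ (Γ β).Singular
  crossing : ∀ t ∈ Icc α β, (Γ t).Singular → IsPositiveCrossing Γ t ∨ IsNegativeCrossing Γ t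

variable {α β : ℝ} {e : ℝ → Fin d → TTCot d M} {Γ : ℝ → SubspaceAt d M}
  {F F' : OpenPartialHomeomorph (Cot d M) (Rn d × Rn d)} {t₀ : ℝ}
  {S₀ S₀' : Matrix (Fin d) (Fin d) ℝ}

lemma HasGoodCrossings.mem_nhds_of_singular (h : HasGoodCrossings α β e Γ) (ht₀ : t₀ ∈ Icc α β)
    (hs : (Γ t₀).Singular) : Icc α β ∈ 𝓝 t₀ := by
  refine Icc_mem_nhds (lt_of_le_of_ne ht₀.1 ?_) (lt_of_le_of_ne ht₀.2 ?_)
  · rintro rfl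
    exact h.left hs
  · rintro rfl
    exact h.right hs

lemma HasGoodCrossings.eventually_not_singular (h : HasGoodCrossings α β e Γ)
    (ht₀ : t₀ ∈ Icc α β) (hF : IsVerticallyFoliated F) (hS : IsSlope F (Γ t₀) S₀) :
    ∀ᶠ t in 𝓝[Icc α β] t₀, t ≠ t₀ → ¬ (Γ t).Singular := by
  by_cases hs : (Γ t₀).Singular
  · have hn := h.mem_nhds_of_singular ht₀ hs
    have h1 : ∀ᶠ t in 𝓝[≠] t₀, ¬ (Γ t).Singular := by
      rcases h.crossing t₀ ht₀ hs with hc | hc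
      · exact (h.frame.of_isPositiveCrossing hn hF hS hc).2.2
      · exact (h.frame.of_isNegativeCrossing hn hF hS hc).2.2
    exact (eventually_nhdsWithin_iff.1 h1).filter_mono nhdsWithin_le_nhds
  · exact (h.frame.eventually_of_not_singular ht₀ hF hS hs).mono fun t ht _ => ht.1

lemma HasGoodCrossings.frequently_not_singular (h : HasGoodCrossings α β e Γ)
    (ht₀ : t₀ ∈ Icc α β) (hF : IsVerticallyFoliated F) (hS : IsSlope F (Γ t₀) S₀) :
    ∃ᶠ t in 𝓝[Icc α β] t₀, ¬ (Γ t).Singular := by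
  by_cases hs : (Γ t₀).Singular
  · have hn := h.mem_nhds_of_singular ht₀ hs
    rw [nhdsWithin_eq_nhds.2 hn]
    have h1 := h.eventually_not_singular ht₀ hF hS
    rw [nhdsWithin_eq_nhds.2 hn] at h1
    exact ((eventually_nhdsWithin_iff (s := {t₀}ᶜ)).2 h1).frequently.filter_mono
      nhdsWithin_le_nhds
  · exact frequently_iff.2 fun hU => ⟨t₀, mem_of_mem_nhdsWithin ht₀ hU, hs⟩

variable (hslope : ∀ t ∈ Icc α β, ∃ F S, IsVerticallyFoliated F ∧ IsSlope F (Γ t) S)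

include hslope in
lemma HasGoodCrossings.finite_singular (h : HasGoodCrossings α β e Γ) :
    {t ∈ Icc α β | (Γ t).Singular}.Finite := by
  have key : (Icc α β ∩ {t | (Γ t).Singular}).Finite := by
    refine isCompact_Icc.induction_on (p := fun s => (s ∩ {t | (Γ t).Singular}).Finite) ?_ ?_ ?_ ?_
    · simp
    · exact fun s t hst ht => ht.subset (inter_subset_inter_left _ hst)
    · intro s t hs ht
      rw [union_inter_distrib_right]
      exact hs.union ht
    · intro t ht
      obtain ⟨F, S, hF, hS⟩ := hslope t ht
      refine ⟨_, h.eventually_not_singular ht hF hS, (finite_singleton t).subset ?_⟩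
      rintro z ⟨hz1, hz2⟩
      by_contra hne
      exact hz1 hne hz2
  exact key

include hslope in
lemma HasGoodCrossings.finite_posSet (h : HasGoodCrossings α β e Γ) : (posSet α β Γ).Finite :=
  (h.finite_singular hslope).subset fun _ ht => ⟨ht.1, ht.2.singular⟩

include hslope in
lemma HasGoodCrossings.finite_negSet (h : HasGoodCrossings α β e Γ) : (negSet α β Γ).Finite :=
  (h.finite_singular hslope).subset fun _ ht => ⟨ht.1, ht.2.singular⟩

include hslope in
/-- The positive index of the slope in a chart, corrected by the number of the crossings so far, is
locally constant. -/
lemma HasGoodCrossings.eventually_posIndex_add (h : HasGoodCrossings α β e Γ)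
    (ht₀ : t₀ ∈ Icc α β) (hF : IsVerticallyFoliated F) (hS : IsSlope F (Γ t₀) S₀) :
    ∀ᶠ t in 𝓝[Icc α β] t₀, ∀ S, IsSlope F (Γ t) S →
      (posIndex S : ℤ) + countUpTo (posSet α β Γ) (negSet α β Γ) t =
        posIndex S₀ + countUpTo (posSet α β Γ) (negSet α β Γ) t₀ := by
  have hPf := h.finite_posSet hslope
  have hNf := h.finite_negSet hslope
  set c := countUpTo (posSet α β Γ) (negSet α β Γ) with hc
  have hl := countUpTo_left hPf hNf t₀
  have hr := countUpTo_right hPf hNf t₀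
  rw [← hc] at hl hr
  have hsplit : ∀ p : ℝ → Prop, p t₀ → (∀ᶠ t in 𝓝[<] t₀, t ∈ Icc α β → p t) →
      (∀ᶠ t in 𝓝[>] t₀, t ∈ Icc α β → p t) → ∀ᶠ t in 𝓝[Icc α β] t₀, p t := by
    intro p h0 h1 h2
    rw [eventually_nhdsWithin_iff, ← nhdsNE_sup_pure, ← nhdsLT_sup_nhdsGT, eventually_sup,
      eventually_sup, eventually_pure]
    exact ⟨⟨h1, h2⟩, fun _ => h0⟩
  have h0 : ∀ S, IsSlope F (Γ t₀) S → (posIndex S : ℤ) + c t₀ = posIndex S₀ + c t₀ := by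
    intro S hS'
    rw [hS'.unique hF.1 hS]
  by_cases hs : (Γ t₀).Singular
  · have hn := h.mem_nhds_of_singular ht₀ hs
    have hexS : ∀ᶠ t in 𝓝[>] t₀, ∃ S, IsSlope F (Γ t) S := by
      obtain ⟨S, -, -, hSs⟩ := h.frame.exists_slope_near ht₀ hF hS
      rw [nhdsWithin_eq_nhds.2 hn] at hSs
      exact (hSs.filter_mono nhdsWithin_le_nhds).mono fun t ht => ⟨_, ht⟩
    have hdisj : IsPositiveCrossing Γ t₀ → IsNegativeCrossing Γ t₀ → False := by
      intro hp hn'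
      obtain ⟨-, h1, -⟩ := h.frame.of_isPositiveCrossing hn hF hS hp
      obtain ⟨-, h2, -⟩ := h.frame.of_isNegativeCrossing hn hF hS hn'
      obtain ⟨t, h3, h4, S, h5⟩ := (h1.and (h2.and hexS)).exists
      have := h3 S h5
      have := h4 S h5
      omega
    rcases h.crossing t₀ ht₀ hs with hp | hp
    · have hmem : t₀ ∈ posSet α β Γ := ⟨ht₀, hp⟩
      have hnmem : t₀ ∉ negSet α β Γ := fun h' => hdisj hp h'.2
      obtain ⟨h1, h2, -⟩ := h.frame.of_isPositiveCrossing hn hF hS hp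
      refine hsplit _ h0 ?_ ?_
      · filter_upwards [h1, hl] with t h3 h4 _ S h5
        rw [h4.1 hmem, h3 S h5]
        push_cast
        ring
      · filter_upwards [h2, hr] with t h3 h4 _ S h5
        rw [h4.2 hnmem, h3 S h5]
    · have hmem : t₀ ∈ negSet α β Γ := ⟨ht₀, hp⟩
      have hnmem : t₀ ∉ posSet α β Γ := fun h' => hdisj h'.2 hp
      obtain ⟨h1, h2, -⟩ := h.frame.of_isNegativeCrossing hn hF hS hp
      refine hsplit _ h0 ?_ ?_
      · filter_upwards [h1, hl] with t h3 h4 _ S h5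
        rw [h4.2 hnmem, h3 S h5]
      · filter_upwards [h2, hr] with t h3 h4 _ S h5
        rw [h4.1 hmem, h3 S h5]
        push_cast
        ring
  · have h1 := eventually_nhdsWithin_iff.1 (h.frame.eventually_of_not_singular ht₀ hF hS hs)
    have hP : t₀ ∉ posSet α β Γ := fun h' => hs h'.2.singular
    have hN : t₀ ∉ negSet α β Γ := fun h' => hs h'.2.singular
    refine hsplit _ h0 ?_ ?_
    · filter_upwards [h1.filter_mono nhdsWithin_le_nhds, hl] with t h3 h4 h6 S h5
      rw [h4.2 hP, (h3 h6).2 S h5]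
    · filter_upwards [h1.filter_mono nhdsWithin_le_nhds, hr] with t h3 h4 h6 S h5
      rw [h4.2 hN, (h3 h6).2 S h5]

include hslope in
lemma HasGoodCrossings.posIndex_add_const (h : HasGoodCrossings α β e Γ) {a b : ℝ} (hab : a ≤ b)
    (hsub : Icc a b ⊆ Icc α β) (hF : IsVerticallyFoliated F)
    (hS : ∀ t ∈ Icc a b, ∃ S, IsSlope F (Γ t) S) {Sa Sb : Matrix (Fin d) (Fin d) ℝ}
    (ha : IsSlope F (Γ a) Sa) (hb : IsSlope F (Γ b) Sb) :
    (posIndex Sa : ℤ) + countUpTo (posSet α β Γ) (negSet α β Γ) a =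
      posIndex Sb + countUpTo (posSet α β Γ) (negSet α β Γ) b := by
  set c := countUpTo (posSet α β Γ) (negSet α β Γ) with hc
  choose! S hS using hS
  have hcont : ContinuousOn (fun t => (posIndex (S t) : ℤ) + c t) (Icc a b) := by
    intro t ht
    refine ContinuousWithinAt.congr_of_eventuallyEq
      (continuousWithinAt_const (b := (posIndex (S t) : ℤ) + c t)) ?_ rfl
    filter_upwards [(h.eventually_posIndex_add hslope (hsub ht) hF (hS t ht)).filter_mono
      (nhdsWithin_mono _ hsub), self_mem_nhdsWithin] with z hz hz'
    exact hz _ (hS z hz')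
  have := isPreconnected_Icc.constant hcont (left_mem_Icc.2 hab) (right_mem_Icc.2 hab)
  rwa [(hS a (left_mem_Icc.2 hab)).unique hF.1 ha, (hS b (right_mem_Icc.2 hab)).unique hF.1 hb]
    at this

include hslope in
/-- A relation between the indices in two charts that holds near `t₀` out of the singular cycle
also holds at `t₀`. -/
lemma HasGoodCrossings.posIndex_eq_add (h : HasGoodCrossings α β e Γ) (ht₀ : t₀ ∈ Icc α β)
    (hF : IsVerticallyFoliated F) (hF' : IsVerticallyFoliated F') (hS : IsSlope F (Γ t₀) S₀)
    (hS' : IsSlope F' (Γ t₀) S₀') {k : ℤ}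
    (hk : ∀ᶠ t in 𝓝[Icc α β] t₀, ∀ S S', ¬ (Γ t).Singular → IsSlope F (Γ t) S →
      IsSlope F' (Γ t) S' → (posIndex S : ℤ) = posIndex S' + k) :
    (posIndex S₀ : ℤ) = posIndex S₀' + k := by
  obtain ⟨S, -, -, hSs⟩ := h.frame.exists_slope_near ht₀ hF hS
  obtain ⟨S', -, -, hSs'⟩ := h.frame.exists_slope_near ht₀ hF' hS'
  obtain ⟨t, h1, h2, h3, h4, h5, h6⟩ := ((h.frequently_not_singular ht₀ hF hS).and_eventually
    (hk.and (hSs.and (hSs'.and ((h.eventually_posIndex_add hslope ht₀ hF hS).and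
      (h.eventually_posIndex_add hslope ht₀ hF' hS')))))).exists
  have := h2 _ _ h1 h3 h4
  have := h5 _ h3
  have := h6 _ h4
  omega

/-- The signed number of crossings, from a partition into intervals over which the path is
transverse to the horizontal foliation of a chart. -/
lemma HasGoodCrossings.signedCrossings_eq (h : HasGoodCrossings α β e Γ) {T : ℕ → ℝ}
    (hT : Monotone T) {N : ℕ} (hT0 : T 0 = α) (hTN : T (N + 1) = β)
    {F : ℕ → OpenPartialHomeomorph (Cot d M) (Rn d × Rn d)}
    (hF : ∀ k, IsVerticallyFoliated (F k))
    (hS : ∀ k ≤ N, ∀ t ∈ Icc (T k) (T (k + 1)), ∃ S, IsSlope (F k) (Γ t) S) {c : ℕ → ℤ}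
    (hc : ∀ k < N, ∀ᶠ t in 𝓝[Icc α β] (T (k + 1)), ∀ S S', ¬ (Γ t).Singular →
      IsSlope (F k) (Γ t) S → IsSlope (F (k + 1)) (Γ t) S' → (posIndex S : ℤ) = posIndex S' + c k)
    {a b : ℤ} (ha : ∀ S, IsSlope (F 0) (Γ α) S → (posIndex S : ℤ) = a)
    (hb : ∀ S, IsSlope (F N) (Γ β) S → (posIndex S : ℤ) = b) :
    signedCrossings α β Γ = a - ∑ k ∈ Finset.range N, c k - b := by
  have hαβ : α ≤ β := by
    rw [← hT0, ← hTN]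
    exact hT (Nat.zero_le _)
  have hsub : ∀ k ≤ N, Icc (T k) (T (k + 1)) ⊆ Icc α β := by
    intro k hk
    rw [← hT0, ← hTN]
    exact Icc_subset_Icc (hT (Nat.zero_le _)) (hT (by omega))
  have hslope : ∀ t ∈ Icc α β, ∃ F S, IsVerticallyFoliated F ∧ IsSlope F (Γ t) S := by
    have hind : ∀ k ≤ N, ∀ t ∈ Icc α (T (k + 1)), ∃ F S, IsVerticallyFoliated F ∧
        IsSlope F (Γ t) S := by
      intro k
      induction k with
      | zero =>
        intro h0 t ht
        rw [← hT0] at ht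
        obtain ⟨S, hS⟩ := hS 0 h0 t ht
        exact ⟨_, S, hF 0, hS⟩
      | succ k ih =>
        intro hk t ht
        rcases le_total t (T (k + 1)) with h1 | h1
        · exact ih (by omega) t ⟨ht.1, h1⟩
        · obtain ⟨S, hS⟩ := hS (k + 1) hk t ⟨h1, ht.2⟩
          exact ⟨_, S, hF _, hS⟩
    intro t ht
    exact hind N le_rfl t (by rwa [hTN])
  set C := countUpTo (posSet α β Γ) (negSet α β Γ) with hC
  have hCα : C α = 0 := by
    have h1 : posSet α β Γ ∩ Iic α = ∅ := by
      refine eq_empty_iff_forall_notMem.2 fun t ht => h.left ?_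
      have h2 : t = α := le_antisymm ht.2 ht.1.1.1
      rw [← h2]
      exact ht.1.2.singular
    have h2 : negSet α β Γ ∩ Iio α = ∅ :=
      eq_empty_iff_forall_notMem.2 fun t ht => (show t < α from ht.2).not_ge ht.1.1.1
    rw [hC, countUpTo, h1, h2]
    simp
  have hCβ : C β = signedCrossings α β Γ := by
    have h1 : posSet α β Γ ∩ Iic β = posSet α β Γ := inter_eq_left.2 fun t ht => ht.1.2
    have h2 : negSet α β Γ ∩ Iio β = negSet α β Γ := by
      refine inter_eq_left.2 fun t ht => lt_of_le_of_ne ht.1.2 ?_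
      rintro rfl
      exact h.right ht.2.singular
    rw [hC, countUpTo, h1, h2]
    rfl
  -- The corrected index is constant on each interval of the partition, and it drops by `c k` from
  -- the chart `F k` to the next one.
  have hmain : ∀ k ≤ N, ∀ S, IsSlope (F k) (Γ (T (k + 1))) S →
      (posIndex S : ℤ) + C (T (k + 1)) = a - ∑ j ∈ Finset.range k, c j := by
    intro k
    induction k with
    | zero =>
      intro h0 S hS1
      have hle := hT (Nat.zero_le 1)
      obtain ⟨S', hS'⟩ := hS 0 h0 (T 0) (left_mem_Icc.2 hle)
      have h1 := h.posIndex_add_const hslope hle (hsub 0 h0) (hF 0) (hS 0 h0) hS' hS1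
      rw [hT0] at h1 hS'
      rw [← hC, hCα, ha S' hS'] at h1
      simp only [Finset.range_zero, Finset.sum_empty, sub_zero]
      rw [← h1, add_zero]
    | succ k ih =>
      intro hk S hS1
      have hle := hT (Nat.le_succ (k + 1))
      have hle' := hT (Nat.le_succ k)
      obtain ⟨S', hS'⟩ := hS (k + 1) hk (T (k + 1)) (left_mem_Icc.2 hle)
      obtain ⟨S'', hS''⟩ := hS k (by omega) (T (k + 1)) (right_mem_Icc.2 hle')
      have h1 := h.posIndex_add_const hslope hle (hsub _ hk) (hF _) (hS _ hk) hS' hS1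
      have h2 := ih (by omega) S'' hS''
      have h3 := h.posIndex_eq_add hslope (hsub k (by omega) (right_mem_Icc.2 hle')) (hF k)
        (hF (k + 1)) hS'' hS' (hc k (by omega))
      rw [← hC] at h1
      rw [Finset.sum_range_succ]
      linarith
  obtain ⟨S, hS1⟩ := hS N le_rfl (T (N + 1)) (right_mem_Icc.2 (hT (Nat.le_succ N)))
  have h1 := hmain N le_rfl S hS1
  rw [hTN] at h1 hS1
  rw [hCβ, hb S hS1] at h1
  linarith

end Counting

/-! ### Stability of the number of crossings under small perturbations -/

section Stability

/-- A partition of `[α, β]` into intervals, each of them contained in one of the neighbourhoods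
`V τ`. -/
lemma exists_partition {α β : ℝ} (hαβ : α ≤ β) {V : ℝ → Set ℝ}
    (hV : ∀ t ∈ Icc α β, V t ∈ 𝓝[Icc α β] t) :
    ∃ (T : ℕ → ℝ) (N : ℕ), Monotone T ∧ T 0 = α ∧ T (N + 1) = β ∧ (∀ k, T k ∈ Icc α β) ∧
      ∀ k, ∃ τ ∈ Icc α β, Icc (T k) (T (k + 1)) ⊆ V τ := by
  have hV' : ∀ t : Icc α β, ∃ U : Set ℝ, IsOpen U ∧ (t : ℝ) ∈ U ∧ U ∩ Icc α β ⊆ V t := fun t =>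
    mem_nhdsWithin.1 (hV t t.2)
  choose U hU htU hUV using hV'
  obtain ⟨T, h0, hm, ⟨N, hN⟩, hc⟩ := exists_monotone_Icc_subset_open_cover_Icc hαβ
    (c := fun t : Icc α β => ((↑) : Icc α β → ℝ) ⁻¹' U t)
    (fun t => (hU t).preimage continuous_subtype_val)
    (fun t _ => mem_iUnion.2 ⟨t, htU t⟩)
  refine ⟨fun k => T k, N, fun i j hij => hm hij, h0, hN _ (Nat.le_succ N), fun k => (T k).2,
    fun k => ?_⟩
  obtain ⟨τ, hτ⟩ := hc k
  refine ⟨τ, τ.2, fun t ht => ?_⟩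
  have htI : t ∈ Icc α β := ⟨(T k).2.1.trans ht.1, ht.2.trans (T (k + 1)).2.2⟩
  exact hUV τ ⟨hτ (show (⟨t, htI⟩ : Icc α β) ∈ Icc (T k) (T (k + 1)) from ht), htI⟩

variable {d : ℕ} {M : Type*} [TopologicalSpace M] [ChartedSpace (Rn d) M]
  [IsManifold 𝓘(ℝ, Rn d) ∞ M]

variable {α β : ℝ} {e : ℝ → Fin d → TTCot d M} {Γ : ℝ → SubspaceAt d M}

lemma mem_c1Nhds {K : Set ℝ} {i : Fin d}
    {U : Set (TangentBundle (JCot d).tangent (TTCot d M))} (hK : IsCompact K)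
    (hKs : K ⊆ Icc α β) (hU : IsOpen U) (he : ∀ t ∈ K, velocity α β (fun s => e s i) t ∈ U) :
    ∀ᶠ e' in c1Nhds α β e, ∀ t ∈ K, velocity α β (fun s => e' s i) t ∈ U := by
  rw [c1Nhds, TopologicalSpace.nhds_generateFrom]
  exact mem_iInf_of_mem _ (mem_iInf_of_mem ⟨he, K, i, U, hK, hKs, hU, rfl⟩ (mem_principal_self _))

/-- The `C^1` topology is finer than the topology of uniform convergence on compact sets. -/
lemma eventually_c1Nhds_mem (he : ContinuousOn e (Icc α β)) {K : Set ℝ} (hK : IsCompact K)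
    (hKs : K ⊆ Icc α β) {U : Set (Fin d → TTCot d M)} (hU : ∀ t ∈ K, U ∈ 𝓝 (e t)) :
    ∀ᶠ e' in c1Nhds α β e, ∀ t ∈ K, e' t ∈ U := by
  refine hK.induction_on (p := fun s => ∀ᶠ e' in c1Nhds α β e, ∀ t ∈ s, e' t ∈ U) ?_ ?_ ?_ ?_
  · simp
  · exact fun s t hst ht => ht.mono fun e' h z hz => h z (hst hz)
  · intro s t hs ht
    filter_upwards [hs, ht] with e' h1 h2 z hz
    exact hz.elim (h1 z) (h2 z)
  · intro t ht
    have h1 := hU t ht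
    rw [nhds_pi, Filter.mem_pi] at h1
    obtain ⟨I, -, V, hV, hVU⟩ := h1
    choose W hWV hW htW using fun i => mem_nhds_iff.1 (hV i)
    have h2 : ∀ᶠ z in 𝓝[K] t, ∀ i, e z i ∈ W i := by
      rw [eventually_all]
      intro i
      have h3 : ContinuousWithinAt (fun z => e z i) K t :=
        ((continuous_apply i).continuousAt.comp_continuousWithinAt (he t (hKs ht))).mono hKs
      exact h3.eventually ((hW i).mem_nhds (htW i))
    obtain ⟨O, hO, htO, hOK⟩ := mem_nhdsWithin.1 h2
    obtain ⟨C, hC, htC, hCO⟩ := local_compact_nhds (hO.mem_nhds htO)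
    refine ⟨K ∩ C, inter_mem_nhdsWithin K hC, ?_⟩
    have h4 : ∀ i, ∀ᶠ e' in c1Nhds α β e, ∀ z ∈ K ∩ C, e' z i ∈ W i := by
      intro i
      have hp : Continuous (TotalSpace.proj :
          TangentBundle (JCot d).tangent (TTCot d M) → TTCot d M) :=
        FiberBundle.continuous_proj _ _
      exact mem_c1Nhds (U := TotalSpace.proj ⁻¹' W i) (hK.inter hCO) (inter_subset_left.trans hKs)
        ((hW i).preimage hp) (fun z hz => hOK ⟨htC hz.2, hz.1⟩ i)
    filter_upwards [eventually_all.2 h4] with e' h5 z hz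
    exact hVU fun i _ => hWV i (h5 i z hz)

lemma IsLagrangianFrame.isContFrame {k : ℕ∞ω} (h : IsLagrangianFrame k α β e Γ) :
    IsContFrame (Icc α β) e Γ where
  lagrangian := h.1
  continuousOn_pt := h.2.1.continuousOn
  continuousOn := continuousOn_pi.2 fun i => (h.2.2.1 i).continuousOn
  frame := h.2.2.2

lemma InGeneralPosition.hasGoodCrossings (h : InGeneralPosition α β e Γ) :
    HasGoodCrossings α β e Γ :=
  ⟨h.1.isContFrame, h.2.1, h.2.2.1, h.2.2.2⟩

lemma signedCrossings_eq_zero_of_dim_zero (hd : d = 0) : signedCrossings α β Γ = 0 := by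
  have hno : ∀ L : SubspaceAt d M, ¬ L.RegularSingular := by
    intro L hL
    have h1 : Module.finrank ℝ (L.sub ⊓ vert L.pt : Submodule ℝ (TCot L.pt)) ≤ d + d :=
      (Submodule.finrank_le _).trans_eq (finrank_tangent _)
    rw [hL] at h1
    omega
  have h1 : {t ∈ Icc α β | IsPositiveCrossing Γ t} = ∅ :=
    eq_empty_iff_forall_notMem.2 fun t ht => hno _ ht.2.1
  have h2 : {t ∈ Icc α β | IsNegativeCrossing Γ t} = ∅ :=
    eq_empty_iff_forall_notMem.2 fun t ht => hno _ ht.2.1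
  rw [signedCrossings, h1, h2]
  simp

/-- All paths in general position that are close enough to a given path have the same signed number
of crossings, which does not depend on the frame used to measure the closeness. -/
lemma exists_signedCrossings_eq (hαβ : α ≤ β) (h : IsContFrame (Icc α β) e Γ)
    (hα : ¬ (Γ α).Singular) (hβ : ¬ (Γ β).Singular)
    (hslope : ∀ t ∈ Icc α β, ∃ F S, IsVerticallyFoliated F ∧ IsSlope F (Γ t) S) :
    ∃ m : ℤ, ∀ e', IsContFrame (Icc α β) e' Γ → ∀ᶠ e'' in c1Nhds α β e', ∀ Γ'',
      HasGoodCrossings α β e'' Γ'' → signedCrossings α β Γ'' = m := by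
  -- In dimension `0` there are no crossings, and frames do not determine base points.
  rcases Nat.eq_zero_or_pos d with hd | hd
  · exact ⟨0, fun e' _ => Eventually.of_forall fun e'' Γ'' _ =>
      signedCrossings_eq_zero_of_dim_zero hd⟩
  let i₀ : Fin d := ⟨0, hd⟩
  have : Nonempty (OpenPartialHomeomorph (Cot d M) (Rn d × Rn d)) := by
    obtain ⟨F, -⟩ := hslope α (left_mem_Icc.2 hαβ)
    exact ⟨F⟩
  choose! F S hF hFS using hslope
  obtain ⟨T, N, hT, hT0, hTN, hTI, hTV⟩ := exists_partition hαβ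
    (V := fun τ => {t | ∃ S, IsSlope (F τ) (Γ t) S}) (by
      intro t ht
      obtain ⟨S', -, -, hS'⟩ := h.exists_slope_near ht (hF t ht) (hFS t ht)
      exact hS'.mono fun z hz => ⟨_, hz⟩)
  choose τ hτI hτ using hTV
  have hle : ∀ k, T k ≤ T (k + 1) := fun k => hT (Nat.le_succ k)
  choose A hA using fun k => hτ k (left_mem_Icc.2 (hle k))
  choose B hB using fun k => hτ k (right_mem_Icc.2 (hle k))
  choose c hc using fun k => exists_posIndex_eq_add (hF _ (hτI k)) (hF _ (hτI (k + 1)))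
    (h.lagrangian _ (hTI (k + 1))) (hB k) (hA (k + 1))
  have hA0 := hA 0
  rw [hT0] at hA0
  have hBN := hB N
  rw [hTN] at hBN
  -- The index of the slope is locally constant at the ends.
  have hends : ∀ {t S} {F : OpenPartialHomeomorph (Cot d M) (Rn d × Rn d)}, t ∈ Icc α β →
      ¬ (Γ t).Singular → IsVerticallyFoliated F → IsSlope F (Γ t) S → ∀ {e'},
      IsContFrame (Icc α β) e' Γ → ∀ᶠ w in 𝓝 (e' t), ∀ (L : SubspaceAt d M) S', IsFrameOf w L →
        L.IsLagrangian → IsSlope F L S' → (posIndex S' : ℤ) = posIndex S := by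
    intro t S F ht hns hF hS e' he'
    have hsrc : ∀ i, (e' t i).proj ∈ F.source := fun i => by
      rw [(he'.frame t ht).proj_eq]
      exact hS.1
    have h1 := continuousAt_slope hF.1 hsrc (hS.det_pMat_ne_zero hF.1 (he'.frame t ht))
    have h2 : S.det ≠ 0 := fun h0 => hns ((hS.singular_iff hF).2 h0)
    have h3 := h1.eventually (eventually_posIndex_eq
      (H₀ := qMat F (e' t) * (pMat F (e' t))⁻¹)
      (by
        rw [← hS.eq_qMat_mul hF.1 (he'.frame t ht)]
        exact hS.isSymm hF (h.lagrangian t ht).isotropic)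
      (by rwa [← hS.eq_qMat_mul hF.1 (he'.frame t ht)]))
    rw [← hS.eq_qMat_mul hF.1 (he'.frame t ht)] at h3
    filter_upwards [h3] with w hw L S' hfr hL hS'
    rw [← hS'.eq_qMat_mul hF.1 hfr] at hw
    rw [(hw (hS'.isSymm hF hL.isotropic)).1]
  refine ⟨posIndex (A 0) - ∑ k ∈ Finset.range N, c k - posIndex (B N), fun e' he' => ?_⟩
  -- Close to `Γ`, a path is transverse to the horizontal foliation of the chart of each interval.
  have hev1 : ∀ k, ∀ᶠ e'' in c1Nhds α β e', ∀ t ∈ Icc (T k) (T (k + 1)),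
      e'' t ∈ {w | (∀ i, (w i).proj ∈ (F (τ k)).source) ∧ (pMat (F (τ k)) w).det ≠ 0} := by
    intro k
    have hsub : Icc (T k) (T (k + 1)) ⊆ Icc α β := Icc_subset_Icc (hTI k).1 (hTI _).2
    refine eventually_c1Nhds_mem he'.continuousOn isCompact_Icc hsub fun t ht => ?_
    obtain ⟨S', hS'⟩ := hτ k ht
    have hFk := hF _ (hτI k)
    have hsrc : ∀ i, (e' t i).proj ∈ (F (τ k)).source := fun i => by
      rw [(he'.frame t (hsub ht)).proj_eq]
      exact hS'.1
    have h1 : ∀ᶠ w in 𝓝 (e' t), ∀ i, (w i).proj ∈ (F (τ k)).source := by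
      rw [eventually_all]
      intro i
      have hcp : Continuous fun w : Fin d → TTCot d M => (w i).proj :=
        (FiberBundle.continuous_proj _ _).comp (continuous_apply i)
      exact hcp.continuousAt.eventually ((F (τ k)).open_source.mem_nhds (hsrc i))
    have h2 : ContinuousAt (fun w => (pMat (F (τ k)) w).det) (e' t) :=
      (continuous_id.matrix_det).continuousAt.comp (continuousAt_pMat hFk.1 hsrc)
    exact h1.and (h2.eventually_ne (hS'.det_pMat_ne_zero hFk.1 (he'.frame t (hsub ht))))
  -- Close to `Γ`, the indices in consecutive charts are related by the same constants.
  have hev2 : ∀ k, ∀ᶠ e'' in c1Nhds α β e', ∀ t ∈ ({T (k + 1)} : Set ℝ), e'' t ∈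
      interior {w | ∀ (L' : SubspaceAt d M) S S', IsFrameOf w L' → L'.IsLagrangian →
        ¬ L'.Singular → IsSlope (F (τ k)) L' S → IsSlope (F (τ (k + 1))) L' S' →
        (posIndex S : ℤ) = posIndex S' + c k} := by
    intro k
    refine eventually_c1Nhds_mem he'.continuousOn isCompact_singleton
      (singleton_subset_iff.2 (hTI _)) fun t ht => ?_
    rw [mem_singleton_iff.1 ht]
    exact interior_mem_nhds.2 (hc k _ (he'.frame _ (hTI (k + 1))))
  have hev3 := eventually_c1Nhds_mem he'.continuousOn isCompact_singleton
    (singleton_subset_iff.2 (left_mem_Icc.2 hαβ)) (fun t ht => by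
      rw [mem_singleton_iff.1 ht]
      exact hends (left_mem_Icc.2 hαβ) hα (hF _ (hτI 0)) hA0 he')
  have hev4 := eventually_c1Nhds_mem he'.continuousOn isCompact_singleton
    (singleton_subset_iff.2 (right_mem_Icc.2 hαβ)) (fun t ht => by
      rw [mem_singleton_iff.1 ht]
      exact hends (right_mem_Icc.2 hαβ) hβ (hF _ (hτI N)) hBN he')
  have hev1' := (Set.finite_Iic N).eventually_all (l := c1Nhds α β e')
    (p := fun k e'' => ∀ t ∈ Icc (T k) (T (k + 1)),
      e'' t ∈ {w | (∀ i, (w i).proj ∈ (F (τ k)).source) ∧ (pMat (F (τ k)) w).det ≠ 0})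
  have hev2' := (Set.finite_Iio N).eventually_all (l := c1Nhds α β e')
    (p := fun k e'' => ∀ t ∈ ({T (k + 1)} : Set ℝ), e'' t ∈
      interior {w | ∀ (L' : SubspaceAt d M) S S', IsFrameOf w L' → L'.IsLagrangian →
        ¬ L'.Singular → IsSlope (F (τ k)) L' S → IsSlope (F (τ (k + 1))) L' S' →
        (posIndex S : ℤ) = posIndex S' + c k})
  filter_upwards [hev1'.2 fun k _ => hev1 k, hev2'.2 fun k _ => hev2 k, hev3, hev4]
    with e'' h1 h2 h3 h4 Γ'' hΓ
  have hfr := hΓ.frame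
  refine hΓ.signedCrossings_eq hT hT0 hTN (F := fun k => F (τ k)) (fun k => hF _ (hτI k))
    ?_ ?_ ?_ ?_
  · intro k hk t ht
    obtain ⟨h5, h6⟩ := h1 k hk t ht
    have htI : t ∈ Icc α β := ⟨(hTI k).1.trans ht.1, ht.2.trans (hTI _).2⟩
    have h7 := hfr.frame t htI
    refine ⟨_, h7.isSlope (hF _ (hτI k)).1 ?_ h6⟩
    rw [← h7.proj_eq i₀]
    exact h5 i₀
  · intro k hk
    have h5 := h2 k hk (T (k + 1)) rfl
    have h6 := (hfr.continuousOn _ (hTI (k + 1))).eventually (isOpen_interior.mem_nhds h5)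
    filter_upwards [h6, self_mem_nhdsWithin] with t h7 h8 S S' h9 h10 h11
    exact interior_subset h7 (Γ'' t) S S' (hfr.frame t h8) (hfr.lagrangian t h8) h9 h10 h11
  · intro S hS
    exact h3 α rfl (Γ'' α) S (hfr.frame _ (left_mem_Icc.2 hαβ))
      (hfr.lagrangian _ (left_mem_Icc.2 hαβ)) hS
  · intro S hS
    exact h4 β rfl (Γ'' β) S (hfr.frame _ (right_mem_Icc.2 hαβ))
      (hfr.lagrangian _ (right_mem_Icc.2 hαβ)) hS

end Stability

/-! ### Dynamical paths and their frames -/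

section Dynamics

variable {d : ℕ} {M : Type*} [TopologicalSpace M] [ChartedSpace (Rn d) M]
  [IsManifold 𝓘(ℝ, Rn d) ∞ M]
  {φ : ℝ → Diffeomorph (JCot d) (JCot d) (Cot d M) (Cot d M) ∞}

/-- The image of the tangent vector `z` of `T*M` by the differential of `φ_t`. -/
def flowVec (φ : ℝ → Diffeomorph (JCot d) (JCot d) (Cot d M) (Cot d M) ∞) (z : ℝ × TTCot d M) :
    TTCot d M :=
  tangentMap (JCot d) (JCot d) (φ z.1) z.2

lemma contMDiff_flowVec (hφ : IsConformallySymplecticIsotopy φ) :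
    ContMDiff (𝓘(ℝ, ℝ).prod (JCot d).tangent) (JCot d).tangent ∞ (flowVec φ) := by
  have h1 : ContMDiff (𝓘(ℝ, ℝ).prod (JCot d)).tangent (JCot d).tangent ∞
      (tangentMap (𝓘(ℝ, ℝ).prod (JCot d)) (JCot d) (fun z : ℝ × Cot d M => φ z.1 z.2)) :=
    hφ.1.contMDiff_tangentMap (by simp)
  have h2 : ContMDiff 𝓘(ℝ, ℝ) 𝓘(ℝ, ℝ).tangent ∞
      (zeroSection ℝ (TangentSpace 𝓘(ℝ, ℝ) : ℝ → Type)) := contMDiff_zeroSection ℝ _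
  have h3 : ContMDiff (𝓘(ℝ, ℝ).prod (JCot d).tangent) (𝓘(ℝ, ℝ).tangent.prod (JCot d).tangent) ∞
      (fun z : ℝ × TTCot d M =>
        ((zeroSection ℝ (TangentSpace 𝓘(ℝ, ℝ) : ℝ → Type) z.1 : TangentBundle 𝓘(ℝ, ℝ) ℝ), z.2)) :=
    (h2.comp contMDiff_fst).prodMk contMDiff_snd
  have h4 := h1.comp ((contMDiff_equivTangentBundleProd_symm (n := ∞) (I := 𝓘(ℝ, ℝ)) (M := ℝ)
    (I' := JCot d) (M' := Cot d M)).comp h3)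
  refine h4.congr fun z => ?_
  obtain ⟨t, x, v⟩ := z
  have hd : MDifferentiableAt (𝓘(ℝ, ℝ).prod (JCot d)) (JCot d)
      (fun z : ℝ × Cot d M => φ z.1 z.2) (t, x) := hφ.1.mdifferentiable (by simp) _
  have hr : MDifferentiableAt (JCot d) (𝓘(ℝ, ℝ).prod (JCot d)) (fun y : Cot d M => (t, y)) x :=
    mdifferentiableAt_const.prodMk mdifferentiableAt_id
  have h5 := mfderiv_comp x (g := fun z : ℝ × Cot d M => φ z.1 z.2) hd hr
  rw [mfderiv_prod_right] at h5
  exact congrArg (TotalSpace.mk (φ t x)) (DFunLike.congr_fun h5 v)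

/-- The velocity at time `t` of the curve `s ↦ Dφ_s(z)`. -/
lemma velocity_flowVec (hφ : IsConformallySymplecticIsotopy φ) {α β : ℝ} (hαβ : α < β) {t : ℝ}
    (ht : t ∈ Icc α β) (z : TTCot d M) :
    velocity α β (fun s => flowVec φ (s, z)) t =
      tangentMap (𝓘(ℝ, ℝ).prod (JCot d).tangent) (JCot d).tangent (flowVec φ)
        ((equivTangentBundleProd 𝓘(ℝ, ℝ) ℝ (JCot d).tangent (TTCot d M)).symm
          (⟨t, (1 : ℝ)⟩, zeroSection _ _ z)) := by
  have hd : MDifferentiableAt (𝓘(ℝ, ℝ).prod (JCot d).tangent) (JCot d).tangent (flowVec φ) (t, z) :=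
    (contMDiff_flowVec hφ).mdifferentiable (by simp) _
  have hl : MDifferentiableAt 𝓘(ℝ, ℝ) (𝓘(ℝ, ℝ).prod (JCot d).tangent) (fun s : ℝ => (s, z)) t :=
    mdifferentiableAt_id.prodMk mdifferentiableAt_const
  have hu : UniqueMDiffWithinAt 𝓘(ℝ, ℝ) (Icc α β) t :=
    ((uniqueDiffOn_Icc hαβ) t ht).uniqueMDiffWithinAt
  refine (tangentMapWithin_eq_tangentMap (f := flowVec φ ∘ fun s : ℝ => (s, z))
    (p := (⟨t, (1 : ℝ)⟩ : TangentBundle 𝓘(ℝ, ℝ) ℝ)) hu (hd.comp t hl)).trans ?_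
  have h5 := mfderiv_comp t hd hl
  rw [mfderiv_prod_left] at h5
  exact congrArg (TotalSpace.mk (flowVec φ (t, z))) (DFunLike.congr_fun h5 (1 : ℝ))

/-- The frame `t ↦ (Dφ_t(w 0), …, Dφ_t(w (d-1)))`. -/
def dynFrame (φ : ℝ → Diffeomorph (JCot d) (JCot d) (Cot d M) (Cot d M) ∞) {x : Cot d M}
    (w : Fin d → TCot x) (t : ℝ) (i : Fin d) : TTCot d M :=
  flowVec φ (t, ⟨x, w i⟩)

set_option synthInstance.maxHeartbeats 200000 in
/-- A dynamical frame depends continuously, in the `C^1` topology, on its initial value. -/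
lemma tendsto_dynFrame (hφ : IsConformallySymplecticIsotopy φ) {α β : ℝ} (hαβ : α < β)
    {x : Cot d M} (w₀ : Fin d → TCot x) :
    Tendsto (fun w : Fin d → TCot x => dynFrame φ w) (𝓝 w₀) (c1Nhds α β (dynFrame φ w₀)) := by
  rw [c1Nhds, TopologicalSpace.nhds_generateFrom]
  refine tendsto_iInf.2 fun s => tendsto_iInf.2 fun hs => tendsto_principal.2 ?_
  obtain ⟨hmem, K, i, U, hK, hKs, hU, rfl⟩ := hs
  let g : (Fin d → TCot x) × ℝ → TangentBundle (JCot d).tangent (TTCot d M) := fun z =>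
    tangentMap (𝓘(ℝ, ℝ).prod (JCot d).tangent) (JCot d).tangent (flowVec φ)
      ((equivTangentBundleProd 𝓘(ℝ, ℝ) ℝ (JCot d).tangent (TTCot d M)).symm
        ((⟨z.2, (1 : ℝ)⟩ : TangentBundle 𝓘(ℝ, ℝ) ℝ),
          zeroSection (((Rn d × (Rn d →L[ℝ] ℝ)) × (Rn d × (Rn d →L[ℝ] ℝ))))
            (TangentSpace (JCot d).tangent : TTCot d M → Type) ⟨x, z.1 i⟩))
  have hg : Continuous g := by
    have h1 : Continuous (tangentMap (𝓘(ℝ, ℝ).prod (JCot d).tangent) (JCot d).tangent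
        (flowVec φ)) := (contMDiff_flowVec hφ).continuous_tangentMap (by simp)
    have h2 : Continuous (equivTangentBundleProd 𝓘(ℝ, ℝ) ℝ (JCot d).tangent (TTCot d M)).symm :=
      (contMDiff_equivTangentBundleProd_symm (n := ∞)).continuous
    have h3 : Continuous (fun t : ℝ => (⟨t, (1 : ℝ)⟩ : TangentBundle 𝓘(ℝ, ℝ) ℝ)) :=
      (tangentBundleModelSpaceHomeomorph 𝓘(ℝ, ℝ)).symm.continuous.comp
        (continuous_id.prodMk continuous_const)
    have h4 : Continuous (zeroSection (((Rn d × (Rn d →L[ℝ] ℝ)) × (Rn d × (Rn d →L[ℝ] ℝ))))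
            (TangentSpace (JCot d).tangent : TTCot d M → Type)) :=
      (contMDiff_zeroSection (n := ∞) (IB := (JCot d).tangent) ℝ _).continuous
    have h5 : Continuous (fun v : TCot x => (⟨x, v⟩ : TTCot d M)) :=
      FiberBundle.continuous_totalSpaceMk _ _ x
    exact h1.comp (h2.comp ((h3.comp continuous_snd).prodMk
      (h4.comp (h5.comp ((continuous_apply i).comp continuous_fst)))))
  have hgv : ∀ w, ∀ t ∈ K, velocity α β (fun s => dynFrame φ w s i) t = g (w, t) :=
    fun w t ht => velocity_flowVec hφ hαβ (hKs ht) _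
  have h6 : ∀ᶠ w in 𝓝 w₀, ∀ t ∈ K, g (w, t) ∈ U := by
    refine hK.eventually_forall_of_forall_eventually fun t ht => ?_
    refine hg.continuousAt.eventually (hU.mem_nhds ?_)
    rw [← hgv w₀ t ht]
    exact hmem t ht
  filter_upwards [h6] with w hw t ht
  rw [hgv w t ht]
  exact hw t ht

lemma isFrameOf_dynFrame {L : SubspaceAt d M} {w : Fin d → TCot L.pt}
    (hw : LinearIndependent ℝ w) (hs : Submodule.span ℝ (range w) = L.sub) (t : ℝ) :
    IsFrameOf (dynFrame φ w t) (dynPath φ L t) := by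
  let A := (φ t).mfderivToContinuousLinearEquiv (by simp) L.pt
  have hA : ∀ v, mfderiv (JCot d) (JCot d) (φ t) L.pt v = A v := fun v => rfl
  refine ⟨fun i => mfderiv (JCot d) (JCot d) (φ t) L.pt (w i), fun i => rfl, ?_, ?_⟩
  · exact hw.map' A.toLinearEquiv.toLinearMap A.toLinearEquiv.ker
  · change _ = L.sub.map (mfderiv (JCot d) (JCot d) (φ t) L.pt).toLinearMap
    rw [← hs, Submodule.map_span, ← range_comp]
    rfl

lemma contMDiff_dynFrame (hφ : IsConformallySymplecticIsotopy φ) {x : Cot d M}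
    (w : Fin d → TCot x) (i : Fin d) :
    ContMDiff 𝓘(ℝ, ℝ) (JCot d).tangent ∞ (fun t => dynFrame φ w t i) :=
  (contMDiff_flowVec hφ).comp (contMDiff_id.prodMk contMDiff_const)

lemma contMDiff_dynPath_pt (hφ : IsConformallySymplecticIsotopy φ) (L : SubspaceAt d M) :
    ContMDiff 𝓘(ℝ, ℝ) (JCot d) ∞ (fun t => (dynPath φ L t).pt) :=
  hφ.1.comp (contMDiff_id.prodMk contMDiff_const)

/-- The symplectic form is nondegenerate at the points that are covered by charts. -/
lemma eq_zero_of_omega_eq_zero {F : OpenPartialHomeomorph (Cot d M) (Rn d × Rn d)}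
    (hF : IsVerticallyFoliated F) {x : Cot d M} (hx : x ∈ F.source) {u : TCot x}
    (h : ∀ v, omega x u v = 0) : u = 0 := by
  have h1 : ∀ a b : Fin d → ℝ, qC F x u ⬝ᵥ b - pC F x u ⬝ᵥ a = 0 := by
    intro a b
    have := h ((coordEquiv hF.1 hx).symm (a, b))
    rwa [omega_eq hF hx, qC_symm, pC_symm] at this
  have h2 : qC F x u = 0 := by
    have := h1 0 (qC F x u)
    rwa [dotProduct_zero, sub_zero, dotProduct_self_eq_zero] at this
  have h3 : pC F x u = 0 := by
    have := h1 (pC F x u) 0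
    rwa [dotProduct_zero, zero_sub, neg_eq_zero, dotProduct_self_eq_zero] at this
  exact eq_of_coords hF.1 hx (h2.trans (map_zero _).symm) (h3.trans (map_zero _).symm)

/-- The conformal factor of a conformally symplectic diffeomorphism can be taken nonzero. -/
lemma exists_conformal_factor_ne_zero
    (hch : ∀ x : Cot d M, ∃ F, IsVerticallyFoliated F ∧ x ∈ F.source)
    (f : Diffeomorph (JCot d) (JCot d) (Cot d M) (Cot d M) ∞) (hf : IsConformallySymplectic f) :
    ∃ a : ℝ, a ≠ 0 ∧ ∀ (x : Cot d M) (u v : TCot x),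
      omega (f x) (mfderiv (JCot d) (JCot d) f x u) (mfderiv (JCot d) (JCot d) f x v) =
        a * omega x u v := by
  obtain ⟨a, ha⟩ := hf
  by_cases h0 : a = 0
  · -- A vanishing form is nondegenerate in dimension zero only.
    have hz : ∀ (x : Cot d M) (u : TCot x), u = 0 := by
      intro x u
      let A := f.mfderivToContinuousLinearEquiv (by simp) x
      obtain ⟨F, hF, hx⟩ := hch (f x)
      have h1 : A u = 0 := by
        refine eq_zero_of_omega_eq_zero hF hx fun v => ?_
        have h2 := ha x u (A.symm v)
        rw [h0, zero_mul] at h2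
        have h3 : mfderiv (JCot d) (JCot d) f x (A.symm v) = v := A.apply_symm_apply v
        rw [h3] at h2
        exact h2
      exact A.injective (h1.trans (map_zero A).symm)
    refine ⟨1, one_ne_zero, fun x u v => ?_⟩
    rw [hz x u]
    simp
  · exact ⟨a, h0, ha⟩

lemma SubspaceAt.IsLagrangian.push {L : SubspaceAt d M} (hL : L.IsLagrangian)
    (f : Diffeomorph (JCot d) (JCot d) (Cot d M) (Cot d M) ∞) {a : ℝ} (ha : a ≠ 0)
    (hf : ∀ (x : Cot d M) (u v : TCot x),
      omega (f x) (mfderiv (JCot d) (JCot d) f x u) (mfderiv (JCot d) (JCot d) f x v) =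
        a * omega x u v) : (L.push f).IsLagrangian := by
  let A := f.mfderivToContinuousLinearEquiv (by simp) L.pt
  have hmem : ∀ u, u ∈ (L.push f).sub ↔ ∃ v ∈ L.sub, A v = u := fun u => Iff.rfl
  have hA : ∀ u v, omega (f L.pt) (A u) (A v) = a * omega L.pt u v := fun u v => hf L.pt u v
  intro u
  constructor
  · intro hu v hv
    obtain ⟨u', hu', rfl⟩ := (hmem u).1 hu
    obtain ⟨v', hv', rfl⟩ := (hmem v).1 hv
    exact (hA u' v').trans (by rw [(hL u').1 hu' v' hv', mul_zero])
  · intro h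
    refine (hmem u).2 ⟨A.symm u, (hL _).2 fun v hv => ?_, A.apply_symm_apply u⟩
    have h1 := h (A v) ((hmem _).2 ⟨v, hv, rfl⟩)
    have h2 : omega (f L.pt) u (A v) = a * omega L.pt (A.symm u) v :=
      (congrArg (fun z => omega (f L.pt) z (A v)) (A.apply_symm_apply u)).symm.trans
        (hA (A.symm u) v)
    exact (mul_eq_zero.1 (h2.symm.trans h1)).resolve_left ha

lemma isLagrangian_dynPath (hφ : IsConformallySymplecticIsotopy φ)
    (hch : ∀ x : Cot d M, ∃ F, IsVerticallyFoliated F ∧ x ∈ F.source)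
    {L : SubspaceAt d M} (hL : L.IsLagrangian) (t : ℝ) : (dynPath φ L t).IsLagrangian := by
  obtain ⟨a, ha, h⟩ := exists_conformal_factor_ne_zero hch (φ t) (hφ.2 t)
  exact hL.push (φ t) ha h

lemma isLagrangianFrame_dynFrame (hφ : IsConformallySymplecticIsotopy φ)
    (hch : ∀ x : Cot d M, ∃ F, IsVerticallyFoliated F ∧ x ∈ F.source)
    {L : SubspaceAt d M} (hL : L.IsLagrangian) {w : Fin d → TCot L.pt}
    (hw : LinearIndependent ℝ w) (hs : Submodule.span ℝ (range w) = L.sub) (α β : ℝ) :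
    IsLagrangianFrame ∞ α β (dynFrame φ w) (dynPath φ L) :=
  ⟨fun t _ => isLagrangian_dynPath hφ hch hL t, (contMDiff_dynPath_pt hφ L).contMDiffOn,
    fun i => (contMDiff_dynFrame hφ w i).contMDiffOn, fun t _ => isFrameOf_dynFrame hw hs t⟩

/-- A subspace that has a slope has the frame given by the lifts of the momentum coordinates. -/
lemma IsSlope.exists_basis {F : OpenPartialHomeomorph (Cot d M) (Rn d × Rn d)}
    (hF : IsSmoothChart F) {L : SubspaceAt d M} {S : Matrix (Fin d) (Fin d) ℝ}
    (h : IsSlope F L S) :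
    ∃ w : Fin d → TCot L.pt, LinearIndependent ℝ w ∧ Submodule.span ℝ (range w) = L.sub := by
  let w : Fin d → TCot L.pt := fun i => (coordEquiv hF h.1).symm (S *ᵥ Pi.single i 1, Pi.single i 1)
  have hp : ∀ i, pC F L.pt (w i) = Pi.single i 1 := fun i => pC_symm hF h.1 _
  have hq : ∀ i, qC F L.pt (w i) = S *ᵥ Pi.single i 1 := fun i => qC_symm hF h.1 _
  refine ⟨w, ?_, le_antisymm (Submodule.span_le.2 ?_) fun z hz => ?_⟩
  · refine LinearIndependent.of_comp (pC F L.pt) ?_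
    have : (pC F L.pt) ∘ w = fun i => (Pi.single i 1 : Fin d → ℝ) := funext hp
    rw [this]
    exact Pi.linearIndependent_single_one (Fin d) ℝ
  · rintro _ ⟨i, rfl⟩
    exact h.mem hF _
  · rw [Submodule.mem_span_range_iff_exists_fun]
    have h1 : ∑ i, pC F L.pt z i • (Pi.single i 1 : Fin d → ℝ) = pC F L.pt z := by
      simpa using (pi_eq_sum_univ' (pC F L.pt z)).symm
    refine ⟨pC F L.pt z, eq_of_coords hF h.1 ?_ ?_⟩
    · simp only [map_sum, map_smul, hq]
      rw [(h.2 z).1 hz]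
      conv_rhs => rw [← h1]
      rw [Matrix.mulVec_sum]
      simp only [Matrix.mulVec_smul]
    · simp only [map_sum, map_smul, hp, h1]

end Dynamics

/-! ### Sheared charts -/

section Shear

/-- The linear symplectic shear `(q, p) ↦ (q, p - s q)`. -/
def shear (d : ℕ) (s : ℝ) : (Rn d × Rn d) ≃L[ℝ] (Rn d × Rn d) :=
  ContinuousLinearEquiv.equivOfInverse
    ((ContinuousLinearMap.fst ℝ _ _).prod
      (ContinuousLinearMap.snd ℝ _ _ - s • ContinuousLinearMap.fst ℝ _ _))
    ((ContinuousLinearMap.fst ℝ _ _).prod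
      (ContinuousLinearMap.snd ℝ _ _ + s • ContinuousLinearMap.fst ℝ _ _))
    (fun z => by simp) (fun z => by simp)

lemma shear_apply (d : ℕ) (s : ℝ) (z : Rn d × Rn d) : shear d s z = (z.1, z.2 - s • z.1) := rfl

lemma shear_symm_apply (d : ℕ) (s : ℝ) (z : Rn d × Rn d) :
    (shear d s).symm z = (z.1, z.2 + s • z.1) := rfl

lemma isOpen_box (d : ℕ) {I : Set ℝ} (hI : IsOpen I) : IsOpen (box d I) := by
  have : box d I = ⋂ i, (fun p : Rn d => p i) ⁻¹' I := by
    ext p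
    simp [box]
  rw [this]
  exact isOpen_iInter_of_finite fun i => hI.preimage (by fun_prop)

variable {d : ℕ} {M : Type*} [TopologicalSpace M] [ChartedSpace (Rn d) M]
  [IsManifold 𝓘(ℝ, Rn d) ∞ M]

/-- A chart centred at `x` whose image is a cube. -/
def IsCubicChartAt (F : OpenPartialHomeomorph (Cot d M) (Rn d × Rn d)) (x : Cot d M) (a : ℝ) :
    Prop :=
  IsVerticallyFoliated F ∧ x ∈ F.source ∧ F x = 0 ∧
    F.target = box d (Ioo (-a) a) ×ˢ box d (Ioo (-a) a)

variable {F : OpenPartialHomeomorph (Cot d M) (Rn d × Rn d)} {x : Cot d M} {a : ℝ}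

/-- The composition of a cubic chart with a shear, restricted to a smaller cube, is again a
vertically foliated chart. -/
lemma IsCubicChartAt.exists_shear (h : IsCubicChartAt F x a) (ha : 0 < a) {s : ℝ} (hs : 0 ≤ s) :
    ∃ F' : OpenPartialHomeomorph (Cot d M) (Rn d × Rn d), IsVerticallyFoliated F' ∧
      x ∈ F'.source ∧ F'.source ⊆ F.source ∧ ∀ y ∈ F'.source, ∀ v : TCot y,
        qC F' y v = qC F y v ∧ pC F' y v = pC F y v - s • qC F y v := by
  obtain ⟨⟨hsm, hom, I, J, hI, hJ, hIJ, hfib⟩, hx, hFx, ht⟩ := h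
  -- The inverse shear maps the cube of size `b` into that of size `b + s * b = a`.
  set b := a / (1 + s) with hb
  have hb0 : 0 < b := by positivity
  have hba : b + s * b = a := by
    rw [hb]
    field_simp
  set U : Set (Rn d × Rn d) := box d (Ioo (-b) b) ×ˢ box d (Ioo (-b) b) with hU
  have hUo : IsOpen U := (isOpen_box d isOpen_Ioo).prod (isOpen_box d isOpen_Ioo)
  have hUt : ∀ z ∈ U, (shear d s).symm z ∈ F.target := by
    rintro z ⟨h1, h2⟩
    rw [ht, shear_symm_apply]
    have h3 : ∀ i, |z.1 i| < b := fun i => abs_lt.2 (h1 i)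
    have h4 : ∀ i, |z.2 i| < b := fun i => abs_lt.2 (h2 i)
    refine ⟨fun i => abs_lt.1 ?_, fun i => abs_lt.1 ?_⟩
    · exact (h3 i).trans_le (by nlinarith)
    · calc |z.2 i + s * z.1 i| ≤ |z.2 i| + |s * z.1 i| := abs_add_le _ _
        _ = |z.2 i| + s * |z.1 i| := by rw [abs_mul, abs_of_nonneg hs]
        _ < b + s * b := add_lt_add_of_lt_of_le (h4 i) (mul_le_mul_of_nonneg_left (h3 i).le hs)
        _ = a := hba
  let F' := (F.trans (shear d s).toHomeomorph.toOpenPartialHomeomorph).trans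
    (OpenPartialHomeomorph.ofSet U hUo)
  have hF' : ∀ y, F' y = shear d s (F y) := fun y => rfl
  have hF's : ∀ z, F'.symm z = F.symm ((shear d s).symm z) := fun z => rfl
  have hsrc : ∀ y, y ∈ F'.source ↔ y ∈ F.source ∧ shear d s (F y) ∈ U := by
    intro y
    simp [F']
  have htgt : F'.target = U := by
    ext z
    have h1 : z ∈ F'.target ↔ z ∈ U ∧ (shear d s).symm z ∈ F.target := by
      simp only [F', OpenPartialHomeomorph.trans_target, OpenPartialHomeomorph.ofSet_target,
        OpenPartialHomeomorph.ofSet_symm, mem_inter_iff, mem_preimage]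
      rw [show (OpenPartialHomeomorph.ofSet U hUo) z = z from rfl]
      exact ⟨fun h => ⟨h.1, h.2.2⟩, fun h => ⟨h.1, mem_univ _, h.2⟩⟩
    exact h1.trans ⟨fun h => h.1, fun h => ⟨h, hUt z h⟩⟩
  have hsub : F'.source ⊆ F.source := fun y hy => ((hsrc y).1 hy).1
  have hd : ∀ y ∈ F'.source, ∀ v : TCot y, dChart F' y v = shear d s (dChart F y v) := by
    intro y hy v
    have h1 : HasMFDerivAt (JCot d) 𝓘(ℝ, Rn d × Rn d) F y (dChart F y) :=
      (hsm.mdifferentiable.mdifferentiableAt (hsub hy)).hasMFDerivAt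
    have h2 : HasMFDerivAt 𝓘(ℝ, Rn d × Rn d) 𝓘(ℝ, Rn d × Rn d) (shear d s) (F y)
        (shear d s : (Rn d × Rn d) →L[ℝ] (Rn d × Rn d)) :=
      (shear d s).hasFDerivAt.hasMFDerivAt
    have h3 := (h2.comp y h1).mfderiv
    exact DFunLike.congr_fun h3 v
  refine ⟨F', ⟨⟨?_, ?_⟩, ?_, Ioo (-b) b, Ioo (-b) b, ordConnected_Ioo, ordConnected_Ioo, htgt, ?_⟩,
    ?_, hsub, ?_⟩
  · exact (((shear d s).contDiff.contMDiff (n := ∞)).comp_contMDiffOn (hsm.1.mono hsub)).congr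
      fun y _ => rfl
  · refine (hsm.2.comp ((shear d s).symm.contDiff.contMDiff (n := ∞)).contMDiffOn ?_).congr
      fun y _ => rfl
    intro z hz
    exact hUt z (htgt ▸ hz)
  · intro y hy u v
    rw [hd y hy, hd y hy, ← hom y (hsub hy)]
    simp only [shear_apply, stdForm_eq, WithLp.ofLp_sub, WithLp.ofLp_smul,
      dotProduct_sub, sub_dotProduct, dotProduct_smul, smul_dotProduct]
    ring
  · intro y hy
    have hyF := hsub hy
    have hyU := ((hsrc y).1 hy).2
    ext z
    constructor
    · rintro ⟨y', ⟨h1, h2⟩, rfl⟩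
      have h3 : F y' ∈ ({(F y).1} : Set (Rn d)) ×ˢ box d J := by
        rw [← hfib y hyF]
        exact ⟨y', ⟨h1, hsub h2⟩, rfl⟩
      exact ⟨h3.1, ((hsrc y').1 h2).2.2⟩
    · rintro ⟨h1, h2⟩
      have h1' : z.1 = (F y).1 := h1
      have hzU : z ∈ U := ⟨by rw [h1']; exact hyU.1, h2⟩
      have h3 : (shear d s).symm z ∈ ({(F y).1} : Set (Rn d)) ×ˢ box d J := by
        have := hUt z hzU
        rw [hIJ] at this
        exact ⟨h1', this.2⟩
      rw [← hfib y hyF] at h3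
      obtain ⟨y', ⟨h4, h5⟩, h6⟩ := h3
      have h7 : F' y' = z := by
        rw [hF', h6, ContinuousLinearEquiv.apply_symm_apply]
      exact ⟨y', ⟨h4, (hsrc y').2 ⟨h5, by rw [← hF', h7]; exact hzU⟩⟩, h7⟩
  · rw [hsrc, hFx, map_zero]
    exact ⟨hx, fun i => ⟨by simpa using hb0, by simpa using hb0⟩,
      fun i => ⟨by simpa using hb0, by simpa using hb0⟩⟩
  · intro y hy v
    rw [qC_apply, pC_apply, hd y hy, shear_apply]
    exact ⟨rfl, rfl⟩

/-- A Lagrangian subspace is the graph of a slope as soon as the momentum coordinates are injective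
on it. -/
lemma exists_isSlope_of_injective (hF : IsVerticallyFoliated F) {L : SubspaceAt d M}
    (hL : L.IsLagrangian) (hx : L.pt ∈ F.source)
    (hinj : ∀ z ∈ L.sub, pC F L.pt z = 0 → z = 0) : ∃ S, IsSlope F L S := by
  let f : L.sub →ₗ[ℝ] (Fin d → ℝ) := pC F L.pt ∘ₗ L.sub.subtype
  have hfi : Function.Injective f := by
    rw [← LinearMap.ker_eq_bot, LinearMap.ker_eq_bot']
    exact fun z hz => Subtype.ext (hinj z z.2 hz)
  have hfs : LinearMap.range f = ⊤ := by
    by_contra hne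
    obtain ⟨r, hr0, hr⟩ : ∃ r : Fin d → ℝ, r ≠ 0 ∧ ∀ p ∈ LinearMap.range f, r ⬝ᵥ p = 0 := by
      obtain ⟨g, hg0, hg⟩ := Submodule.exists_le_ker_of_lt_top _ (lt_top_iff_ne_top.2 hne)
      refine ⟨(dotProductEquiv ℝ (Fin d)).symm g, ?_, fun p hp => ?_⟩
      · simpa using hg0
      · have h1 : dotProductEquiv ℝ (Fin d) ((dotProductEquiv ℝ (Fin d)).symm g) p = 0 := by
          rw [LinearEquiv.apply_symm_apply]
          exact hg hp
        exact h1
    -- The horizontal vector `(r, 0)` is orthogonal to `L`.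
    have hmem : (coordEquiv hF.1 hx).symm (r, 0) ∈ L.sub := by
      refine (hL _).2 fun v hv => ?_
      rw [omega_eq hF hx, qC_symm, pC_symm, zero_dotProduct, sub_zero]
      exact hr _ ⟨⟨v, hv⟩, rfl⟩
    have h0 := hinj _ hmem (pC_symm hF.1 hx _)
    have h1 := qC_symm hF.1 hx (r, 0)
    rw [h0, map_zero] at h1
    exact hr0 h1.symm
  let E : L.sub ≃ₗ[ℝ] (Fin d → ℝ) := LinearEquiv.ofBijective f ⟨hfi, LinearMap.range_eq_top.1 hfs⟩
  refine ⟨LinearMap.toMatrix' (qC F L.pt ∘ₗ L.sub.subtype ∘ₗ E.symm.toLinearMap), hx, fun z => ?_⟩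
  rw [LinearMap.toMatrix'_mulVec]
  constructor
  · intro hz
    have h1 : E ⟨z, hz⟩ = pC F L.pt z := rfl
    change _ = qC F L.pt (E.symm (pC F L.pt z))
    rw [← h1, LinearEquiv.symm_apply_apply]
  · intro hz
    have h1 : pC F L.pt (E.symm (pC F L.pt z)) = pC F L.pt z := E.apply_symm_apply _
    have h2 : z = E.symm (pC F L.pt z) := eq_of_coords hF.1 hx hz h1.symm
    rw [h2]
    exact (E.symm (pC F L.pt z)).2

/-- Every Lagrangian subspace is transverse to the horizontal foliation of some chart that is
obtained from a given cubic chart by a nonnegative shear. -/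
lemma IsCubicChartAt.exists_isSlope {L : SubspaceAt d M} (h : IsCubicChartAt F L.pt a)
    (ha : 0 < a) (hL : L.IsLagrangian) :
    ∃ (F' : OpenPartialHomeomorph (Cot d M) (Rn d × Rn d)) (s : ℝ) (S : _), 0 ≤ s ∧
      IsVerticallyFoliated F' ∧ F'.source ⊆ F.source ∧ 
      (∀ y ∈ F'.source, ∀ v : TCot y, qC F' y v = qC F y v ∧ pC F' y v = pC F y v - s • qC F y v) ∧
        IsSlope F' L S := by
  -- Among `d + 1` different shears there is one that works: the position parts of vectors of `L`
  -- that become horizontal after different shears are orthogonal.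
  obtain ⟨k, hk⟩ : ∃ k : Fin (d + 1), ∀ z ∈ L.sub,
      pC F L.pt z = (k : ℝ) • qC F L.pt z → z = 0 := by
    by_contra! hno
    choose z hz hpz hz0 using hno
    have hq0 : ∀ k, (dChart F L.pt (z k)).1 ≠ 0 := by
      intro k h0
      have h1 : qC F L.pt (z k) = 0 := by
        rw [qC_apply, h0]
        rfl
      have h2 := hpz k
      rw [h1, smul_zero] at h2
      exact hz0 k (eq_of_coords h.1.1 h.2.1 (h1.trans (map_zero _).symm)
        (h2.trans (map_zero _).symm))
    have horth : Pairwise fun k l =>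
        inner ℝ (dChart F L.pt (z k)).1 (dChart F L.pt (z l)).1 = 0 := by
      intro k l hkl
      have h1 := hL.isotropic _ (hz k) _ (hz l)
      rw [omega_eq h.1 h.2.1, hpz, hpz, dotProduct_smul, smul_dotProduct, ← sub_smul] at h1
      have h2 : ((l : ℝ) - k) ≠ 0 := by
        rw [sub_ne_zero]
        intro h'
        exact hkl (Fin.ext (by exact_mod_cast h'.symm))
      have h3 := (smul_eq_zero.1 h1).resolve_left h2
      rw [EuclideanSpace.inner_eq_star_dotProduct, dotProduct_comm]
      exact h3
    have := (linearIndependent_of_ne_zero_of_inner_eq_zero hq0 horth).fintype_card_le_finrank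
    rw [finrank_euclideanSpace, Fintype.card_fin, Fintype.card_fin] at this
    omega
  obtain ⟨F', hF', hx', hsub, hqp⟩ := h.exists_shear ha (s := (k : ℝ)) (Nat.cast_nonneg _)
  obtain ⟨S, hS⟩ := exists_isSlope_of_injective hF' hL hx' fun z hz h0 => by
    refine hk z hz ?_
    rw [(hqp _ hx' z).2] at h0
    exact sub_eq_zero.1 h0
  exact ⟨F', k, S, Nat.cast_nonneg _, hF', hsub, hqp, hS⟩

end Shear

/-! ### The twist condition excludes positive crossings -/

section Twist

/-- The gradient of a concave function is a monotone decreasing operator. -/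
lemma inner_gradient_sub_nonpos {E : Type*} [NormedAddCommGroup E] [InnerProductSpace ℝ E]
    [CompleteSpace E] {g : E → ℝ} {s : Set E} (hg : ConvexOn ℝ s (-g)) {p y : E} (hp : p ∈ s)
    (hy : y ∈ s) (hdp : DifferentiableAt ℝ g p) (hdy : DifferentiableAt ℝ g y) :
    inner ℝ (gradient g y - gradient g p) (y - p) ≤ 0 := by
  have hc := (hg.comp_affineMap (AffineMap.lineMap (k := ℝ) p y))
  have h0 : (0 : ℝ) ∈ AffineMap.lineMap (k := ℝ) p y ⁻¹' s := by simpa using hp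
  have h1 : (1 : ℝ) ∈ AffineMap.lineMap (k := ℝ) p y ⁻¹' s := by simpa using hy
  have hd : ∀ r : ℝ, DifferentiableAt ℝ g (AffineMap.lineMap p y r) →
      HasDerivAt (-g ∘ AffineMap.lineMap (k := ℝ) p y)
        (-inner ℝ (gradient g (AffineMap.lineMap p y r)) (y - p)) r := by
    intro r hr
    have h2 := hr.hasGradientAt.hasFDerivAt.neg.comp_hasDerivAt r
      (AffineMap.hasDerivAt_lineMap (a := p) (b := y) (x := r))
    exact h2
  have e0 := hd 0 (by simpa using hdp)
  have e1 := hd 1 (by simpa using hdy)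
  have h3 := hc.le_slope_of_hasDerivAt h0 h1 one_pos e0
  have h4 := hc.slope_le_of_hasDerivAt h0 h1 one_pos e1
  rw [AffineMap.lineMap_apply_zero] at h3
  rw [AffineMap.lineMap_apply_one] at h4
  rw [inner_sub_left]
  linarith

/-- The two components of the velocity of a curve in a monotone decreasing relation have a
nonpositive inner product. -/
lemma inner_deriv_nonpos {E : Type*} [NormedAddCommGroup E] [InnerProductSpace ℝ E]
    {z : ℝ → E × E} {z' : E × E} (hz : HasDerivAt z z' 0)
    (h : ∀ᶠ s in 𝓝 0, inner ℝ ((z s).1 - (z 0).1) ((z s).2 - (z 0).2) ≤ 0) :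
    inner ℝ z'.1 z'.2 ≤ 0 := by
  have h1 := hasDerivAt_iff_tendsto_slope.1 hz
  have h2 : Tendsto (fun s => inner ℝ (slope z 0 s).1 (slope z 0 s).2) (𝓝[≠] 0)
      (𝓝 (inner ℝ z'.1 z'.2)) :=
    (continuous_inner.tendsto (z'.1, z'.2)).comp h1
  refine le_of_tendsto h2 ?_
  filter_upwards [h.filter_mono nhdsWithin_le_nhds] with s hs
  rw [slope_def_module, Prod.smul_fst, Prod.smul_snd, real_inner_smul_left, real_inner_smul_right,
    ← mul_assoc]
  exact mul_nonpos_of_nonneg_of_nonpos (mul_self_nonneg _) hs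

variable {d : ℕ} {M : Type*} [TopologicalSpace M] [ChartedSpace (Rn d) M]
  [IsManifold 𝓘(ℝ, Rn d) ∞ M]
  {φ : ℝ → Diffeomorph (JCot d) (JCot d) (Cot d M) (Cot d M) ∞}

/-- In a twist chart, the images at earlier times of the vertical at time `t₁` have nonpositive
slopes. -/
lemma TwistsVertical.exists_chart (h : TwistsVertical φ) (t₁ : ℝ) (x₀ : Cot d M) :
    ∃ ε > 0, ∃ a > 0, ∃ F : OpenPartialHomeomorph (Cot d M) (Rn d × Rn d),
      IsCubicChartAt F (φ t₁ x₀) a ∧ ∀ t ∈ Ioc (t₁ - ε) t₁, φ t x₀ ∈ F.source ∧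
        ∀ u : TCot x₀, mfderiv (JCot d) (JCot d) (φ t₁) x₀ u ∈ vert (φ t₁ x₀) →
          pC F (φ t x₀) (mfderiv (JCot d) (JCot d) (φ t) x₀ u) ⬝ᵥ
            qC F (φ t x₀) (mfderiv (JCot d) (JCot d) (φ t) x₀ u) ≤ 0 := by
  obtain ⟨ε, hε, a, ha, F, hF, hx₁, hF0, htgt, htw⟩ := h t₁ (φ t₁ x₀)
  refine ⟨ε, hε, a, ha, F, ⟨hF, hx₁, hF0, htgt⟩, fun t ht => ?_⟩
  obtain ⟨G, hG, hGs, D, g, hD, hg, hgraph, -, hconc⟩ :=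
    htw t ⟨ht.1, ht.2.trans_lt (by linarith)⟩
  replace hconc := hconc ht.2
  have hbox : ∀ p ∈ box d (Ioo (-(a / 2)) (a / 2)),
      φ t ((φ t₁).symm (F.symm (0, p))) ∈ G := by
    intro p hp
    rw [hG]
    exact ⟨_, ⟨(0, p), ⟨rfl, hp⟩, rfl⟩, rfl⟩
  have h0box : (0 : Rn d) ∈ box d (Ioo (-(a / 2)) (a / 2)) := fun i =>
    ⟨by simpa using ha, by simpa using ha⟩
  have hinv : F.symm 0 = φ t₁ x₀ := by rw [← hF0, F.left_inv hx₁]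
  have hinv' : (φ t₁).symm (F.symm 0) = x₀ := by rw [hinv, Diffeomorph.symm_apply_apply]
  have hsrc : φ t x₀ ∈ F.source := by
    have := hGs (hbox 0 h0box)
    have h00 : ((0, 0) : Rn d × Rn d) = 0 := rfl
    rwa [h00, hinv'] at this
  refine ⟨hsrc, fun u hu => ?_⟩
  have hm := hF.1.mdifferentiable
  -- The map `φ_t ∘ φ_{t₁}⁻¹` in the chart.
  let K : Rn d × Rn d → Rn d × Rn d := fun z => F (φ t ((φ t₁).symm (F.symm z)))
  have hKd : DifferentiableAt ℝ K 0 := by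
    rw [← mdifferentiableAt_iff_differentiableAt]
    have h1 : MDifferentiableAt 𝓘(ℝ, Rn d × Rn d) (JCot d) F.symm 0 := by
      have := hm.mdifferentiableAt_symm (F.map_source hx₁)
      rwa [hF0] at this
    have h2 : MDifferentiableAt (JCot d) (JCot d) (φ t₁).symm (F.symm 0) :=
      (φ t₁).symm.mdifferentiable (by simp) _
    have h3 : MDifferentiableAt (JCot d) (JCot d) (φ t) ((φ t₁).symm (F.symm 0)) :=
      (φ t).mdifferentiable (by simp) _
    have h4 : MDifferentiableAt (JCot d) 𝓘(ℝ, Rn d × Rn d) F (φ t ((φ t₁).symm (F.symm 0))) := by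
      rw [hinv']
      exact hm.mdifferentiableAt hsrc
    exact h4.comp 0 (h3.comp 0 (h2.comp 0 h1))
  have hchain : ∀ v : TCot x₀, fderiv ℝ K 0 (dChart F (φ t₁ x₀)
      (mfderiv (JCot d) (JCot d) (φ t₁) x₀ v)) =
        dChart F (φ t x₀) (mfderiv (JCot d) (JCot d) (φ t) x₀ v) := by
    have h1 : ∀ r : ℝ, MDifferentiableAt (JCot d) (JCot d) (φ r) x₀ := fun r =>
      (φ r).mdifferentiable (by simp) _
    have h2 := (hm.mdifferentiableAt hx₁).hasMFDerivAt.comp x₀ (h1 t₁).hasMFDerivAt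
    have h3 := (hm.mdifferentiableAt hsrc).hasMFDerivAt.comp x₀ (h1 t).hasMFDerivAt
    have h4 : HasMFDerivAt 𝓘(ℝ, Rn d × Rn d) 𝓘(ℝ, Rn d × Rn d) K ((F ∘ φ t₁) x₀)
        (fderiv ℝ K 0) := by
      have : (F ∘ φ t₁) x₀ = 0 := hF0
      rw [this]
      exact hKd.hasFDerivAt.hasMFDerivAt
    have h5 : F ∘ φ t =ᶠ[𝓝 x₀] K ∘ F ∘ φ t₁ := by
      have h6 : ∀ᶠ y in 𝓝 x₀, φ t₁ y ∈ F.source :=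
        (φ t₁).continuous.continuousAt.eventually (F.open_source.mem_nhds hx₁)
      filter_upwards [h6] with y hy
      simp only [K, Function.comp, F.left_inv hy, Diffeomorph.symm_apply_apply]
    have h7 := hasMFDerivAt_unique h3 ((h4.comp x₀ h2).congr_of_eventuallyEq h5)
    exact fun v => (DFunLike.congr_fun h7 v).symm
  set w := dChart F (φ t₁ x₀) (mfderiv (JCot d) (JCot d) (φ t₁) x₀ u) with hw
  have hw1 : w.1 = 0 := by
    have h1 := (mem_vert_iff hF hx₁ _).1 hu
    exact WithLp.ofLp_injective 2 h1
  have hz : HasDerivAt (fun s : ℝ => K (s • w)) (fderiv ℝ K 0 w) 0 := by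
    have h1 : HasDerivAt (fun s : ℝ => s • w) w 0 := by
      simpa using (hasDerivAt_id (0 : ℝ)).smul_const w
    have h2 : HasFDerivAt K (fderiv ℝ K 0) ((0 : ℝ) • w) := by
      rw [zero_smul]
      exact hKd.hasFDerivAt
    exact h2.comp_hasDerivAt 0 h1
  -- The curve `s ↦ K (s • w)` runs in the graph of the gradient of the concave function `g`.
  have hmemb : ∀ᶠ s in 𝓝 (0 : ℝ),
      K (s • w) ∈ {z : Rn d × Rn d | z.2 ∈ D ∧ z.1 = gradient g z.2} := by
    have h1 : ∀ᶠ s in 𝓝 (0 : ℝ), s • w.2 ∈ box d (Ioo (-(a / 2)) (a / 2)) := by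
      have hc : Continuous fun s : ℝ => s • w.2 := by fun_prop
      refine hc.continuousAt.eventually ((isOpen_box d isOpen_Ioo).mem_nhds ?_)
      change (0 : ℝ) • w.2 ∈ _
      rwa [zero_smul]
    filter_upwards [h1] with s hs
    change K (s • w) ∈ {z : Rn d × Rn d | z.2 ∈ D ∧ z.1 = gradient g z.2}
    rw [← hgraph]
    have h2 : s • w = (0, s • w.2) := Prod.ext (by simp [hw1]) rfl
    rw [h2]
    exact ⟨_, hbox _ hs, rfl⟩
  have hmem0 := hmemb.self_of_nhds
  obtain ⟨r, hr, hrD, hrc⟩ := hconc _ hmem0.1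
  have hball : ∀ᶠ s in 𝓝 (0 : ℝ), (K (s • w)).2 ∈ Metric.ball (K ((0 : ℝ) • w)).2 r :=
    (continuous_snd.continuousAt.comp hz.continuousAt).eventually (Metric.ball_mem_nhds _ hr)
  have hdiff : ∀ p ∈ D, DifferentiableAt ℝ g p := fun p hp => hg.differentiableAt (hD.mem_nhds hp)
  have hle := inner_deriv_nonpos hz (by
    filter_upwards [hmemb, hball] with s h1 h2
    rw [h1.2, hmem0.2]
    exact inner_gradient_sub_nonpos hrc (Metric.mem_ball_self hr) h2 (hdiff _ hmem0.1)
      (hdiff _ h1.1))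
  rw [hw, hchain u, EuclideanSpace.inner_eq_star_dotProduct] at hle
  exact hle

lemma TwistsVertical.exists_mem_source (h : TwistsVertical φ) (x : Cot d M) :
    ∃ F, IsVerticallyFoliated F ∧ x ∈ F.source := by
  obtain ⟨-, -, -, -, F, hF, hx, -⟩ := h 0 x
  exact ⟨F, hF, hx⟩

lemma TwistsVertical.exists_isSlope (h : TwistsVertical φ) {L : SubspaceAt d M}
    (hL : L.IsLagrangian) : ∃ F S, IsVerticallyFoliated F ∧ IsSlope F L S := by
  obtain ⟨-, -, a, ha, F, hF, hx, h0, ht, -⟩ := h 0 L.pt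
  obtain ⟨F', -, S, -, hF', -, -, hS⟩ := IsCubicChartAt.exists_isSlope ⟨hF, hx, h0, ht⟩ ha hL
  exact ⟨F', S, hF', hS⟩

lemma TwistsVertical.exists_basis (h : TwistsVertical φ) {L : SubspaceAt d M}
    (hL : L.IsLagrangian) :
    ∃ w : Fin d → TCot L.pt, LinearIndependent ℝ w ∧ Submodule.span ℝ (range w) = L.sub := by
  obtain ⟨F, S, hF, hS⟩ := h.exists_isSlope hL
  exact hS.exists_basis hF.1

lemma isContFrame_dynFrame (hφ : IsConformallySymplecticIsotopy φ) (h : TwistsVertical φ)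
    {L : SubspaceAt d M} (hL : L.IsLagrangian) {w : Fin d → TCot L.pt}
    (hw : LinearIndependent ℝ w) (hs : Submodule.span ℝ (range w) = L.sub) (s : Set ℝ) :
    IsContFrame s (dynFrame φ w) (dynPath φ L) where
  lagrangian t _ := isLagrangian_dynPath hφ h.exists_mem_source hL t
  continuousOn_pt := (contMDiff_dynPath_pt hφ L).continuous.continuousOn
  continuousOn := continuousOn_pi.2 fun i => (contMDiff_dynFrame hφ w i).continuous.continuousOn
  frame t _ := isFrameOf_dynFrame hw hs t

/-- A dynamical path has no positive crossing: its slope `S` in a sheared twist chart is compared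
with the nonpositive slope `R` of the image of the vertical, and the rank of `S - R` is constant. -/
lemma not_isPositiveCrossing_dynPath (hφ : IsConformallySymplecticIsotopy φ)
    (h : TwistsVertical φ) {L : SubspaceAt d M} (hL : L.IsLagrangian) (t₁ : ℝ) :
    ¬ IsPositiveCrossing (dynPath φ L) t₁ := by
  intro hcross
  obtain ⟨ε, hε, a, ha, F, hcub, hneg⟩ := h.exists_chart t₁ L.pt
  have hLag := isLagrangian_dynPath hφ h.exists_mem_source hL
  obtain ⟨F', s, S₁, hs, hF', hsub, hqp, hS₁⟩ := IsCubicChartAt.exists_isSlope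
    (L := dynPath φ L t₁) hcub ha (hLag t₁)
  have hA : ∀ t, Function.Bijective (mfderiv (JCot d) (JCot d) (φ t) L.pt) := fun t =>
    ((φ t).mfderivToContinuousLinearEquiv (by simp) L.pt).bijective
  -- `U` is the subspace that is vertical at time `t₁`.
  let U : SubspaceAt d M :=
    ⟨L.pt, (vert (φ t₁ L.pt)).comap (mfderiv (JCot d) (JCot d) (φ t₁) L.pt).toLinearMap⟩
  have hUmem : ∀ u, u ∈ U.sub ↔ mfderiv (JCot d) (JCot d) (φ t₁) L.pt u ∈ vert (φ t₁ L.pt) :=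
    fun u => Iff.rfl
  have hU : U.IsLagrangian := by
    obtain ⟨c, hc, hconf⟩ := exists_conformal_factor_ne_zero h.exists_mem_source (φ t₁) (hφ.2 t₁)
    have hV : (⟨φ t₁ L.pt, vert (φ t₁ L.pt)⟩ : SubspaceAt d M).IsLagrangian :=
      (isSlope_vert hF' hS₁.1).isLagrangian hF' Matrix.isSymm_zero
    intro u
    rw [hUmem, hV]
    constructor
    · intro h1 v hv
      have h2 := h1 _ hv
      exact (mul_eq_zero.1 ((hconf L.pt u v).symm.trans h2)).resolve_left hc
    · intro h1 v hv
      obtain ⟨v', rfl⟩ := (hA t₁).2 v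
      exact (hconf L.pt u v').trans (by rw [h1 v' hv, mul_zero])
  obtain ⟨w, hw, hws⟩ := h.exists_basis hL
  obtain ⟨b, hb, hbs⟩ := h.exists_basis hU
  have hfL := isContFrame_dynFrame hφ h hL hw hws univ
  have hfU := isContFrame_dynFrame hφ h hU hb hbs univ
  have hR₁ : IsSlope F' (dynPath φ U t₁) 0 := by
    refine ⟨hS₁.1, fun z => ?_⟩
    have h1 := (isSlope_vert hF' (x := φ t₁ L.pt) hS₁.1).2 z
    refine Iff.trans ?_ h1
    constructor
    · rintro ⟨u, hu, rfl⟩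
      exact hu
    · intro hz
      obtain ⟨u, rfl⟩ := (hA t₁).2 z
      exact ⟨u, hz, rfl⟩
  obtain ⟨S, hS0, hSc, hSs⟩ := hfL.exists_slope_near (mem_univ t₁) hF' hS₁
  obtain ⟨R, hR0, hRc, hRs⟩ := hfU.exists_slope_near (mem_univ t₁) hF' hR₁
  -- The kernel of `S t - R t` corresponds to `L ⊓ U`.
  have hrank : ∀ t, IsSlope F' (dynPath φ L t) (S t) → IsSlope F' (dynPath φ U t) (R t) →
      Module.finrank ℝ (LinearMap.ker (S t - R t).mulVecLin) =
        Module.finrank ℝ (L.sub ⊓ U.sub : Submodule ℝ (TCot L.pt)) := by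
    intro t h1 h2
    rw [← IsSlope.finrank_inf (x := φ t L.pt) hF'.1 h1 h2]
    change Module.finrank ℝ (Submodule.map _ L.sub ⊓ Submodule.map _ U.sub : Submodule ℝ _) = _
    rw [← Submodule.map_inf _ (hA t).1]
    exact ((Submodule.equivMapOfInjective _ (hA t).1 _).finrank_eq).symm
  have hlow : ∀ᶠ t in 𝓝[univ] t₁, negIndex S₁ ≤ negIndex (S t - R t) := by
    have h1 := (hSc.sub hRc).eventually (p := fun H => negIndex S₁ ≤ negIndex H)
    rw [Pi.sub_apply, hS0, hR0, sub_zero] at h1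
    exact h1 (eventually_negIndex_ge S₁)
  rw [nhdsWithin_univ] at hSs hRs hlow
  -- At a time `t < t₁` close to `t₁`, a positive crossing would give an index of `S t` larger than
  -- that of `S₁`, whereas it is at most the index of `S t - R t`, which is that of `S₁`.
  have hpos := (hfL.of_isPositiveCrossing univ_mem hF' hS₁ hcross).1
  have hI : ∀ᶠ t in 𝓝[<] t₁, t ∈ Ioo (t₁ - ε) t₁ := Ioo_mem_nhdsLT (by linarith)
  obtain ⟨t, e1, e2, e3, e4, e5⟩ := (hpos.and (hI.and ((hSs.filter_mono nhdsWithin_le_nhds).and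
    ((hRs.filter_mono nhdsWithin_le_nhds).and (hlow.filter_mono nhdsWithin_le_nhds))))).exists
  have hSsym := e3.isSymm hF' (hfL.lagrangian t trivial).isotropic
  have hRsym := e4.isSymm hF' (hfU.lagrangian t trivial).isotropic
  -- The shear by `s ≥ 0` preserves the sign of the slope.
  have hRneg : ∀ p, p ⬝ᵥ R t *ᵥ p ≤ 0 := by
    intro p
    obtain ⟨u, hu, hup⟩ := e4.mem hF'.1 p
    have h1 := (hneg t ⟨e2.1, e2.2.le⟩).2 u hu
    have h2 := hqp (φ t L.pt) e4.1 (mfderiv (JCot d) (JCot d) (φ t) L.pt u)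
    have h3 : qC F' (φ t L.pt) (mfderiv (JCot d) (JCot d) (φ t) L.pt u) = R t *ᵥ p :=
      (congrArg _ hup).trans (qC_symm hF'.1 e4.1 _)
    have h4 : pC F' (φ t L.pt) (mfderiv (JCot d) (JCot d) (φ t) L.pt u) = p :=
      (congrArg _ hup).trans (pC_symm hF'.1 e4.1 _)
    have h5 := h2.1.symm.trans h3
    have h6 := sub_eq_iff_eq_add.1 (h2.2.symm.trans h4)
    rw [h6, h5, add_dotProduct, smul_dotProduct, smul_eq_mul] at h1
    have h7 : 0 ≤ s * (R t *ᵥ p ⬝ᵥ R t *ᵥ p) := mul_nonneg hs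
      (Finset.sum_nonneg fun i _ => mul_self_nonneg _)
    linarith
  have hmono : posIndex (S t) ≤ posIndex (S t - R t) := by
    refine posIndex_mono fun u => ?_
    rw [Matrix.sub_mulVec, dotProduct_sub]
    have := hRneg u
    linarith
  have h1 := posIndex_add_negIndex (hSsym.sub hRsym)
  have h2 := posIndex_add_negIndex (hS₁.isSymm hF' (hfL.lagrangian t₁ trivial).isotropic)
  have h3 := hrank t e3 e4
  have h4 := hrank t₁ (by rwa [hS0]) (by rwa [hR0])
  rw [hS0, hR0, sub_zero] at h4
  have h5 := e1 _ e3
  omega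

end Twist

/-! ### Simple zeros and crossings -/

section SimpleCrossings

lemma differentiableAt_inv_apply {n : Type*} [Fintype n] [DecidableEq n] {A : ℝ → Matrix n n ℝ}
    {t : ℝ} (hA : ∀ i j, DifferentiableAt ℝ (fun s => A s i j) t) (hd : (A t).det ≠ 0) (i j : n) :
    DifferentiableAt ℝ (fun s => (A s)⁻¹ i j) t := by
  have h1 : (fun s => (A s)⁻¹ i j) =
      fun s => ((A s).det)⁻¹ * ((A s).updateRow j (Pi.single i 1)).det := by
    ext s
    rw [Matrix.inv_def, Ring.inverse_eq_inv', Matrix.smul_apply, Matrix.adjugate_apply, smul_eq_mul]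
  rw [h1]
  refine ((differentiableAt_det hA).inv hd).mul (differentiableAt_det fun k l => ?_)
  by_cases hk : k = j
  · subst hk
    simp only [Matrix.updateRow_self]
    exact differentiableAt_const _
  · simp only [Matrix.updateRow_ne hk]
    exact hA k l

lemma differentiableAt_mul_apply {n : Type*} [Fintype n] {A B : ℝ → Matrix n n ℝ} {t : ℝ}
    (hA : ∀ i j, DifferentiableAt ℝ (fun s => A s i j) t)
    (hB : ∀ i j, DifferentiableAt ℝ (fun s => B s i j) t) (i j : n) :
    DifferentiableAt ℝ (fun s => (A s * B s) i j) t := by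
  simp only [Matrix.mul_apply]
  exact DifferentiableAt.fun_sum fun k _ => (hA i k).mul (hB k j)

/-- Having only simple zeros on a compact set is stable under `C^1`-small perturbations. -/
lemma eventually_hasSimpleDetZeros {W n : Type*} [TopologicalSpace W] [Fintype n] [DecidableEq n]
    {w₀ : W} {I : Set ℝ} (hI : IsCompact I) {A A' : W → ℝ → Matrix n n ℝ}
    (hA : ∀ w, ∀ t ∈ I, ∀ i j, HasDerivAt (fun s => A w s i j) (A' w t i j) t)
    (hc : ∀ t ∈ I, ContinuousAt (fun z : W × ℝ => A z.1 z.2) (w₀, t))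
    (hc' : ∀ t ∈ I, ContinuousAt (fun z : W × ℝ => A' z.1 z.2) (w₀, t))
    (h : HasSimpleDetZeros I (A w₀)) : ∀ᶠ w in 𝓝 w₀, HasSimpleDetZeros I (A w) := by
  let D : W → ℝ → ℝ := fun w t => ∑ i, ((A w t).updateRow i fun j => A' w t i j).det
  have hD : ∀ w, ∀ t ∈ I, deriv (fun s => (A w s).det) t = D w t := by
    intro w t ht
    rw [(hasDerivAt_det fun i j => (hA w t ht i j).differentiableAt).deriv]
    refine Finset.sum_congr rfl fun i _ => ?_
    simp only [(hA w t ht _ _).deriv]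
  -- At each time the determinant or its derivative is nonzero, which is an open condition.
  have key : ∀ᶠ w in 𝓝 w₀, ∀ t ∈ I, (A w t).det ≠ 0 ∨ D w t ≠ 0 := by
    refine hI.eventually_forall_of_forall_eventually fun t ht => ?_
    by_cases h0 : (A w₀ t).det = 0
    · have h1 := h t ht h0
      rw [hD w₀ t ht] at h1
      have h2 : ContinuousAt (fun z : W × ℝ => D z.1 z.2) (w₀, t) := by
        refine tendsto_finsetSum _ fun i _ => ?_
        have h3 : Continuous fun B : Matrix n n ℝ × Matrix n n ℝ =>
            (B.1.updateRow i fun j => B.2 i j).det :=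
          (continuous_fst.matrix_updateRow i
            (continuous_pi fun j => (continuous_apply_apply i j).comp continuous_snd)).matrix_det
        exact h3.continuousAt.comp ((hc t ht).prodMk (hc' t ht))
      exact (h2.eventually_ne h1).mono fun z hz => Or.inr hz
    · have h2 : ContinuousAt (fun z : W × ℝ => (A z.1 z.2).det) (w₀, t) :=
        (continuous_id.matrix_det).continuousAt.comp (hc t ht)
      exact (h2.eventually_ne h0).mono fun z hz => Or.inl hz
  filter_upwards [key] with w hw t ht h0
  rw [hD w t ht]
  exact (hw t ht).resolve_left fun h' => h' h0

variable {d : ℕ} {M : Type*} [TopologicalSpace M] [ChartedSpace (Rn d) M]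
  [IsManifold 𝓘(ℝ, Rn d) ∞ M]

/-- The path crosses the singular cycle, positively or negatively, at the simple zeros of the
determinant of the position coordinates of a frame. -/
lemma IsContFrame.isCrossing_of_simple_zero {s : Set ℝ} {e : ℝ → Fin d → TTCot d M}
    {Γ : ℝ → SubspaceAt d M} {t₀ : ℝ} {F : OpenPartialHomeomorph (Cot d M) (Rn d × Rn d)}
    (h : IsContFrame s e Γ) (hs : s ∈ 𝓝 t₀) (hF : IsVerticallyFoliated F)
    (hx : (Γ t₀).pt ∈ F.source) (hP : (pMat F (e t₀)).det ≠ 0)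
    (hq : ∀ i j, DifferentiableAt ℝ (fun t => qMat F (e t) i j) t₀)
    (hp : ∀ i j, DifferentiableAt ℝ (fun t => pMat F (e t) i j) t₀)
    (h0 : (qMat F (e t₀)).det = 0) (hd : deriv (fun t => (qMat F (e t)).det) t₀ ≠ 0) :
    IsPositiveCrossing Γ t₀ ∨ IsNegativeCrossing Γ t₀ := by
  have ht₀ := mem_of_mem_nhds hs
  have hS := (h.frame t₀ ht₀).isSlope hF.1 hx hP
  obtain ⟨S, hS0, hSc, hSs⟩ := h.exists_slope_near ht₀ hF hS
  rw [nhdsWithin_eq_nhds.2 hs] at hSs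
  have hev : ∀ᶠ t in 𝓝 t₀, S t = qMat F (e t) * (pMat F (e t))⁻¹ := by
    filter_upwards [hSs, hs] with t h1 h2
    exact h1.eq_qMat_mul hF.1 (h.frame t h2)
  have hsym : ∀ᶠ t in 𝓝 t₀, (S t).IsSymm := by
    filter_upwards [hSs, hs] with t h1 h2
    exact h1.isSymm hF (h.lagrangian t h2).isotropic
  have hdet : HasDerivAt (fun t => (S t).det)
      (deriv (fun t => (qMat F (e t)).det) t₀ * ((pMat F (e t₀)).det)⁻¹) t₀ := by
    have h1 := (differentiableAt_det hq).hasDerivAt.mul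
      ((differentiableAt_det hp).inv hP).hasDerivAt
    simp only [h0, zero_mul, add_zero, Pi.inv_apply] at h1
    refine h1.congr_of_eventuallyEq ?_
    filter_upwards [hev] with t ht
    rw [ht, Matrix.det_mul, Matrix.det_nonsing_inv, Ring.inverse_eq_inv']
    rfl
  have hk : Module.finrank ℝ (LinearMap.ker (S t₀).mulVecLin) = 1 := by
    have h1 := finrank_ker_eq_one hq hd h0
    have h2 := LinearMap.finrank_range_add_finrank_ker (qMat F (e t₀)).mulVecLin
    have h3 := LinearMap.finrank_range_add_finrank_ker (S t₀).mulVecLin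
    have h4 : (S t₀).rank = (qMat F (e t₀)).rank := by
      rw [hS0]
      refine Matrix.rank_mul_eq_left_of_isUnit_det _ _ ?_
      rw [Matrix.det_nonsing_inv, Ring.inverse_eq_inv']
      exact isUnit_iff_ne_zero.2 (inv_ne_zero hP)
    rw [Matrix.rank, Matrix.rank] at h4
    omega
  have hdet0 : (S t₀).det = 0 := by
    rw [hS0, Matrix.det_mul, h0, zero_mul]
  obtain ⟨hne, hcase⟩ := posIndex_jump hsym (hSc.continuousAt hs) hdet
    (mul_ne_zero hd (inv_ne_zero hP)) hdet0 hk
  have hSt : IsSlope F (Γ t₀) (S t₀) := by rwa [hS0]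
  have hreg : (Γ t₀).RegularSingular := (hSt.regularSingular_iff hF).2 hk
  have hidx : HasHeightIndex F (Γ t₀) (posIndex (S t₀)) := (hSt.hasHeightIndex_iff hF _).2 rfl
  have hgood : ∀ {l : Filter ℝ} {n : ℕ}, l ≤ 𝓝[≠] t₀ → (∀ᶠ t in l, posIndex (S t) = n) →
      ∀ᶠ t in l, ¬ (Γ t).Singular ∧ HasHeightIndex F (Γ t) n := by
    intro l n hl hn
    filter_upwards [hn, hne.filter_mono hl, (hSs.filter_mono nhdsWithin_le_nhds).filter_mono hl]
      with t h1 h2 h3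
    exact ⟨fun h4 => h2 ((h3.singular_iff hF).1 h4), (h3.hasHeightIndex_iff hF _).2 h1⟩
  have hleft : 𝓝[<] t₀ ≤ 𝓝[≠] t₀ := nhdsWithin_mono _ fun t ht => ne_of_lt ht
  have hright : 𝓝[>] t₀ ≤ 𝓝[≠] t₀ := nhdsWithin_mono _ fun t ht => ne_of_gt ht
  rcases hcase with ⟨h1, h2⟩ | ⟨h1, h2⟩
  · left
    obtain ⟨a, ha, ha'⟩ := mem_nhdsLT_iff_exists_Ioo_subset.1 (hgood hleft h1)
    obtain ⟨b, hb, hb'⟩ := mem_nhdsGT_iff_exists_Ioo_subset.1 (hgood hright h2)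
    have ha0 : a < t₀ := ha
    have hb0 : t₀ < b := hb
    refine ⟨hreg, F, hF, _, hidx, min (t₀ - a) (b - t₀), lt_min (sub_pos.2 ha) (sub_pos.2 hb),
      fun t ht => ha' ⟨?_, ht.2⟩, fun t ht => hb' ⟨ht.1, ?_⟩⟩
    · linarith [ht.1, min_le_left (t₀ - a) (b - t₀)]
    · linarith [ht.2, min_le_right (t₀ - a) (b - t₀)]
  · right
    obtain ⟨a, ha, ha'⟩ := mem_nhdsLT_iff_exists_Ioo_subset.1 (hgood hleft h1)
    obtain ⟨b, hb, hb'⟩ := mem_nhdsGT_iff_exists_Ioo_subset.1 (hgood hright h2)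
    have ha0 : a < t₀ := ha
    have hb0 : t₀ < b := hb
    refine ⟨by simpa only [neg_neg] using hreg, F, hF, posIndex (S t₀),
      by simpa only [neg_neg] using hidx, min (t₀ - a) (b - t₀),
      lt_min (sub_pos.2 ha) (sub_pos.2 hb), fun t ht => hb' ⟨?_, ?_⟩, fun t ht => ha' ⟨?_, ?_⟩⟩
    · linarith [ht.2]
    · linarith [ht.1, min_le_right (t₀ - a) (b - t₀)]
    · linarith [ht.2, min_le_left (t₀ - a) (b - t₀)]
    · linarith [ht.1]

variable {φ : ℝ → Diffeomorph (JCot d) (JCot d) (Cot d M) (Cot d M) ∞}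
  {F : OpenPartialHomeomorph (Cot d M) (Rn d × Rn d)} {x : Cot d M}

lemma isOpen_setOf_mem_source (hφ : IsConformallySymplecticIsotopy φ) (x : Cot d M)
    (F : OpenPartialHomeomorph (Cot d M) (Rn d × Rn d)) : IsOpen {t : ℝ | φ t x ∈ F.source} := by
  have h : Continuous fun t : ℝ => φ t x :=
    (hφ.1.comp (contMDiff_id.prodMk contMDiff_const)).continuous
  exact F.open_source.preimage h

lemma contDiffOn_chartVec_flowVec (hφ : IsConformallySymplecticIsotopy φ) (hF : IsSmoothChart F)
    (z : TTCot d M) :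
    ContDiffOn ℝ ∞ (fun t => chartVec F (flowVec φ (t, z))) {t | φ t z.proj ∈ F.source} := by
  rw [← contMDiffOn_iff_contDiffOn]
  exact (contMDiffOn_chartVec hF).comp ((contMDiff_flowVec hφ).comp
    (contMDiff_id.prodMk contMDiff_const)).contMDiffOn fun t ht => ht

lemma contDiffOn_qMat_dynFrame (hφ : IsConformallySymplecticIsotopy φ) (hF : IsSmoothChart F)
    (w : Fin d → TCot x) (i j : Fin d) :
    ContDiffOn ℝ ∞ (fun t => qMat F (dynFrame φ w t) i j) {t | φ t x ∈ F.source} := by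
  have h : ContDiff ℝ ∞ fun y : Rn d × Rn d => y.1 i := by fun_prop
  exact h.comp_contDiffOn (contDiffOn_chartVec_flowVec hφ hF ⟨x, w j⟩)

lemma contDiffOn_pMat_dynFrame (hφ : IsConformallySymplecticIsotopy φ) (hF : IsSmoothChart F)
    (w : Fin d → TCot x) (i j : Fin d) :
    ContDiffOn ℝ ∞ (fun t => pMat F (dynFrame φ w t) i j) {t | φ t x ∈ F.source} := by
  have h : ContDiff ℝ ∞ fun y : Rn d × Rn d => y.2 i := by fun_prop
  exact h.comp_contDiffOn (contDiffOn_chartVec_flowVec hφ hF ⟨x, w j⟩)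

lemma differentiableAt_qMat_dynFrame (hφ : IsConformallySymplecticIsotopy φ)
    (hF : IsSmoothChart F) (w : Fin d → TCot x) {t : ℝ} (ht : φ t x ∈ F.source) (i j : Fin d) :
    DifferentiableAt ℝ (fun t => qMat F (dynFrame φ w t) i j) t :=
  ((contDiffOn_qMat_dynFrame hφ hF w i j).differentiableOn (by simp)).differentiableAt
    ((isOpen_setOf_mem_source hφ x F).mem_nhds ht)

lemma differentiableAt_pMat_dynFrame (hφ : IsConformallySymplecticIsotopy φ)
    (hF : IsSmoothChart F) (w : Fin d → TCot x) {t : ℝ} (ht : φ t x ∈ F.source) (i j : Fin d) :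
    DifferentiableAt ℝ (fun t => pMat F (dynFrame φ w t) i j) t :=
  ((contDiffOn_pMat_dynFrame hφ hF w i j).differentiableOn (by simp)).differentiableAt
    ((isOpen_setOf_mem_source hφ x F).mem_nhds ht)

lemma continuous_dynFrame (hφ : IsConformallySymplecticIsotopy φ) (x : Cot d M) :
    Continuous fun z : (Fin d → TCot x) × ℝ => dynFrame φ z.1 z.2 := by
  refine continuous_pi fun i => ?_
  have h5 : Continuous (fun v : TCot x => (⟨x, v⟩ : TTCot d M)) :=
    FiberBundle.continuous_totalSpaceMk _ _ x
  exact (contMDiff_flowVec hφ).continuous.comp (continuous_snd.prodMk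
    (h5.comp ((continuous_apply i).comp continuous_fst)))

/-- Having only simple zeros is an open condition on the initial value of a dynamical frame. -/
lemma eventually_hasSimpleDetZeros_dynFrame (hφ : IsConformallySymplecticIsotopy φ)
    (hF : IsSmoothChart F) {I : Set ℝ} (hI : IsCompact I) (hx : ∀ t ∈ I, φ t x ∈ F.source)
    {w₀ : Fin d → TCot x} (h : HasSimpleDetZeros I fun t => qMat F (dynFrame φ w₀ t)) :
    ∀ᶠ w in 𝓝 w₀, HasSimpleDetZeros I fun t => qMat F (dynFrame φ w t) := by
  let β := Module.finBasis ℝ (TCot x)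
  have : T2Space (TCot x) := inferInstanceAs (T2Space (Rn d × (Rn d →L[ℝ] ℝ)))
  have hcoord : ∀ k, Continuous fun v : TCot x => β.repr v k := fun k =>
    LinearMap.continuous_of_finiteDimensional (β.coord k)
  let f : Fin (Module.finrank ℝ (TCot x)) → Fin d → ℝ → ℝ := fun k i t =>
    (chartVec F (flowVec φ (t, ⟨x, β k⟩))).1 i
  have hO := isOpen_setOf_mem_source hφ x F
  have hf : ∀ k i, ContDiffOn ℝ ∞ (f k i) {t | φ t x ∈ F.source} := by
    intro k i
    have h : ContDiff ℝ ∞ fun y : Rn d × Rn d => y.1 i := by fun_prop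
    exact h.comp_contDiffOn (contDiffOn_chartVec_flowVec hφ hF ⟨x, β k⟩)
  have hq : ∀ w : Fin d → TCot x, ∀ t i j,
      qMat F (dynFrame φ w t) i j = ∑ k, β.repr (w j) k * f k i t := by
    intro w t i j
    have h1 : w j = ∑ k, β.repr (w j) k • β k := (β.sum_repr (w j)).symm
    let T : TCot x →ₗ[ℝ] (Fin d → ℝ) :=
      qC F (φ t x) ∘ₗ (mfderiv (JCot d) (JCot d) (φ t) x).toLinearMap
    have h2 : qMat F (dynFrame φ w t) i j = T (w j) i := rfl
    rw [h2]
    conv_lhs => rw [h1]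
    rw [map_sum, Finset.sum_apply]
    refine Finset.sum_congr rfl fun k _ => ?_
    rw [map_smul]
    rfl
  have hcomb : ∀ (g : Fin (Module.finrank ℝ (TCot x)) → Fin d → ℝ → ℝ) (t : ℝ),
      (∀ k i, ContinuousAt (g k i) t) → ContinuousAt
        (fun z : (Fin d → TCot x) × ℝ => (Matrix.of fun i j =>
          ∑ k, β.repr (z.1 j) k * g k i z.2 : Matrix (Fin d) (Fin d) ℝ)) (w₀, t) := by
    intro g t hg
    refine continuousAt_pi.2 fun i => continuousAt_pi.2 fun j => ?_
    simp only [Matrix.of_apply]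
    refine tendsto_finsetSum _ fun k _ => ?_
    exact ((hcoord k).comp ((continuous_apply j).comp continuous_fst)).continuousAt.mul
      (ContinuousAt.comp (f := Prod.snd) (hg k i) continuousAt_snd)
  refine eventually_hasSimpleDetZeros hI (A := fun w t => qMat F (dynFrame φ w t))
    (A' := fun w t => Matrix.of fun i j => ∑ k, β.repr (w j) k * deriv (f k i) t) ?_ ?_ ?_ h
  · intro w t ht i j
    simp only [hq, Matrix.of_apply]
    refine HasDerivAt.fun_sum fun k _ => HasDerivAt.const_mul _ ?_
    exact (((hf k i).differentiableOn (by simp)).differentiableAt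
      (hO.mem_nhds (hx t ht))).hasDerivAt
  · intro t ht
    have h1 := hcomb f t fun k i => (hf k i).continuousOn.continuousAt (hO.mem_nhds (hx t ht))
    refine h1.congr (Eventually.of_forall fun z => ?_)
    ext i j
    exact (hq z.1 z.2 i j).symm
  · intro t ht
    exact hcomb (fun k i => deriv (f k i)) t fun k i =>
      ((hf k i).continuousOn_deriv_of_isOpen hO (by simp)).continuousAt (hO.mem_nhds (hx t ht))

end SimpleCrossings

/-! ### Dynamical paths in general position -/

section GeneralPosition

variable {d : ℕ} {M : Type*} [TopologicalSpace M] [ChartedSpace (Rn d) M]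
  [IsManifold 𝓘(ℝ, Rn d) ∞ M]
  {φ : ℝ → Diffeomorph (JCot d) (JCot d) (Cot d M) (Cot d M) ∞}
  {F : OpenPartialHomeomorph (Cot d M) (Rn d × Rn d)} {x : Cot d M}

/-- The subspace spanned by tangent vectors at `x`. -/
def spanAt {x : Cot d M} (w : Fin d → TCot x) : SubspaceAt d M := ⟨x, Submodule.span ℝ (range w)⟩

/-- The vectors `w` are a basis of a Lagrangian subspace. -/
def IsLagrangianBasis {x : Cot d M} (w : Fin d → TCot x) : Prop :=
  LinearIndependent ℝ w ∧ (spanAt w).IsLagrangian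

lemma isSlope_dynPath_spanAt (hF : IsSmoothChart F) {w : Fin d → TCot x}
    (hw : LinearIndependent ℝ w) {t : ℝ} (hx : φ t x ∈ F.source)
    (hP : (pMat F (dynFrame φ w t)).det ≠ 0) :
    IsSlope F (dynPath φ (spanAt w) t)
      (qMat F (dynFrame φ w t) * (pMat F (dynFrame φ w t))⁻¹) :=
  (isFrameOf_dynFrame (L := spanAt w) hw rfl t).isSlope hF hx hP

lemma singular_dynPath_spanAt_iff (hF : IsVerticallyFoliated F) {w : Fin d → TCot x}
    (hw : LinearIndependent ℝ w) {t : ℝ} (hx : φ t x ∈ F.source)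
    (hP : (pMat F (dynFrame φ w t)).det ≠ 0) :
    (dynPath φ (spanAt w) t).Singular ↔ (qMat F (dynFrame φ w t)).det = 0 := by
  rw [(isSlope_dynPath_spanAt hF.1 hw hx hP).singular_iff hF, Matrix.det_mul,
    Matrix.det_nonsing_inv, Ring.inverse_eq_inv', mul_eq_zero]
  exact or_iff_left (inv_ne_zero hP)

lemma isLagrangian_of_push {L : SubspaceAt d M}
    (f : Diffeomorph (JCot d) (JCot d) (Cot d M) (Cot d M) ∞) {a : ℝ} (ha : a ≠ 0)
    (hf : ∀ (x : Cot d M) (u v : TCot x),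
      omega (f x) (mfderiv (JCot d) (JCot d) f x u) (mfderiv (JCot d) (JCot d) f x v) =
        a * omega x u v) (hL : (L.push f).IsLagrangian) : L.IsLagrangian := by
  let A := f.mfderivToContinuousLinearEquiv (by simp) L.pt
  have hmem : ∀ u, A u ∈ (L.push f).sub ↔ u ∈ L.sub := by
    intro u
    constructor
    · rintro ⟨v, hv, h⟩
      rwa [← A.injective h]
    · exact fun hu => ⟨u, hu, rfl⟩
  have hA : ∀ u v, omega (f L.pt) (A u) (A v) = a * omega L.pt u v := fun u v => hf L.pt u v
  intro u
  refine (hmem u).symm.trans ((hL (A u)).trans ⟨?_, ?_⟩)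
  · intro h1 v hv
    exact (mul_eq_zero.1 ((hA u v).symm.trans (h1 (A v) ((hmem v).2 hv)))).resolve_left ha
  · rintro h1 _ ⟨v, hv, rfl⟩
    exact (hA u v).trans (by rw [h1 v hv, mul_zero])

/-- The position coordinates of the image of a tangent vector at `x` by the differential of
`φ_t`. -/
def qAt (φ : ℝ → Diffeomorph (JCot d) (JCot d) (Cot d M) (Cot d M) ∞)
    (F : OpenPartialHomeomorph (Cot d M) (Rn d × Rn d)) (t : ℝ) (x : Cot d M) :
    TCot x →ₗ[ℝ] (Fin d → ℝ) :=
  qC F (φ t x) ∘ₗ (mfderiv (JCot d) (JCot d) (φ t) x).toLinearMap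

/-- The momentum coordinates of the image of a tangent vector at `x` by the differential of
`φ_t`. -/
def pAt (φ : ℝ → Diffeomorph (JCot d) (JCot d) (Cot d M) (Cot d M) ∞)
    (F : OpenPartialHomeomorph (Cot d M) (Rn d × Rn d)) (t : ℝ) (x : Cot d M) :
    TCot x →ₗ[ℝ] (Fin d → ℝ) :=
  pC F (φ t x) ∘ₗ (mfderiv (JCot d) (JCot d) (φ t) x).toLinearMap

lemma omega_push_eq (hF : IsVerticallyFoliated F) {t : ℝ} (hx : φ t x ∈ F.source)
    (u v : TCot x) :
    omega (φ t x) (mfderiv (JCot d) (JCot d) (φ t) x u) (mfderiv (JCot d) (JCot d) (φ t) x v) =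
      qAt φ F t x u ⬝ᵥ pAt φ F t x v - pAt φ F t x u ⬝ᵥ qAt φ F t x v :=
  omega_eq hF hx _ _

lemma qMat_dynFrame_mulVec (w : Fin d → TCot x) (t : ℝ) (u : Fin d → ℝ) :
    qMat F (dynFrame φ w t) *ᵥ u = qAt φ F t x (∑ i, u i • w i) := by
  refine (qMat_mulVec (x := φ t x) (fun i => rfl) u).trans ?_
  simp only [map_sum, map_smul]
  rfl

lemma pMat_dynFrame_mulVec (w : Fin d → TCot x) (t : ℝ) (u : Fin d → ℝ) :
    pMat F (dynFrame φ w t) *ᵥ u = pAt φ F t x (∑ i, u i • w i) := by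
  refine (pMat_mulVec (x := φ t x) (fun i => rfl) u).trans ?_
  simp only [map_sum, map_smul]
  rfl

/-- The modification of `w` by the combinations of the vectors `b` with coefficients `X`. -/
def addComb (w b : Fin d → TCot x) (X : Matrix (Fin d) (Fin d) ℝ) (i : Fin d) : TCot x :=
  w i + ∑ j, X j i • b j

lemma sum_smul_addComb (w b : Fin d → TCot x) (X : Matrix (Fin d) (Fin d) ℝ) (u : Fin d → ℝ) :
    ∑ i, u i • addComb w b X i = ∑ i, u i • w i + ∑ j, (X *ᵥ u) j • b j := by
  simp only [addComb, smul_add, Finset.sum_add_distrib, Finset.smul_sum, Matrix.mulVec, dotProduct,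
    Finset.sum_smul, smul_smul]
  rw [Finset.sum_comm]
  simp only [mul_comm]

lemma qMat_addComb (w b : Fin d → TCot x) (X : Matrix (Fin d) (Fin d) ℝ) (t : ℝ) :
    qMat F (dynFrame φ (addComb w b X) t) =
      qMat F (dynFrame φ w t) + qMat F (dynFrame φ b t) * X := by
  refine Matrix.ext_of_mulVec_single fun i => ?_
  rw [Matrix.add_mulVec, ← Matrix.mulVec_mulVec, qMat_dynFrame_mulVec, qMat_dynFrame_mulVec,
    qMat_dynFrame_mulVec, sum_smul_addComb, map_add]

lemma pMat_addComb (w b : Fin d → TCot x) (X : Matrix (Fin d) (Fin d) ℝ) (t : ℝ) :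
    pMat F (dynFrame φ (addComb w b X) t) =
      pMat F (dynFrame φ w t) + pMat F (dynFrame φ b t) * X := by
  refine Matrix.ext_of_mulVec_single fun i => ?_
  rw [Matrix.add_mulVec, ← Matrix.mulVec_mulVec, pMat_dynFrame_mulVec, pMat_dynFrame_mulVec,
    pMat_dynFrame_mulVec, sum_smul_addComb, map_add]

lemma linearIndependent_of_det_pMat_ne_zero {w : Fin d → TCot x} {t : ℝ}
    (h : (pMat F (dynFrame φ w t)).det ≠ 0) : LinearIndependent ℝ w := by
  rw [Fintype.linearIndependent_iff]
  intro u hu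
  have h1 := pMat_dynFrame_mulVec (φ := φ) (F := F) w t u
  rw [hu, map_zero] at h1
  exact congrFun (Matrix.eq_zero_of_mulVec_eq_zero h h1)

lemma exists_bound_of_mem_nhds_zero {O : Set (Matrix (Fin d) (Fin d) ℝ)} (hO : O ∈ 𝓝 0) :
    ∃ ε > 0, ∀ C : Matrix (Fin d) (Fin d) ℝ, (∀ i j, |C i j| < ε) → C ∈ O := by
  obtain ⟨ε, hε, h⟩ := Metric.mem_nhds_iff.1
    (show (O : Set (Fin d → Fin d → ℝ)) ∈ 𝓝 (0 : Fin d → Fin d → ℝ) from hO)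
  exact ⟨ε, hε, fun C hC => h ((dist_pi_lt_iff hε).2 fun i => (dist_pi_lt_iff hε).2 fun j => by
    simpa [Real.dist_eq] using hC i j)⟩

lemma continuous_addComb (w b : Fin d → TCot x) (P : Matrix (Fin d) (Fin d) ℝ) :
    Continuous fun C : Matrix (Fin d) (Fin d) ℝ => addComb w b (C * P) := by
  refine continuous_pi fun i => ?_
  refine continuous_const.add (continuous_finsetSum _ fun j _ => ?_)
  have h : Continuous fun C : Matrix (Fin d) (Fin d) ℝ => (C * P) j i :=
    (continuous_apply_apply j i).comp (continuous_id.matrix_mul continuous_const)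
  exact h.smul continuous_const

/-- A Lagrangian basis can be slightly perturbed, along vectors `b` that are horizontal at time `τ`,
so that its images cross the singular cycle transversally over a compact set of times. The
determinant of the position coordinates of the images is, up to nonzero factors, that of `Y t + C`,
where `Y` is a path of symmetric matrices and the symmetric matrix `C` is the perturbation. -/
lemma exists_perturbation (hφ : IsConformallySymplecticIsotopy φ)
    (hch : ∀ x : Cot d M, ∃ F, IsVerticallyFoliated F ∧ x ∈ F.source)
    (hF : IsVerticallyFoliated F) {I : Set ℝ} (hI : IsCompact I) {τ : ℝ}
    (hτ : φ τ x ∈ F.source) (hx : ∀ t ∈ I, φ t x ∈ F.source) {b : Fin d → TCot x}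
    (hbq : qMat F (dynFrame φ b τ) = 1) (hbp : pMat F (dynFrame φ b τ) = 0)
    (hb : ∀ t ∈ I, (qMat F (dynFrame φ b t)).det ≠ 0) {w : Fin d → TCot x}
    (hw : IsLagrangianBasis w) (hP : (pMat F (dynFrame φ w τ)).det ≠ 0)
    {O : Set (Fin d → TCot x)} (hO : O ∈ 𝓝 w) :
    ∃ w' ∈ O, IsLagrangianBasis w' ∧ HasSimpleDetZeros I fun t => qMat F (dynFrame φ w' t) := by
  set Q : ℝ → Matrix (Fin d) (Fin d) ℝ := fun t => qMat F (dynFrame φ w t) with hQ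
  set B : ℝ → Matrix (Fin d) (Fin d) ℝ := fun t => qMat F (dynFrame φ b t) with hB
  set P := pMat F (dynFrame φ w τ) with hPdef
  have hPu : IsUnit P.det := isUnit_iff_ne_zero.2 hP
  have hslope : IsSlope F (dynPath φ (spanAt w) τ) (Q τ * P⁻¹) :=
    isSlope_dynPath_spanAt hF.1 hw.1 hτ hP
  have hS : (Q τ * P⁻¹).IsSymm :=
    hslope.isSymm hF (isLagrangian_dynPath hφ hch hw.2 τ).isotropic
  have hO' := isOpen_setOf_mem_source hφ x F
  have hBd : ∀ t ∈ I, ∀ i j, DifferentiableAt ℝ (fun s => B s i j) t := fun t ht =>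
    differentiableAt_qMat_dynFrame hφ hF.1 b (hx t ht)
  have hBev : ∀ t ∈ I, ∀ᶠ s in 𝓝 t, (B s).det ≠ 0 := fun t ht =>
    (differentiableAt_det (hBd t ht)).continuousAt.eventually_ne (hb t ht)
  set Y : ℝ → Matrix (Fin d) (Fin d) ℝ := fun t => (B t)⁻¹ * Q t * P⁻¹ with hY
  have hBY : ∀ t, (B t).det ≠ 0 → B t * Y t = Q t * P⁻¹ := by
    intro t ht
    rw [hY]
    simp only [Matrix.mul_assoc]
    rw [← Matrix.mul_assoc (B t), Matrix.mul_nonsing_inv _ (isUnit_iff_ne_zero.2 ht),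
      Matrix.one_mul]
  -- For every `c`, the image at time `t` of the combination `u c` of `w` and `b` is vertical, so
  -- that `u c` and `u c'` are orthogonal for `ω`; read at time `τ`, this is the symmetry of `Y t`.
  have hYs : ∀ t, φ t x ∈ F.source → (B t).det ≠ 0 → (Y t).IsSymm := by
    intro t ht hBt
    let u : (Fin d → ℝ) → TCot x := fun c =>
      ∑ i, (P⁻¹ *ᵥ c) i • w i - ∑ j, (Y t *ᵥ c) j • b j
    have hq : ∀ c r, qAt φ F r x (u c) = (Q r * P⁻¹) *ᵥ c - (B r * Y t) *ᵥ c := by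
      intro c r
      rw [map_sub, ← qMat_dynFrame_mulVec, ← qMat_dynFrame_mulVec, Matrix.mulVec_mulVec,
        Matrix.mulVec_mulVec]
    have hp : ∀ c, pAt φ F τ x (u c) = c := by
      intro c
      rw [map_sub, ← pMat_dynFrame_mulVec, ← pMat_dynFrame_mulVec, hbp,
        Matrix.zero_mulVec, sub_zero, Matrix.mulVec_mulVec, ← hPdef, Matrix.mul_nonsing_inv _ hPu,
        Matrix.one_mulVec]
    have hqt : ∀ c, qAt φ F t x (u c) = 0 := by
      intro c
      rw [hq, hBY t hBt, sub_self]
    obtain ⟨a, ha, hconf⟩ := exists_conformal_factor_ne_zero hch (φ t) (hφ.2 t)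
    obtain ⟨a', -, hconf'⟩ := exists_conformal_factor_ne_zero hch (φ τ) (hφ.2 τ)
    refine isSymm_of_dotProduct_mulVec fun c c' => ?_
    have h1 : omega x (u c) (u c') = 0 := by
      have h2 := hconf x (u c) (u c')
      rw [omega_push_eq hF ht, hqt, hqt, zero_dotProduct, dotProduct_zero, sub_zero] at h2
      exact (mul_eq_zero.1 h2.symm).resolve_left ha
    have h3 := hconf' x (u c) (u c')
    have hBτ : B τ = 1 := hbq
    rw [h1, mul_zero, omega_push_eq hF hτ, hq, hq, hp, hp, hBτ, Matrix.one_mul, sub_dotProduct,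
      dotProduct_sub, dotProduct_mulVec_comm_of_isSymm hS] at h3
    linarith
  have hYd : ∀ t ∈ I, ∀ i j, DifferentiableAt ℝ (fun s => Y s i j) t := by
    intro t ht
    refine differentiableAt_mul_apply (differentiableAt_mul_apply
      (differentiableAt_inv_apply (hBd t ht) (hb t ht))
      (differentiableAt_qMat_dynFrame hφ hF.1 w (hx t ht))) fun i j => differentiableAt_const _
  have hO0 : {C : Matrix (Fin d) (Fin d) ℝ | addComb w b (C * P) ∈ O} ∈ 𝓝 0 := by
    refine (continuous_addComb w b P).continuousAt.preimage_mem_nhds ?_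
    have : addComb w b (0 * P) = w := by
      ext i
      simp [addComb]
    rwa [this]
  obtain ⟨ε, hε, hεO⟩ := exists_bound_of_mem_nhds_zero hO0
  obtain ⟨C, hCs, hCε, hC⟩ := exists_simple_zeros hI hYd (fun t ht => by
    filter_upwards [hBev t ht, hO'.mem_nhds (hx t ht)] with s h1 h2
    exact hYs s h2 h1) hε
  have hPτ : pMat F (dynFrame φ (addComb w b (C * P)) τ) = P := by
    rw [pMat_addComb, hbp, Matrix.zero_mul, add_zero]
  have hli : LinearIndependent ℝ (addComb w b (C * P)) :=
    linearIndependent_of_det_pMat_ne_zero (φ := φ) (F := F) (t := τ) (by rwa [hPτ])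
  refine ⟨addComb w b (C * P), hεO C hCε, ⟨hli, ?_⟩, ?_⟩
  · have h1 : IsSlope F (dynPath φ (spanAt (addComb w b (C * P))) τ) (Q τ * P⁻¹ + C) := by
      have h2 := isSlope_dynPath_spanAt (φ := φ) (t := τ) hF.1 hli hτ (by rwa [hPτ])
      rwa [hPτ, qMat_addComb, hbq, Matrix.one_mul, Matrix.add_mul, Matrix.mul_assoc C,
        Matrix.mul_nonsing_inv _ hPu, Matrix.mul_one] at h2
    obtain ⟨a, ha, hconf⟩ := exists_conformal_factor_ne_zero hch (φ τ) (hφ.2 τ)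
    exact isLagrangian_of_push (φ τ) ha hconf (h1.isLagrangian hF (hS.add hCs))
  · have hdet : ∀ s, (B s).det ≠ 0 → (qMat F (dynFrame φ (addComb w b (C * P)) s)).det =
        (B s).det * (Y s + C).det * P.det := by
      intro s hs
      rw [← Matrix.det_mul, ← Matrix.det_mul, qMat_addComb, Matrix.mul_add, hBY s hs,
        Matrix.add_mul, Matrix.mul_assoc (Q s), Matrix.nonsing_inv_mul _ hPu, Matrix.mul_one,
        Matrix.mul_assoc]
    intro t ht h0
    rw [hdet t (hb t ht)] at h0
    have h1 : (Y t + C).det = 0 :=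
      (mul_eq_zero.1 ((mul_eq_zero.1 h0).resolve_right hP)).resolve_left (hb t ht)
    have h2 := hC t ht h1
    have hYCd : DifferentiableAt ℝ (fun s => (Y s + C).det) t :=
      differentiableAt_det fun i j => (hYd t ht i j).add_const (C i j)
    have h3 := ((differentiableAt_det (hBd t ht)).hasDerivAt.mul hYCd.hasDerivAt).mul_const P.det
    rw [h1, mul_zero, zero_add] at h3
    have h4 : (fun s => (qMat F (dynFrame φ (addComb w b (C * P)) s)).det) =ᶠ[𝓝 t]
        fun s => (B s).det * (Y s + C).det * P.det := (hBev t ht).mono fun s hs => hdet s hs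
    rw [h4.deriv_eq]
    have h5 := h3.deriv
    exact fun h6 => mul_ne_zero (mul_ne_zero (hb t ht) h2) hP (h5.symm.trans h6)

lemma exists_mem_Icc_of_partition {T : ℕ → ℝ} {N : ℕ} {t : ℝ} (h0 : T 0 ≤ t)
    (hN : t ≤ T (N + 1)) : ∃ k ≤ N, t ∈ Icc (T k) (T (k + 1)) := by
  induction N with
  | zero => exact ⟨0, le_rfl, h0, hN⟩
  | succ N ih =>
    rcases le_total t (T (N + 1)) with h | h
    · obtain ⟨k, hk, hkt⟩ := ih h
      exact ⟨k, by omega, hkt⟩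
    · exact ⟨N + 1, le_rfl, h, hN⟩

/-- A dynamical path becomes in general position by a small change of its initial value. -/
lemma exists_inGeneralPosition (hφ : IsConformallySymplecticIsotopy φ) (h : TwistsVertical φ)
    {α β : ℝ} (hαβ : α ≤ β) {w₀ : Fin d → TCot x} (hw₀ : IsLagrangianBasis w₀)
    (hα : ¬ (dynPath φ (spanAt w₀) α).Singular) (hβ : ¬ (dynPath φ (spanAt w₀) β).Singular)
    {O : Set (Fin d → TCot x)} (hO : O ∈ 𝓝 w₀) :
    ∃ w ∈ O, IsLagrangianBasis w ∧
      InGeneralPosition α β (dynFrame φ w) (dynPath φ (spanAt w)) := by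
  have hch := h.exists_mem_source
  have hfr := isContFrame_dynFrame hφ h (L := spanAt w₀) hw₀.2 hw₀.1 rfl univ
  have hdet : ∀ {F : OpenPartialHomeomorph (Cot d M) (Rn d × Rn d)} {t S},
      IsVerticallyFoliated F → IsSlope F (dynPath φ (spanAt w₀) t) S →
        (pMat F (dynFrame φ w₀ t)).det ≠ 0 := fun hF hS =>
    hS.det_pMat_ne_zero hF.1 (hfr.frame _ trivial)
  -- Near each time there is a chart that gives a slope to the path, and tangent vectors `b` that are
  -- horizontal in this chart at this time.
  have hbase : ∀ t : ℝ, ∃ (F : OpenPartialHomeomorph (Cot d M) (Rn d × Rn d))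
      (b : Fin d → TCot x), IsVerticallyFoliated F ∧ φ t x ∈ F.source ∧
        (pMat F (dynFrame φ w₀ t)).det ≠ 0 ∧ qMat F (dynFrame φ b t) = 1 ∧
        pMat F (dynFrame φ b t) = 0 := by
    intro t
    obtain ⟨F, S, hF, hS⟩ := h.exists_isSlope (isLagrangian_dynPath hφ hch hw₀.2 t)
    have hx : φ t x ∈ F.source := hS.1
    let A := (φ t).mfderivToContinuousLinearEquiv (by simp) x
    let b : Fin d → TCot x := fun j =>
      A.symm ((coordEquiv hF.1 hx).symm (Pi.single j 1, 0))
    have hA : ∀ j, mfderiv (JCot d) (JCot d) (φ t) x (b j) =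
        (coordEquiv hF.1 hx).symm (Pi.single j 1, 0) := fun j => A.apply_symm_apply _
    refine ⟨F, b, hF, hx, hdet hF hS, ?_, ?_⟩
    · ext i j
      have h1 : qMat F (dynFrame φ b t) i j =
        qC F (φ t x) (mfderiv (JCot d) (JCot d) (φ t) x (b j)) i := rfl
      rw [h1, hA, qC_symm, Matrix.one_apply]
      exact Pi.single_apply j (1 : ℝ) i
    · ext i j
      have h1 : pMat F (dynFrame φ b t) i j =
        pC F (φ t x) (mfderiv (JCot d) (JCot d) (φ t) x (b j)) i := rfl
      rw [h1, hA, pC_symm]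
      rfl
  choose F b hF hx hP hbq hbp using hbase
  have hcont := continuous_dynFrame hφ x
  have hPc : ∀ {F : OpenPartialHomeomorph (Cot d M) (Rn d × Rn d)} {t : ℝ},
      IsVerticallyFoliated F → φ t x ∈ F.source →
        ContinuousAt (fun z : (Fin d → TCot x) × ℝ => (pMat F (dynFrame φ z.1 z.2)).det)
          (w₀, t) := by
    intro F t hF ht
    have h1 : ContinuousAt (pMat F) (dynFrame φ w₀ t) := continuousAt_pMat hF.1 fun _ => ht
    have h2 : ContinuousAt (fun z : (Fin d → TCot x) × ℝ => dynFrame φ z.1 z.2) (w₀, t) :=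
      hcont.continuousAt
    have h3 : ContinuousAt (fun z : (Fin d → TCot x) × ℝ => pMat F (dynFrame φ z.1 z.2)) (w₀, t) :=
      ContinuousAt.comp (g := pMat F)
        (f := fun z : (Fin d → TCot x) × ℝ => dynFrame φ z.1 z.2) h1 h2
    exact (continuous_id.matrix_det).continuousAt.comp h3
  have hQc : ∀ {F : OpenPartialHomeomorph (Cot d M) (Rn d × Rn d)} {t : ℝ} (v : Fin d → TCot x),
      IsVerticallyFoliated F → φ t x ∈ F.source →
        ContinuousAt (fun z : (Fin d → TCot x) × ℝ => (qMat F (dynFrame φ z.1 z.2)).det)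
          (v, t) := by
    intro F t v hF ht
    have h1 : ContinuousAt (qMat F) (dynFrame φ v t) := continuousAt_qMat hF.1 fun _ => ht
    have h2 : ContinuousAt (fun z : (Fin d → TCot x) × ℝ => dynFrame φ z.1 z.2) (v, t) :=
      hcont.continuousAt
    have h3 : ContinuousAt (fun z : (Fin d → TCot x) × ℝ => qMat F (dynFrame φ z.1 z.2)) (v, t) :=
      ContinuousAt.comp (g := qMat F)
        (f := fun z : (Fin d → TCot x) × ℝ => dynFrame φ z.1 z.2) h1 h2
    exact (continuous_id.matrix_det).continuousAt.comp h3
  obtain ⟨T, N, hT, hT0, hTN, hTI, hTV⟩ := exists_partition hαβ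
    (V := fun τ => {t | φ t x ∈ (F τ).source ∧ (pMat (F τ) (dynFrame φ w₀ t)).det ≠ 0 ∧
      (qMat (F τ) (dynFrame φ (b τ) t)).det ≠ 0}) (by
      intro τ _
      refine mem_nhdsWithin_of_mem_nhds (inter_mem
        ((isOpen_setOf_mem_source hφ x (F τ)).mem_nhds (hx τ)) (inter_mem ?_ ?_))
      · have h1 := ContinuousAt.comp (f := fun t : ℝ => (w₀, t)) (hPc (hF τ) (hx τ))
          (continuous_const.prodMk continuous_id).continuousAt
        exact h1.eventually_ne (hP τ)
      · have h1 := ContinuousAt.comp (f := fun t : ℝ => (b τ, t)) (hQc (b τ) (hF τ) (hx τ))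
          (continuous_const.prodMk continuous_id).continuousAt
        refine h1.eventually_ne ?_
        change (qMat (F τ) (dynFrame φ (b τ) τ)).det ≠ 0
        rw [hbq, Matrix.det_one]
        exact one_ne_zero)
  choose τ hτI hτ using hTV
  have hnear : ∀ k, ∀ᶠ w in 𝓝 w₀, (pMat (F (τ k)) (dynFrame φ w (τ k))).det ≠ 0 ∧
      ∀ t ∈ Icc (T k) (T (k + 1)), (pMat (F (τ k)) (dynFrame φ w t)).det ≠ 0 := by
    intro k
    refine Eventually.and ?_ ?_
    · have h1 := ContinuousAt.comp (f := fun w : Fin d → TCot x => (w, τ k))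
        (hPc (hF (τ k)) (hx (τ k))) (continuous_id.prodMk continuous_const).continuousAt
      exact h1.eventually_ne (hP (τ k))
    · refine isCompact_Icc.eventually_forall_of_forall_eventually fun t ht => ?_
      obtain ⟨h1, h2, -⟩ := hτ k ht
      exact (hPc (hF (τ k)) h1).eventually_ne h2
  -- Each endpoint stays out of the singular cycle.
  have hend : ∀ t, ¬ (dynPath φ (spanAt w₀) t).Singular →
      ∀ᶠ w in 𝓝 w₀, LinearIndependent ℝ w → ¬ (dynPath φ (spanAt w) t).Singular := by
    intro t hns
    have h1 : ∀ᶠ w in 𝓝 w₀, (pMat (F t) (dynFrame φ w t)).det ≠ 0 :=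
      (ContinuousAt.comp (f := fun w : Fin d → TCot x => (w, t))
        (hPc (hF t) (hx t)) (continuous_id.prodMk continuous_const).continuousAt).eventually_ne
          (hP t)
    have h2 : ∀ᶠ w in 𝓝 w₀, (qMat (F t) (dynFrame φ w t)).det ≠ 0 :=
      (ContinuousAt.comp (f := fun w : Fin d → TCot x => (w, t))
        (hQc w₀ (hF t) (hx t)) (continuous_id.prodMk continuous_const).continuousAt).eventually_ne
          fun h0 => hns ((singular_dynPath_spanAt_iff (hF t) hw₀.1 (hx t) (hP t)).2 h0)
    filter_upwards [h1, h2] with w h3 h4 h5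
    rw [singular_dynPath_spanAt_iff (hF t) h5 (hx t) h3]
    exact h4
  -- The intervals of the partition are treated one after the other; the property obtained on the
  -- previous ones is stable under small perturbations.
  have hind : ∀ k, ∀ O ∈ 𝓝 w₀, ∃ w ∈ O, IsLagrangianBasis w ∧ ∀ j < k,
      HasSimpleDetZeros (Icc (T j) (T (j + 1))) fun t => qMat (F (τ j)) (dynFrame φ w t) := by
    intro k
    induction k with
    | zero => exact fun O hO => ⟨w₀, mem_of_mem_nhds hO, hw₀, fun j hj => absurd hj (by omega)⟩
    | succ k ih =>
      intro O hO
      obtain ⟨O', hO', hO'o, hwO'⟩ := mem_nhds_iff.1 (inter_mem hO (hnear k))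
      obtain ⟨w, hw, hwL, hwj⟩ := ih O' (hO'o.mem_nhds hwO')
      have h1 : ∀ᶠ w' in 𝓝 w, ∀ j ∈ Iio k, HasSimpleDetZeros (Icc (T j) (T (j + 1)))
          fun t => qMat (F (τ j)) (dynFrame φ w' t) := by
        refine ((Set.finite_Iio k).eventually_all (l := 𝓝 w) (p := fun j w' =>
          HasSimpleDetZeros (Icc (T j) (T (j + 1))) fun t =>
            qMat (F (τ j)) (dynFrame φ w' t))).2 fun j hj => ?_
        exact eventually_hasSimpleDetZeros_dynFrame hφ (hF _).1 isCompact_Icc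
          (fun t ht => (hτ j ht).1) (hwj j hj)
      obtain ⟨w', hw', hwL', hwk⟩ := exists_perturbation hφ hch (hF (τ k)) isCompact_Icc
        (hx (τ k)) (fun t ht => (hτ k ht).1) (hbq (τ k)) (hbp (τ k)) (fun t ht => (hτ k ht).2.2)
        hwL (hO' hw).2.1 (inter_mem (hO'o.mem_nhds hw) h1)
      refine ⟨w', (hO' hw'.1).1, hwL', fun j hj => ?_⟩
      rcases Nat.lt_succ_iff_lt_or_eq.1 hj with hj' | rfl
      · exact hw'.2 j hj'
      · exact hwk
  have hnear' := ((Set.finite_Iic N).eventually_all (l := 𝓝 w₀) (p := fun k w =>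
    (pMat (F (τ k)) (dynFrame φ w (τ k))).det ≠ 0 ∧
      ∀ t ∈ Icc (T k) (T (k + 1)), (pMat (F (τ k)) (dynFrame φ w t)).det ≠ 0)).2
    fun k _ => hnear k
  obtain ⟨w, ⟨⟨hwO, hwn⟩, hwα, hwβ⟩, hwL, hwj⟩ := hind (N + 1) _
    (inter_mem (inter_mem hO hnear') (inter_mem (hend α hα) (hend β hβ)))
  refine ⟨w, hwO, hwL, isLagrangianFrame_dynFrame hφ hch hwL.2 hwL.1 rfl α β, hwα hwL.1,
    hwβ hwL.1, fun t ht hsing => ?_⟩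
  obtain ⟨k, hk, hkt⟩ := exists_mem_Icc_of_partition (T := T) (N := N) (t := t)
    (by rw [hT0]; exact ht.1) (by rw [hTN]; exact ht.2)
  have hfw := isContFrame_dynFrame hφ h (L := spanAt w) hwL.2 hwL.1 rfl univ
  have hxt := (hτ k hkt).1
  have hPt := (hwn k hk).2 t hkt
  have h0 : (qMat (F (τ k)) (dynFrame φ w t)).det = 0 :=
    (singular_dynPath_spanAt_iff (hF (τ k)) hwL.1 hxt hPt).1 hsing
  exact hfw.isCrossing_of_simple_zero univ_mem (hF (τ k)) hxt hPt
    (differentiableAt_qMat_dynFrame hφ (hF (τ k)).1 w hxt)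
    (differentiableAt_pMat_dynFrame hφ (hF (τ k)).1 w hxt) h0 (hwj k (by omega) t hkt h0)

end GeneralPosition

/-! ### The Maslov index of a dynamical path -/

section Maslov

variable {d : ℕ} {M : Type*} [TopologicalSpace M] [ChartedSpace (Rn d) M]
  [IsManifold 𝓘(ℝ, Rn d) ∞ M]
  {φ : ℝ → Diffeomorph (JCot d) (JCot d) (Cot d M) (Cot d M) ∞}

lemma IsLagrangianFrame.of_le {k l : ℕ∞ω} (hkl : k ≤ l) {α β : ℝ} {e : ℝ → Fin d → TTCot d M}
    {Γ : ℝ → SubspaceAt d M} (h : IsLagrangianFrame l α β e Γ) : IsLagrangianFrame k α β e Γ :=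
  ⟨h.1, h.2.1.of_le hkl, fun i => (h.2.2.1 i).of_le hkl, h.2.2.2⟩

lemma mem_of_mem_c1Nhds {α β : ℝ} {e : ℝ → Fin d → TTCot d M} {S : Set (ℝ → Fin d → TTCot d M)}
    (hS : S ∈ c1Nhds α β e) : e ∈ S := by
  exact (@pure_le_nhds _ (TopologicalSpace.generateFrom _) e) hS

/-- A dynamical path has only negative crossings. -/
lemma signedCrossings_dynPath_le_zero (hφ : IsConformallySymplecticIsotopy φ)
    (h : TwistsVertical φ) {L : SubspaceAt d M} (hL : L.IsLagrangian) (α β : ℝ) :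
    signedCrossings α β (dynPath φ L) ≤ 0 := by
  have h0 : {t ∈ Icc α β | IsPositiveCrossing (dynPath φ L) t} = ∅ :=
    eq_empty_of_forall_notMem fun t ht => not_isPositiveCrossing_dynPath hφ h hL t ht.2
  rw [signedCrossings, h0, ncard_empty]
  simp

/-- Arbitrarily close to a dynamical path there are dynamical paths in general position. -/
lemma frequently_inGeneralPosition (hφ : IsConformallySymplecticIsotopy φ) (h : TwistsVertical φ)
    {α β : ℝ} (hαβ : α ≤ β) {x : Cot d M} {w : Fin d → TCot x} (hw : IsLagrangianBasis w)
    (hα : ¬ (dynPath φ (spanAt w) α).Singular) (hβ : ¬ (dynPath φ (spanAt w) β).Singular) :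
    ∃ᶠ e in c1Nhds α β (dynFrame φ w), ∃ L : SubspaceAt d M, L.IsLagrangian ∧
      InGeneralPosition α β e (dynPath φ L) := by
  rcases hαβ.eq_or_lt with rfl | hlt
  · refine fun hev => mem_of_mem_c1Nhds hev ⟨spanAt w, hw.2,
      isLagrangianFrame_dynFrame hφ h.exists_mem_source hw.2 hw.1 rfl α α, hα, hα,
        fun t ht hs => ?_⟩
    rw [Icc_self, mem_singleton_iff] at ht
    exact absurd (ht ▸ hs) hα
  · refine (tendsto_dynFrame hφ hlt w).frequently (frequently_iff.2 fun hO => ?_)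
    obtain ⟨w', hwO, hwL, hgp⟩ := exists_inGeneralPosition hφ h hαβ hw hα hβ hO
    exact ⟨w', hwO, spanAt w', hwL.2, hgp⟩

lemma exists_hasMaslovIndex_dynPath (hφ : IsConformallySymplecticIsotopy φ)
    (h : TwistsVertical φ) {L : SubspaceAt d M} (hL : L.IsLagrangian) {α β : ℝ} (hαβ : α ≤ β)
    (hα : ¬ (dynPath φ L α).Singular) (hβ : ¬ (dynPath φ L β).Singular) :
    ∃ m ≤ 0, ∀ m', HasMaslovIndex α β (dynPath φ L) m' ↔ m' = m := by
  obtain ⟨x, V⟩ := L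
  obtain ⟨w, hw, hs⟩ : ∃ w : Fin d → TCot x, LinearIndependent ℝ w ∧
    Submodule.span ℝ (range w) = V := h.exists_basis hL
  subst hs
  have hwL : IsLagrangianBasis w := ⟨hw, hL⟩
  obtain ⟨m, hm⟩ := exists_signedCrossings_eq hαβ
    (isContFrame_dynFrame hφ h hL hw rfl (Icc α β)) hα hβ
    fun t _ => h.exists_isSlope (isLagrangian_dynPath hφ h.exists_mem_source hL t)
  have hfreq := frequently_inGeneralPosition hφ h hαβ hwL hα hβ
  have hmw := hm _ (isContFrame_dynFrame hφ h hL hw rfl (Icc α β))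
  refine ⟨m, ?_, fun m' => ⟨?_, ?_⟩⟩
  · obtain ⟨e, ⟨L', hL', hgp⟩, he⟩ := (hfreq.and_eventually hmw).exists
    rw [← he _ hgp.hasGoodCrossings]
    exact signedCrossings_dynPath_le_zero hφ h hL' α β
  · rintro ⟨-, -, e', he', hf, hev⟩
    obtain ⟨e, ⟨⟨Γ', hgp⟩, h1⟩, h2⟩ :=
      ((hf.and_eventually hev).and_eventually (hm e' he'.isContFrame)).exists
    rw [← h1 _ hgp, h2 _ hgp.hasGoodCrossings]
  · rintro rfl
    exact ⟨hα, hβ, dynFrame φ w,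
      (isLagrangianFrame_dynFrame hφ h.exists_mem_source hL hw rfl α β).of_le (by norm_num),
      hfreq.mono fun e ⟨L', _, hgp⟩ => ⟨_, hgp⟩,
      hmw.mono fun e he Γ' hgp => he Γ' hgp.hasGoodCrossings⟩

end Maslov

end CotangentMaslov

end

open CotangentMaslov in
theorem mainTheorem10 {d : ℕ} {M : Type*} [TopologicalSpace M] [ChartedSpace (Rn d) M]
    [IsManifold 𝓘(ℝ, Rn d) ∞ M] [T2Space M] [CompactSpace M]
    (φ : ℝ → Diffeomorph (JCot d) (JCot d) (Cot d M) (Cot d M) ∞)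
    (hφ : IsConformallySymplecticIsotopy φ) (htwist : TwistsVertical φ)
    (L : SubspaceAt d M) (hL : L.IsLagrangian) (α β : ℝ) (hαβ : α ≤ β)
    (hα : ¬ (L.push (φ α)).Singular) (hβ : ¬ (L.push (φ β)).Singular) :
    HasMaslovIndex α β (dynPath φ L) (dynMaslovIndex φ L α β) ∧
      dynMaslovIndex φ L α β ≤ 0 := by
  obtain ⟨m, hm0, hm⟩ := exists_hasMaslovIndex_dynPath hφ htwist hL hαβ hα hβ
  have h : HasMaslovIndex α β (dynPath φ L) (dynMaslovIndex φ L α β) :=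
    Classical.epsilon_spec (p := HasMaslovIndex α β (dynPath φ L)) ⟨m, (hm m).2 rfl⟩
  exact ⟨h, ((hm _).1 h).trans_le hm0⟩
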